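/- Let $A,Q\in\mathbb C^{n\times n}$ with $Q=Q^*$, $B,C\in\mathbb C^{n\times m}$, $R\in\mathbb C^{m\times m}$. Consider the Lur'e equations $$A^*X+XA+Q=K^*K,\qquad XB+C=K^*L,\qquad R=L^*L,$$ with $X=X^*$ and $K,L$ having $p$ rows, where $p$ is as small as possible; $X$ is called a solution if they hold for some $K,L$ with this minimal $p$. Let $\mathcal S$ be the set of Hermitian $Y$ with $\begin{bmatrix}A^*Y+YA+Q&YB+C\\B^*Y+C^*&R\end{bmatrix}\ge 0$. A maximal solution is a solution $X$ of the Lur'e equations with $Y\le X$ for all $Y\in\mathcal S$. Let $$s\mathcal E-\mathcal A=\begin{bmatrix}0&-sI+A&B\\ sI+A^*&Q&C\\ B^*&C^*&R\end{bmatrix}.$$ Assume that $(A,B)$ is stabilizable (i.e. $\operatorname{rank}[sI-A,\,B]=n$ whenever $\operatorname{Re}s\ge0$), that $s\mathcal E-\mathcal A$ is regular (its determinant is not identically zero), that $\mathcal S\neq\emptyset$, and that $\gamma>0$ is such that $$T_-:=\begin{bmatrix}0&A-\gamma I&B\\A^*-\gamma I&Q&C\\B^*&C^*&R\end{bmatrix}$$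 is nonsingular. Put $$T_+:=\begin{bmatrix}0&A+\gamma I&B\\A^*+\gamma I&Q&C\\B^*&C^*&R\end{bmatrix},$$ write the leading $2n\times2n$ block of $T_-^{-1}T_+$ as $\begin{bmatrix}E&-\widehat G\\-\widehat H&\widehat F\end{bmatrix}$ with $n\times n$ blocks, and define the reduced pencil $$s\mathcal E_r-\mathcal A_r:=s\begin{bmatrix}I_n&-\widehat G\\0&\widehat F\end{bmatrix}-\begin{bmatrix}E&0\\-\widehat H&I_n\end{bmatrix}.$$ Conventions. A subspace $\mathcal V$ is a deflating subspace of a pencil $sE-A$ if for a full-column-rank matrix $V$ with $k$ columns spanning $\mathcal V$ one has $(sE-A)V=W(s\widetilde E-\widetilde A)$ for some $W$ and some $l\times k$ pencil $s\widetilde E-\widetilde A$ with $l\le k$; it is c-semi-stable if all finite eigenvalues of $s\widetilde E-\widetilde A$ have real part $\le0$. It is $\mathcal E$-neutral if $x^*\mathcal Ey=0$ for all $x,y\in\mathcal V$. A $2n\times 2n$ pencil $sE-A$ is symplectic if $EJE^*=AJA^*$ with $J=\begin{bmatrix}0&I_n\\-I_n&0\end{bmatrix}$. A regular $2n\times2n$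 pencil is weakly d-split (with dimensions $n,n$) if for some $r$ the lengths of its Kronecker chains for eigenvalues $|\lambda|<1$ sum to $n-r$, those for $|\lambda|>1$ (including $\lambda=\infty$) sum to $n-r$, and every chain for an eigenvalue $|\lambda|=1$ has even length. Its canonical d-semi-unstable subspace is then the span of all chains for $|\lambda|>1$ (including $\infty$) and of the first half of each chain for $|\lambda|=1$. Then: 1. There are an invertible matrix $P$ and matrices $Z_1,Z_2\in\mathbb C^{m\times 2n}$ such that the Cayley transform $s(\mathcal A+\gamma\mathcal E)-(\mathcal A-\gamma\mathcal E)$ satisfies $$P\bigl(s(\mathcal A+\gamma\mathcal E)-(\mathcal A-\gamma\mathcal E)\bigr)=\begin{bmatrix}s\mathcal E_r-\mathcal A_r&0\\ sZ_1-Z_2&(s-1)I_m\end{bmatrix},$$ so the reduced pencil is obtained by removing $m$ eigenvalues $1$, which come from the eigenvalue $\infty$ of $s\mathcal E-\mathcal A$. 2. The reduced pencil is symplectic and weakly d-split (with dimensions $n,n$), and its canonical d-semi-unstable subspace is the column span of some $V_1\in\mathbb C^{2n\times n}$. 3. The pencil $s\mathcal E-\mathcal A$ has exactly one $(n+m)$-dimensional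 c-semi-stable $\mathcal E$-neutral deflating subspace $\mathcal V$. For every $V_1\in\mathbb C^{2n\times n}$ spanning the canonical d-semi-unstable subspace of the reduced pencil there is $V_2\in\mathbb C^{m\times n}$ with $$\mathcal V=\operatorname{span}\begin{bmatrix}V_1&0\\V_2&I_m\end{bmatrix}.$$ Moreover, if $\operatorname{span}V_1$ has a basis of the form $\begin{bmatrix}X_+\\I_n\end{bmatrix}$, then $X_+$ is the maximal solution of the Lur'e equations. -/

import Mathlib

open Matrix
open scoped ComplexOrder

noncomputable section

namespace Lure

/-! ### Matrix pencils `s E - A` -/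

/-- A square pencil `s E - A` is regular if it has full normal rank, i.e. `det (s E - A)` does not
vanish identically in `s`. -/
def IsRegular {ι : Type*} [Fintype ι] [DecidableEq ι] (E A : Matrix ι ι ℂ) : Prop :=
  ∃ s : ℂ, (s • E - A).det ≠ 0

/-- `z` is a (finite generalized) eigenvalue of the possibly rectangular pencil `s E - A`:
the rank of `z E - A` is smaller than the normal rank of the pencil. -/
def IsEigenvalue {ι κ : Type*} [Fintype ι] [Fintype κ] (E A : Matrix ι κ ℂ) (z : ℂ) : Prop :=
  ∃ s : ℂ, (z • E - A).rank < (s • E - A).rank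

/-- The span of the columns of a matrix. -/
def colSpan {ι κ : Type*} [Fintype κ] (V : Matrix ι κ ℂ) : Submodule ℂ (ι → ℂ) :=
  LinearMap.range V.mulVecLin

/-- The data `V`, `W`, `s Et - At` exhibit the column span of `V` as a (right) deflating subspace of
`s E - A`: `V` has full column rank, `l ≤ k`, and `(s E - A) V = W (s Et - At)` for all `s`. -/
def IsDeflatingData {ι : Type*} [Fintype ι] (E A : Matrix ι ι ℂ) {k l : ℕ}
    (V : Matrix ι (Fin k) ℂ) (W : Matrix ι (Fin l) ℂ) (Et At : Matrix (Fin l) (Fin k) ℂ) : Prop :=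
  l ≤ k ∧ V.rank = k ∧ ∀ s : ℂ, (s • E - A) * V = W * (s • Et - At)

/-- `𝒱` is a c-semi-stable (right) deflating subspace of `s E - A`: it is deflating, and every
finite eigenvalue of the pencil `s Et - At` it carries has non-positive real part
(infinite eigenvalues are allowed). -/
def IsCSemiStableDeflating {ι : Type*} [Fintype ι] (E A : Matrix ι ι ℂ)
    (𝒱 : Submodule ℂ (ι → ℂ)) : Prop :=
  ∃ (k l : ℕ) (V : Matrix ι (Fin k) ℂ) (W : Matrix ι (Fin l) ℂ) (Et At : Matrix (Fin l) (Fin k) ℂ),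
    IsDeflatingData E A V W Et At ∧ colSpan V = 𝒱 ∧ ∀ z : ℂ, IsEigenvalue Et At z → z.re ≤ 0

/-- `𝒱` is `M`-neutral: `x* M y = 0` for all `x, y ∈ 𝒱`. -/
def IsNeutral {ι : Type*} [Fintype ι] (M : Matrix ι ι ℂ) (𝒱 : Submodule ℂ (ι → ℂ)) : Prop :=
  ∀ x ∈ 𝒱, ∀ y ∈ 𝒱, star x ⬝ᵥ (M *ᵥ y) = 0

/-- A `2n × 2n` pencil `s E - A` is symplectic if `E J E* = A J A*`, `J = [[0, I], [-I, 0]]`. -/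
def IsSymplectic {n : ℕ} (E A : Matrix (Fin n ⊕ Fin n) (Fin n ⊕ Fin n) ℂ) : Prop :=
  E * fromBlocks 0 1 (-1) 0 * Eᴴ = A * fromBlocks 0 1 (-1) 0 * Aᴴ

/-- The Cayley transform of `s E - A` is `s (cayleyE γ E A) - cayleyA γ E A`. -/
def cayleyE {ι : Type*} (γ : ℝ) (E A : Matrix ι ι ℂ) : Matrix ι ι ℂ := A + (γ : ℂ) • E

/-- See `cayleyE`. -/
def cayleyA {ι : Type*} (γ : ℝ) (E A : Matrix ι ι ℂ) : Matrix ι ι ℂ := A - (γ : ℂ) • E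

/-! ### Kronecker canonical form of a regular pencil -/

/-- The nilpotent matrix with ones on the first superdiagonal. -/
def shift (k : ℕ) : Matrix (Fin k) (Fin k) ℂ :=
  Matrix.of fun i j => if (i : ℕ) + 1 = (j : ℕ) then 1 else 0

/-- The blocks that occur in the Kronecker canonical form of a regular pencil (the rectangular
blocks of the general form only occur for singular pencils): `w1 k ev` is `(s - ev) I - N`,
belonging to the eigenvalue `ev`, and `w2 k` is `s N - I`, belonging to the eigenvalue infinity,
both of size `k ≥ 1`. -/
inductive KBlock : Type
  | w1 (k : ℕ+) (ev : ℂ) : KBlock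
  | w2 (k : ℕ+) : KBlock

namespace KBlock

/-- The length of the Kronecker chain. -/
def size : KBlock → ℕ
  | w1 k _ => k
  | w2 k => k

/-- The coefficient of `s` in the block. -/
def matE : (b : KBlock) → Matrix (Fin b.size) (Fin b.size) ℂ
  | w1 _ _ => 1
  | w2 k => shift k

/-- Minus the constant coefficient of the block. -/
def matA : (b : KBlock) → Matrix (Fin b.size) (Fin b.size) ℂ
  | w1 k ev => (ev • (1 : Matrix (Fin k) (Fin k) ℂ) + shift k : Matrix (Fin k) (Fin k) ℂ)
  | w2 _ => 1

/-- The eigenvalue of the block lies inside the unit circle. -/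
def DStable : KBlock → Prop
  | w1 _ ev => ‖ev‖ < 1
  | w2 _ => False

/-- The eigenvalue of the block lies on the unit circle. -/
def DCritical : KBlock → Prop
  | w1 _ ev => ‖ev‖ = 1
  | w2 _ => False

/-- The eigenvalue of the block lies outside the unit circle (infinity included). -/
def DUnstable : KBlock → Prop
  | w1 _ ev => 1 < ‖ev‖
  | w2 _ => True

end KBlock

/-- A Kronecker canonical form `Ul (s E - A) Ur = diag (C_1(s), …, C_k(s))`, with `Ul`, `Ur`
invertible, of a regular pencil `s E - A`. The columns `Ur (·, ⟨j, 0⟩), Ur (·, ⟨j, 1⟩), …`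
are the Kronecker chain of the `j`-th block. -/
structure KroneckerForm {ι : Type*} [Fintype ι] [DecidableEq ι] (E A : Matrix ι ι ℂ) where
  /-- number of blocks -/
  count : ℕ
  /-- the blocks -/
  block : Fin count → KBlock
  /-- left transformation -/
  Ul : Matrix (Σ j, Fin (block j).size) ι ℂ
  /-- right transformation -/
  Ur : Matrix ι (Σ j, Fin (block j).size) ℂ
  Ul_invertible : ∃ T : Matrix ι (Σ j, Fin (block j).size) ℂ, Ul * T = 1 ∧ T * Ul = 1
  Ur_invertible : ∃ T : Matrix (Σ j, Fin (block j).size) ι ℂ, Ur * T = 1 ∧ T * Ur = 1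
  eq_E : Ul * E * Ur = blockDiagonal' fun j => (block j).matE
  eq_A : Ul * A * Ur = blockDiagonal' fun j => (block j).matA

namespace KroneckerForm

variable {ι : Type*} [Fintype ι] [DecidableEq ι] {E A : Matrix ι ι ℂ}

open Classical in
/-- The chain lengths satisfy the conditions of a weakly d-split pencil with dimensions `N`, `M`. -/
def WeaklyDSplit (K : KroneckerForm E A) (N M : ℕ) : Prop :=
  ∃ r : ℕ,
    (∑ j, if (K.block j).DStable then (K.block j).size else 0) + r = N ∧
    (∑ j, if (K.block j).DUnstable then (K.block j).size else 0) + r = M ∧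
    ∀ j, (K.block j).DCritical → Even (K.block j).size

/-- The span of all Kronecker chains relative to d-unstable eigenvalues and of the first half of
each Kronecker chain relative to a d-critical eigenvalue. -/
def dSemiUnstableSpan (K : KroneckerForm E A) : Submodule ℂ (ι → ℂ) :=
  Submodule.span ℂ {v | ∃ (j : Fin K.count) (i : Fin (K.block j).size),
    ((K.block j).DUnstable ∨ ((K.block j).DCritical ∧ (i : ℕ) < (K.block j).size / 2)) ∧
    v = fun a => K.Ur a ⟨j, i⟩}

end KroneckerForm

/-- The pencil `s E - A` is weakly d-split with dimensions `N`, `M`. -/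
def IsWeaklyDSplit {ι : Type*} [Fintype ι] [DecidableEq ι] (E A : Matrix ι ι ℂ) (N M : ℕ) : Prop :=
  ∃ K : KroneckerForm E A, K.WeaklyDSplit N M

/-- `𝒲` is the canonical d-semi-unstable subspace of the weakly d-split pencil `s E - A`,
read off from some Kronecker canonical form. -/
def IsCanonicalDSemiUnstable {ι : Type*} [Fintype ι] [DecidableEq ι] (E A : Matrix ι ι ℂ)
    (N M : ℕ) (𝒲 : Submodule ℂ (ι → ℂ)) : Prop :=
  ∃ K : KroneckerForm E A, K.WeaklyDSplit N M ∧ K.dSemiUnstableSpan = 𝒲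

/-! ### Lur'e equations -/

section

variable {n m : ℕ}

/-- `(A, B)` is stabilizable: `rank [s I - A, B] = n` for all `s` in the closed right
half-plane. -/
def Stabilizable (A : Matrix (Fin n) (Fin n) ℂ) (B : Matrix (Fin n) (Fin m) ℂ) : Prop :=
  ∀ s : ℂ, 0 ≤ s.re → (fromCols (s • (1 : Matrix (Fin n) (Fin n) ℂ) - A) B).rank = n

variable (A Q : Matrix (Fin n) (Fin n) ℂ) (B C : Matrix (Fin n) (Fin m) ℂ)
  (R : Matrix (Fin m) (Fin m) ℂ)

/-- The Lur'e equations for `(X, K, L)`, with `X` Hermitian. -/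
def LureEq {p : ℕ} (X : Matrix (Fin n) (Fin n) ℂ) (K : Matrix (Fin p) (Fin n) ℂ)
    (L : Matrix (Fin p) (Fin m) ℂ) : Prop :=
  X.IsHermitian ∧ Aᴴ * X + X * A + Q = Kᴴ * K ∧ X * B + C = Kᴴ * L ∧ R = Lᴴ * L

/-- `X` is a solution of the Lur'e equations: they hold for some `K`, `L` with `p` rows, where
`p` is the smallest number for which the equations can be solved at all. -/
def IsLureSolution (X : Matrix (Fin n) (Fin n) ℂ) : Prop :=
  ∃ p : ℕ,
    (∃ (K : Matrix (Fin p) (Fin n) ℂ) (L : Matrix (Fin p) (Fin m) ℂ), LureEq A Q B C R X K L) ∧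
    ∀ (q : ℕ) (X' : Matrix (Fin n) (Fin n) ℂ) (K' : Matrix (Fin q) (Fin n) ℂ)
      (L' : Matrix (Fin q) (Fin m) ℂ), LureEq A Q B C R X' K' L' → p ≤ q

/-- `Y` is a Hermitian solution of the linear matrix inequality of the Lur'e equations. -/
def SolvesLMI (Y : Matrix (Fin n) (Fin n) ℂ) : Prop :=
  Y.IsHermitian ∧
    (fromBlocks (Aᴴ * Y + Y * A + Q) (Y * B + C) (Bᴴ * Y + Cᴴ) R).PosSemidef

/-- `X` is the maximal solution: it solves the Lur'e equations, and `Y ≤ X` for all Hermitian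
solutions `Y` of the linear matrix inequality. -/
def IsMaximalSolution (X : Matrix (Fin n) (Fin n) ℂ) : Prop :=
  IsLureSolution A Q B C R X ∧ ∀ Y, SolvesLMI A Q B C R Y → (X - Y).PosSemidef

/-- The matrix `ℰ` of the even Lur'e pencil `s ℰ - 𝒜`. -/
def evenE (n m : ℕ) : Matrix ((Fin n ⊕ Fin n) ⊕ Fin m) ((Fin n ⊕ Fin n) ⊕ Fin m) ℂ :=
  fromBlocks (fromBlocks 0 (-1) 1 0) 0 0 0

/-- The matrix `𝒜` of the even Lur'e pencil
`s ℰ - 𝒜 = [[0, -s I + A, B], [s I + A*, Q, C], [B*, C*, R]]`. -/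
def evenA : Matrix ((Fin n ⊕ Fin n) ⊕ Fin m) ((Fin n ⊕ Fin n) ⊕ Fin m) ℂ :=
  -fromBlocks (fromBlocks 0 A Aᴴ Q) (fromRows B C) (fromCols Bᴴ Cᴴ) R

/-- The matrix `[[0, A - γI, B], [A* - γI, Q, C], [B*, C*, R]]`. -/
def ssfLeft (γ : ℝ) : Matrix ((Fin n ⊕ Fin n) ⊕ Fin m) ((Fin n ⊕ Fin n) ⊕ Fin m) ℂ :=
  fromBlocks (fromBlocks 0 (A - (γ : ℂ) • 1) (Aᴴ - (γ : ℂ) • 1) Q)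
    (fromRows B C) (fromCols Bᴴ Cᴴ) R

/-- The matrix `[[0, A + γI, B], [A* + γI, Q, C], [B*, C*, R]]`. -/
def ssfRight (γ : ℝ) : Matrix ((Fin n ⊕ Fin n) ⊕ Fin m) ((Fin n ⊕ Fin n) ⊕ Fin m) ℂ :=
  fromBlocks (fromBlocks 0 (A + (γ : ℂ) • 1) (Aᴴ + (γ : ℂ) • 1) Q)
    (fromRows B C) (fromCols Bᴴ Cᴴ) R

/-- The leading `2n × 2n` block `[[E, -Ĝ], [-Ĥ, F̂]]` of `ssfLeft⁻¹ * ssfRight`. -/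
def hatA (γ : ℝ) : Matrix (Fin n ⊕ Fin n) (Fin n ⊕ Fin n) ℂ :=
  ((ssfLeft A Q B C R γ)⁻¹ * ssfRight A Q B C R γ).toBlocks₁₁

/-- The matrix `[[I, -Ĝ], [0, F̂]]` of the reduced pencil. -/
def redE (γ : ℝ) : Matrix (Fin n ⊕ Fin n) (Fin n ⊕ Fin n) ℂ :=
  fromBlocks 1 (hatA A Q B C R γ).toBlocks₁₂ 0 (hatA A Q B C R γ).toBlocks₂₂

/-- The matrix `[[E, 0], [-Ĥ, I]]` of the reduced pencil. -/
def redA (γ : ℝ) : Matrix (Fin n ⊕ Fin n) (Fin n ⊕ Fin n) ℂ :=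
  fromBlocks (hatA A Q B C R γ).toBlocks₁₁ 0 (hatA A Q B C R γ).toBlocks₂₁ 1

/-- `𝒱` is an `(n+m)`-dimensional c-semi-stable `ℰ`-neutral deflating subspace of the even
Lur'e pencil. -/
def IsStableLagrangian (𝒱 : Submodule ℂ ((Fin n ⊕ Fin n) ⊕ Fin m → ℂ)) : Prop :=
  Module.finrank ℂ 𝒱 = n + m ∧ IsNeutral (evenE n m) 𝒱 ∧
    IsCSemiStableDeflating (evenE n m) (evenA A Q B C R) 𝒱

end

end Lure

end

/-!
Choose `ω` real such that `H = iω ℰ - 𝒜` is invertible. Since `ℰ` vanishes on the last `m`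
coordinates, `i H⁻¹ ℰ` induces an operator `S` on `ℂ²ⁿ` (`shiftInvert`), which is selfadjoint for
the indefinite inner product with Gram matrix `G = i ℰ` (`gram`). Both pencils of the theorem are
read off from `S`: a finite eigenvalue `z` of `s ℰ - 𝒜` corresponds to the eigenvalue
`-i / (z - iω)` of `S`, and with `a = iω - γ`, `b = iω + γ` the reduced pencil satisfies
`(a Er - b Ar) S = i (Er - Ar)` with `a Er - b Ar` invertible (`reduced_mul_shiftInvert`). Hence
every Kronecker chain of the reduced pencil is a Jordan chain of `S` up to an invertible factor
(`KroneckerForm.isChainOperator`), and `|λ| > 1`, `|λ| = 1`, `|λ| < 1` become `Im θ > 0`,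
`Im θ = 0`, `Im θ < 0`.

The heart of the matter are the real eigenvalues of `S`. On the subspace `Λ` of vectors with
vanishing second half, the form `x* G (S - ρ)⁻¹ x` with `ρ` real is, up to sign, the Popov function
of the system on the imaginary axis, so solvability of the linear matrix inequality makes it
negative semidefinite, while stabilizability says that no eigenvector of `S` for a real eigenvalue
is orthogonal to `Λ` (`IsDefiniteOn`, `isDefiniteOn`). Continuing the form analytically in `ρ`
through a real eigenvalue, semidefiniteness shows that its poles have even order, also with a vector
`z` of the generalized eigenspace in place of `x` (`form_pow_eq_zero_of_even`). It follows that
Jordan chains at real eigenvalues have even length (`exists_pow_mulVec_eq_of_odd`), and that every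
neutral invariant subspace is orthogonal to the first halves of these chains
(`form_eq_zero_of_neutral`). As generalized eigenspaces for eigenvalues that are not complex
conjugate are orthogonal, the reduced pencil is weakly d-split, its canonical d-semi-unstable
subspace is neutral, invariant and `n`-dimensional, and any other such subspace with eigenvalues in
the closed upper half-plane is orthogonal to it, hence equal to it
(`KroneckerForm.eq_dSemiUnstableSpan`). A Kronecker form of the reduced pencil exists by the theorem
of Weierstrass (`IsRegular.nonempty_kroneckerForm`), which is deduced from the structure of
finitely generated torsion modules over `ℂ[X]`.

The `(n+m)`-dimensional semi-stable neutral deflating subspaces of `s ℰ - 𝒜` are exactly the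
preimages of these subspaces of `ℂ²ⁿ` (`IsSemiStableLagrangian.isStableLagrangian`,
`IsStableLagrangian.exists_eq_comap`); in particular one may take `V₂ = 0`.

If the subspace is the graph of `X`, neutrality makes `X` Hermitian, and invariance produces a
matrix `T` such that the matrix of the linear matrix inequality for `X` annihilates the vectors
`(T a, b)`, where `A T a + B b = iω T a - i a`. These vectors are mapped onto `ℂⁿ` by `[A - iω, B]`,
so that matrix is positive semidefinite of rank at most `m` and factors with `m` rows; fewer rows
would make `H` singular (`LureEq.le_of_isUnit`). For another solution `Y` of the inequality, `T` is
dissipative for `Δ = X - Y` and has its eigenvalues in the closed upper half-plane, so the form of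
`Δ` decreases along the powers of the Cayley transform of `T`, which tend to zero modulo the kernel
of `Δ`; thus `Δ ≥ 0` (`posSemidef_of_dissipative`).
-/

noncomputable section

namespace Lure

/-! ### Indefinite inner products -/

section Form

variable {ι : Type*} [Fintype ι]

/-- The sesquilinear form `x* G y` with Gram matrix `G`, conjugate-linear in `x`. -/
def form (G : Matrix ι ι ℂ) (x y : ι → ℂ) : ℂ := star x ⬝ᵥ (G *ᵥ y)

variable {G S T : Matrix ι ι ℂ}

@[simp] lemma form_add_left (x y z : ι → ℂ) : form G (x + y) z = form G x z + form G y z := by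
  simp [form, add_dotProduct]

@[simp] lemma form_add_right (x y z : ι → ℂ) : form G x (y + z) = form G x y + form G x z := by
  simp [form, mulVec_add]

@[simp] lemma form_sub_left (x y z : ι → ℂ) : form G (x - y) z = form G x z - form G y z := by
  simp [form, sub_dotProduct]

@[simp] lemma form_sub_right (x y z : ι → ℂ) : form G x (y - z) = form G x y - form G x z := by
  simp [form, mulVec_sub]

@[simp] lemma form_smul_left (c : ℂ) (x y : ι → ℂ) : form G (c • x) y = star c * form G x y := by
  simp [form]

@[simp] lemma form_smul_right (c : ℂ) (x y : ι → ℂ) : form G x (c • y) = c * form G x y := by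
  simp [form, mulVec_smul]

@[simp] lemma form_zero_left (x : ι → ℂ) : form G 0 x = 0 := by simp [form]

@[simp] lemma form_zero_right (x : ι → ℂ) : form G x 0 = 0 := by simp [form]

lemma form_sum_left {κ : Type*} (s : Finset κ) (f : κ → ι → ℂ) (y : ι → ℂ) :
    form G (∑ i ∈ s, f i) y = ∑ i ∈ s, form G (f i) y := by
  classical
  induction s using Finset.induction_on with
  | empty => simp
  | insert a s ha ih => simp [Finset.sum_insert ha, ih]

lemma form_star (hG : G.IsHermitian) (x y : ι → ℂ) : star (form G x y) = form G y x := by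
  rw [form, form, ← star_dotProduct, star_mulVec, hG.eq, dotProduct_mulVec]

lemma form_mulVec_left (h : Sᴴ * G = G * T) (x y : ι → ℂ) :
    form G (S *ᵥ x) y = form G x (T *ᵥ y) := by
  rw [form, form, star_mulVec, ← dotProduct_mulVec, mulVec_mulVec, mulVec_mulVec, h]

lemma continuous_form {f g : ℝ → ι → ℂ} (hf : Continuous f) (hg : Continuous g) :
    Continuous fun t => form G (f t) (g t) := by
  unfold form
  exact hf.star.dotProduct (continuous_const.matrix_mulVec hg)

variable [DecidableEq ι]

lemma adjoint_sub_smul (hS : Sᴴ * G = G * S) (θ : ℂ) :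
    (S - θ • (1 : Matrix ι ι ℂ))ᴴ * G = G * (S - star θ • (1 : Matrix ι ι ℂ)) := by
  simp [sub_mul, mul_sub, hS, conjTranspose_sub, conjTranspose_smul]

lemma adjoint_pow (h : Sᴴ * G = G * T) (k : ℕ) : (S ^ k)ᴴ * G = G * T ^ k := by
  induction k with
  | zero => simp
  | succ k ih =>
    rw [pow_succ', conjTranspose_mul, mul_assoc, h, ← mul_assoc, ih, pow_succ, mul_assoc]

/-- Biorthogonality for a nondegenerate form: a vector that is orthogonal to everything orthogonal
to `U` lies in `U`. -/
lemma mem_of_forall_form_eq_zero (hG : G.IsHermitian) (hG1 : G * G = 1)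
    (U : Submodule ℂ (ι → ℂ)) (v : ι → ℂ)
    (h : ∀ x, (∀ u ∈ U, form G x u = 0) → form G x v = 0) : v ∈ U := by
  by_contra hv
  obtain ⟨f, hfv, hf⟩ := Submodule.exists_le_ker_of_notMem hv
  obtain ⟨x, hx⟩ : ∃ x, ∀ y, f y = form G x y := by
    refine ⟨G *ᵥ star (fun i => f (Pi.single i 1)), fun y => ?_⟩
    rw [form, star_mulVec, star_star, hG.eq, ← dotProduct_mulVec, mulVec_mulVec, hG1, one_mulVec]
    rw [LinearMap.pi_apply_eq_sum_univ f y]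
    refine Finset.sum_congr rfl fun i _ => ?_
    rw [smul_eq_mul, mul_comm]
    congr 2
    ext j
    simp [Pi.single_apply, eq_comm]
  exact hfv (by rw [hx]; exact h x fun u hu => by rw [← hx]; exact hf hu)

/-- If `conj θ` is not an eigenvalue of the selfadjoint `S` on an invariant subspace, that subspace
is orthogonal to the generalized eigenspace of `θ`. -/
lemma form_eq_zero_of_genEigenspace (hS : Sᴴ * G = G * S) {W : Submodule ℂ (ι → ℂ)}
    (hW : ∀ w ∈ W, S *ᵥ w ∈ W) {θ : ℂ} (hθ : ∀ w ∈ W, S *ᵥ w = star θ • w → w = 0)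
    (k : ℕ) {x : ι → ℂ} (hx : (S - θ • (1 : Matrix ι ι ℂ)) ^ k *ᵥ x = 0)
    {w : ι → ℂ} (hw : w ∈ W) : form G w x = 0 := by
  set f : W →ₗ[ℂ] W := (S - star θ • (1 : Matrix ι ι ℂ)).mulVecLin.restrict (p := W) (q := W)
    (fun w hw => by
      simp only [mulVecLin_apply, sub_mulVec, smul_mulVec, one_mulVec]
      exact W.sub_mem (hW w hw) (W.smul_mem _ hw)) with hf
  have hinj : Function.Injective f := by
    rw [← LinearMap.ker_eq_bot, LinearMap.ker_eq_bot']
    rintro ⟨w, hw⟩ h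
    have h2 := congrArg Subtype.val h
    simp only [hf, LinearMap.coe_restrict_apply, mulVecLin_apply, sub_mulVec, smul_mulVec,
      one_mulVec, ZeroMemClass.coe_zero, sub_eq_zero] at h2
    exact Subtype.ext (hθ w hw h2)
  have hsurj : Function.Surjective f := LinearMap.injective_iff_surjective.mp hinj
  induction k generalizing x w with
  | zero => simp_all
  | succ k ih =>
    obtain ⟨⟨w', hw'⟩, h⟩ := hsurj ⟨w, hw⟩
    have h2 := congrArg Subtype.val h
    simp only [hf, LinearMap.coe_restrict_apply, mulVecLin_apply] at h2
    have := adjoint_sub_smul hS (star θ)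
    rw [← h2, form_mulVec_left this, star_star]
    exact ih (by rwa [mulVec_mulVec, ← pow_succ]) hw'

end Form

/-! ### The sign condition and its consequences at real eigenvalues -/

section Positivity

variable {ι : Type*} [Fintype ι] {G S : Matrix ι ι ℂ} {Λ : Submodule ℂ (ι → ℂ)}

/-- The vectors `z` that agree with some continuous `x(t) ∈ Λ` modulo `(N - t) q(t)`, where `q` is
continuous, for all real `t`. It contains
`∑ Nʲ Λ`, as one sees by taking `x(t) = ∑ tʲ xⱼ`. -/
def reachable (N : Matrix ι ι ℂ) (Λ : Submodule ℂ (ι → ℂ)) : Submodule ℂ (ι → ℂ) where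
  carrier := {z | ∃ q : ℝ → ι → ℂ, Continuous q ∧ ∀ t : ℝ, z + ((t : ℂ) • q t - N *ᵥ q t) ∈ Λ}
  zero_mem' := ⟨fun _ => 0, continuous_const, fun t => by simp⟩
  add_mem' := by
    rintro a b ⟨p, hp, hp'⟩ ⟨q, hq, hq'⟩
    refine ⟨fun t => p t + q t, hp.add hq, fun t => ?_⟩
    convert Λ.add_mem (hp' t) (hq' t) using 1
    rw [mulVec_add, smul_add]
    abel
  smul_mem' := by
    rintro c a ⟨p, hp, hp'⟩
    refine ⟨fun t => c • p t, hp.const_smul c, fun t => ?_⟩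
    convert Λ.smul_mem c (hp' t) using 1
    rw [mulVec_smul, smul_add, smul_sub, smul_comm]

lemma le_reachable (N : Matrix ι ι ℂ) : Λ ≤ reachable N Λ := fun z hz =>
  ⟨fun _ => 0, continuous_const, fun t => by simpa using hz⟩

lemma mulVec_mem_reachable {N : Matrix ι ι ℂ} {z : ι → ℂ} (hz : z ∈ reachable N Λ) :
    N *ᵥ z ∈ reachable N Λ := by
  obtain ⟨q, hq, hq'⟩ := hz
  refine ⟨fun t => z + (t : ℂ) • q t,
    continuous_const.add (Complex.continuous_ofReal.smul hq), fun t => ?_⟩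
  convert Λ.smul_mem (t : ℂ) (hq' t) using 1
  rw [mulVec_add, mulVec_smul, smul_add, smul_add, smul_sub]
  abel

variable [DecidableEq ι]

/-- `S` is selfadjoint for the nondegenerate Hermitian form `G`, the form `x ↦ x* G (S - ρ)⁻¹ x`
is negative semidefinite on `Λ` for all real `ρ`, and no eigenvector of `S` with a real eigenvalue
is orthogonal to `Λ`. The sign condition is phrased in terms of `r = (S - ρ)⁻¹ x`, so that it makes
sense also when `ρ` is an eigenvalue. -/
structure IsDefiniteOn (G S : Matrix ι ι ℂ) (Λ : Submodule ℂ (ι → ℂ)) : Prop where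
  isHermitian : G.IsHermitian
  mul_self : G * G = 1
  adjoint : Sᴴ * G = G * S
  nonpos : ∀ (ρ : ℝ) (r : ι → ℂ), (S - (ρ : ℂ) • (1 : Matrix ι ι ℂ)) *ᵥ r ∈ Λ →
    (form G r ((S - (ρ : ℂ) • (1 : Matrix ι ι ℂ)) *ᵥ r)).re ≤ 0
  eq_zero : ∀ (ρ : ℝ) (v : ι → ℂ), S *ᵥ v = (ρ : ℂ) • v → (∀ x ∈ Λ, form G x v = 0) → v = 0

/-- Generalized eigenvectors for real eigenvalues are reachable: the orthogonal complement of the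
reachable vectors is invariant and contains no eigenvector for a real eigenvalue. -/
lemma mem_reachable_of_pow_mulVec_eq_zero (h : IsDefiniteOn G S Λ) (lam : ℝ) (k : ℕ) {z : ι → ℂ}
    (hz : (S - (lam : ℂ) • (1 : Matrix ι ι ℂ)) ^ k *ᵥ z = 0) :
    z ∈ reachable (S - (lam : ℂ) • (1 : Matrix ι ι ℂ)) Λ := by
  set N := S - (lam : ℂ) • (1 : Matrix ι ι ℂ) with hN
  refine mem_of_forall_form_eq_zero h.isHermitian h.mul_self _ _ fun x hx => ?_
  let W : Submodule ℂ (ι → ℂ) :=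
    { carrier := {w | ∀ u ∈ reachable N Λ, form G w u = 0}
      zero_mem' := fun u _ => by simp
      add_mem' := fun {a b} ha hb u hu => by simp [ha u hu, hb u hu]
      smul_mem' := fun c a ha u hu => by simp [ha u hu] }
  refine form_eq_zero_of_genEigenspace h.adjoint (W := W) (θ := lam) ?_ ?_ k hz hx
  · intro w hw u hu
    rw [form_mulVec_left h.adjoint]
    refine hw _ ?_
    have : S *ᵥ u = N *ᵥ u + (lam : ℂ) • u := by
      simp [hN, sub_mulVec, smul_mulVec]
    rw [this]
    exact Submodule.add_mem _ (mulVec_mem_reachable hu) (Submodule.smul_mem _ _ hu)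
  · intro w hw hw'
    refine h.eq_zero lam w (by simpa using hw') fun x hx => ?_
    rw [← form_star h.isHermitian, hw x (le_reachable N hx), star_zero]

lemma eq_zero_of_mul_nonneg {f : ℝ → ℝ} (hf : Continuous f) (h : ∀ t, t ≠ 0 → 0 ≤ t * f t) :
    f 0 = 0 := by
  refine le_antisymm ?_ ?_
  · by_contra hpos
    obtain ⟨ε, hε, h'⟩ := Metric.eventually_nhds_iff.mp
      (hf.continuousAt.eventually (lt_mem_nhds (not_le.mp hpos)))
    have h1 := h' (y := -(ε / 2)) (by rw [Real.dist_eq, sub_zero, abs_lt]; constructor <;> linarith)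
    have h2 := h (-(ε / 2)) (by linarith)
    nlinarith
  · by_contra hneg
    obtain ⟨ε, hε, h'⟩ := Metric.eventually_nhds_iff.mp
      (hf.continuousAt.eventually (gt_mem_nhds (not_le.mp hneg)))
    have h1 := h' (y := ε / 2) (by rw [Real.dist_eq, sub_zero, abs_lt]; constructor <;> linarith)
    have h2 := h (ε / 2) (by linarith)
    nlinarith

lemma sub_smul_mulVec_geom_sum (N : Matrix ι ι ℂ) (z : ι → ℂ) {t : ℂ} (ht : t ≠ 0) (k : ℕ) :
    (N - t • (1 : Matrix ι ι ℂ)) *ᵥ (∑ j ∈ Finset.range k, (t⁻¹) ^ (j + 1) • (N ^ j *ᵥ z)) =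
      (t⁻¹) ^ k • (N ^ k *ᵥ z) - z := by
  induction k with
  | zero => simp
  | succ k ih =>
    rw [Finset.sum_range_succ, mulVec_add, ih, mulVec_smul, sub_mulVec, mulVec_mulVec, ← pow_succ',
      smul_mulVec, one_mulVec, smul_sub, smul_smul, pow_succ _ k, mul_assoc, inv_mul_cancel₀ ht]
    simp

/-- The principal part of `t ↦ z* G (S - λ - t)⁻¹ z` at `t = 0` is bounded on one side, hence its
pole has even order. Here `z` lies in the generalized eigenspace of the real number `λ`. -/
lemma form_pow_eq_zero_of_even (h : IsDefiniteOn G S Λ) (lam : ℝ) (k : ℕ) {z : ι → ℂ}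
    (hz : (S - (lam : ℂ) • (1 : Matrix ι ι ℂ)) ^ k *ᵥ z = 0) {l : ℕ} (hl : Even l)
    (hl' : ∀ j, l < j → form G z ((S - (lam : ℂ) • (1 : Matrix ι ι ℂ)) ^ j *ᵥ z) = 0) :
    form G z ((S - (lam : ℂ) • (1 : Matrix ι ι ℂ)) ^ l *ᵥ z) = 0 := by
  obtain ⟨q, hq, hq'⟩ := mem_reachable_of_pow_mulVec_eq_zero h lam k hz
  have hadj := adjoint_sub_smul h.adjoint (lam : ℂ)
  rw [show star (lam : ℂ) = lam by simp] at hadj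
  set N := S - (lam : ℂ) • (1 : Matrix ι ι ℂ) with hN
  have hswap : ∀ j, form G (N ^ j *ᵥ z) z = form G z (N ^ j *ᵥ z) := fun j =>
    form_mulVec_left (adjoint_pow hadj j) z z
  have hreal : ∀ j, (form G z (N ^ j *ᵥ z)).im = 0 := fun j => by
    have := form_star h.isHermitian z (N ^ j *ᵥ z)
    rw [hswap] at this
    exact Complex.conj_eq_iff_im.mp this
  set g : ℕ → ℝ := fun j => (form G z (N ^ j *ᵥ z)).re with hg
  let p : ℝ → ι → ℂ := fun t => N *ᵥ q t - (t : ℂ) • q t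
  have hp : Continuous p :=
    (continuous_const.matrix_mulVec hq).sub (Complex.continuous_ofReal.smul hq)
  let c : ℝ → ℝ := fun t => (form G (q t) (p t) - form G z (q t) - form G (q t) z).re
  have hc : Continuous c := Complex.continuous_re.comp
    (((continuous_form hq hp).sub (continuous_form continuous_const hq)).sub
      (continuous_form hq continuous_const))
  let ψ : ℝ → ℝ := fun t => ∑ j ∈ Finset.range (l + 1), t ^ (l - j) * g j - t ^ (l + 1) * c t
  have hψ : Continuous ψ := by
    refine Continuous.sub ?_ ((continuous_pow _).mul hc)
    exact continuous_finsetSum _ fun j _ => (continuous_pow _).mul continuous_const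
  have key : ∀ t : ℝ, t ≠ 0 → 0 ≤ t * ψ t := by
    intro t ht
    have ht' : (t : ℂ) ≠ 0 := by exact_mod_cast ht
    set K := k + l + 1 with hK
    have hzK : N ^ K *ᵥ z = 0 := by
      rw [hK, add_assoc, add_comm, pow_add, ← mulVec_mulVec, hz, mulVec_zero]
    set Rz := ∑ j ∈ Finset.range K, ((t : ℂ)⁻¹) ^ (j + 1) • (N ^ j *ᵥ z) with hRz
    have hR : (N - (t : ℂ) • (1 : Matrix ι ι ℂ)) *ᵥ Rz = -z := by
      rw [hRz, sub_smul_mulVec_geom_sum N z ht', hzK]; simp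
    have hNt : S - ((lam + t : ℝ) : ℂ) • (1 : Matrix ι ι ℂ) = N - (t : ℂ) • 1 := by
      rw [hN]; push_cast; rw [add_smul]; abel
    have hpt : (N - (t : ℂ) • (1 : Matrix ι ι ℂ)) *ᵥ q t = p t := by
      simp [p, sub_mulVec, smul_mulVec]
    have hval : (N - (t : ℂ) • (1 : Matrix ι ι ℂ)) *ᵥ (-Rz - q t) = z - p t := by
      rw [mulVec_sub, mulVec_neg, hR, hpt, neg_neg]
    have hle := h.nonpos (lam + t) (-Rz - q t) (by
      rw [hNt, hval]
      convert hq' t using 1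
      simp only [p]; abel)
    rw [hNt, hval] at hle
    have hadjt := adjoint_sub_smul hadj (t : ℂ)
    rw [show star (t : ℂ) = t by simp] at hadjt
    have h1 : form G Rz (p t) = - form G z (q t) := by
      rw [← hpt, ← form_mulVec_left hadjt, hR]
      simpa using form_smul_left (G := G) (-1) z (q t)
    have h2 : form G Rz z =
        ∑ j ∈ Finset.range K, ((t : ℂ)⁻¹) ^ (j + 1) * form G z (N ^ j *ᵥ z) := by
      rw [hRz, form_sum_left]
      refine Finset.sum_congr rfl fun j _ => ?_
      rw [form_smul_left, hswap]; simp
    have h2' : (form G Rz z).re = ∑ j ∈ Finset.range (l + 1), (t⁻¹) ^ (j + 1) * g j := by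
      rw [h2, Complex.re_sum, ← Finset.sum_subset (s₁ := Finset.range (l + 1))]
      · refine Finset.sum_congr rfl fun j _ => ?_
        rw [← Complex.ofReal_inv, ← Complex.ofReal_pow, Complex.re_ofReal_mul]
      · intro j; simp only [Finset.mem_range, hK]; omega
      · intro j _ hj
        rw [hl' j (by simpa using hj)]; simp
    have h3 : form G (-Rz - q t) (z - p t) = - form G Rz z +
        (form G (q t) (p t) - form G z (q t) - form G (q t) z) := by
      have : -Rz = (-1 : ℂ) • Rz := by simp
      rw [this]
      simp only [form_sub_left, form_sub_right, form_smul_left, h1]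
      simp; ring
    rw [h3, Complex.add_re, Complex.neg_re, h2'] at hle
    have h4 : t * ψ t = t ^ (l + 2) *
        (∑ j ∈ Finset.range (l + 1), (t⁻¹) ^ (j + 1) * g j - c t) := by
      simp only [ψ, mul_sub, Finset.mul_sum]
      congr 1
      · refine Finset.sum_congr rfl fun j hj => ?_
        have : j ≤ l := by simpa [Nat.lt_succ_iff] using hj
        obtain ⟨i, rfl⟩ := Nat.exists_eq_add_of_le this
        rw [Nat.add_sub_cancel_left, inv_pow]
        field_simp
        ring
      · ring
    rw [h4]
    refine mul_nonneg ((Even.add hl even_two).pow_nonneg t) ?_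
    simp only [c]; linarith
  have hψ0 := eq_zero_of_mul_nonneg hψ key
  have : ψ 0 = g l := by
    simp only [ψ, Finset.sum_range_succ]
    rw [Finset.sum_eq_zero]
    · simp
    · intro j hj
      rw [zero_pow (by have := Finset.mem_range.mp hj; omega), zero_mul]
  apply Complex.ext
  · rw [this] at hψ0
    simpa [hg] using hψ0
  · simpa using hreal l

/-- An invariant neutral subspace is orthogonal to `Nⁱ ker N²ʲ` for `i ≥ j`, where `N = S - λ` with
`λ` real. For `i = j` these vectors make up the first halves of the Jordan chains. -/
lemma form_eq_zero_of_neutral (h : IsDefiniteOn G S Λ) (lam : ℝ) {W : Submodule ℂ (ι → ℂ)}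
    (hW : ∀ w ∈ W, S *ᵥ w ∈ W) (hWn : ∀ w ∈ W, ∀ w' ∈ W, form G w w' = 0) {j : ℕ} {y : ι → ℂ}
    (hy : (S - (lam : ℂ) • (1 : Matrix ι ι ℂ)) ^ (2 * j) *ᵥ y = 0) {i : ℕ} (hi : j ≤ i)
    {w : ι → ℂ} (hw : w ∈ W) :
    form G w ((S - (lam : ℂ) • (1 : Matrix ι ι ℂ)) ^ i *ᵥ y) = 0 := by
  have hadj := adjoint_sub_smul h.adjoint (lam : ℂ)
  rw [show star (lam : ℂ) = lam by simp] at hadj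
  set N := S - (lam : ℂ) • (1 : Matrix ι ι ℂ) with hN
  have hNW : ∀ w ∈ W, N *ᵥ w ∈ W := fun w hw => by
    rw [hN, sub_mulVec, smul_mulVec, one_mulVec]
    exact W.sub_mem (hW w hw) (W.smul_mem _ hw)
  have hNkW : ∀ k, ∀ w ∈ W, N ^ k *ᵥ w ∈ W := fun k => by
    induction k with
    | zero => simp
    | succ k ih => intro w hw; rw [pow_succ, ← mulVec_mulVec]; exact ih _ (hNW w hw)
  have hmove : ∀ k a b, form G (N ^ k *ᵥ a) b = form G a (N ^ k *ᵥ b) := fun k =>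
    form_mulVec_left (adjoint_pow hadj k)
  have hy' : ∀ l, 2 * j ≤ l → N ^ l *ᵥ y = 0 := fun l hl => by
    obtain ⟨d, rfl⟩ := Nat.exists_eq_add_of_le hl
    rw [add_comm, pow_add, ← mulVec_mulVec, hy, mulVec_zero]
  -- first for vectors of `W` in the generalized eigenspace, by downward induction on `i`
  have main : ∀ d i, j ≤ i → 2 * j ≤ i + d → ∀ w ∈ W, ∀ k, N ^ k *ᵥ w = 0 →
      form G w (N ^ i *ᵥ y) = 0 := by
    intro d
    induction d with
    | zero => intro i _ hi' w _ k _; rw [hy' i (by omega), form_zero_right]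
    | succ d ih =>
      intro i hi hi' w hw k hk
      by_cases hi2 : 2 * j ≤ i
      · rw [hy' i hi2, form_zero_right]
      have ih' : ∀ a, i < a → form G w (N ^ a *ᵥ y) = 0 := fun a ha =>
        ih a (by omega) (by omega) w hw k hk
      set f := form G w (N ^ i *ᵥ y) with hf
      -- test the parity lemma with `z = N^(2j-i) y + f w`
      have expand : ∀ l, 2 * (i - j) ≤ l →
          form G (N ^ (2 * j - i) *ᵥ y + f • w) (N ^ l *ᵥ (N ^ (2 * j - i) *ᵥ y + f • w)) =
          f * star (form G w (N ^ (l + (2 * j - i)) *ᵥ y)) +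
            star f * form G w (N ^ (l + (2 * j - i)) *ᵥ y) := by
        intro l hl
        have e1 : form G (N ^ (2 * j - i) *ᵥ y) (N ^ l *ᵥ (N ^ (2 * j - i) *ᵥ y)) = 0 := by
          rw [hmove, mulVec_mulVec, mulVec_mulVec, ← pow_add, ← pow_add, hy' _ (by omega),
            form_zero_right]
        have e2 : form G (N ^ (2 * j - i) *ᵥ y) (N ^ l *ᵥ w) =
            star (form G w (N ^ (l + (2 * j - i)) *ᵥ y)) := by
          rw [← hmove, mulVec_mulVec, ← pow_add, form_star h.isHermitian]
        have e3 : form G w (N ^ l *ᵥ w) = 0 := hWn _ hw _ (hNkW l w hw)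
        rw [mulVec_add, mulVec_smul]
        simp only [form_add_left, form_add_right, form_smul_left, form_smul_right, e1, e2, e3]
        rw [mulVec_mulVec, ← pow_add]
        ring
      have hz0 : N ^ (2 * j + k) *ᵥ (N ^ (2 * j - i) *ᵥ y + f • w) = 0 := by
        rw [mulVec_add, mulVec_smul, mulVec_mulVec, ← pow_add, hy' _ (by omega), pow_add,
          ← mulVec_mulVec w, hk]
        simp
      have h0 := form_pow_eq_zero_of_even h lam (2 * j + k) hz0 (l := 2 * (i - j)) (by simp)
        (fun l hl => by
          rw [expand l hl.le, ih' _ (by omega)]; simp)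
      rw [expand _ le_rfl, show 2 * (i - j) + (2 * j - i) = i by omega, ← hf] at h0
      have h1 : f * star f = 0 := by
        have : star f * f = f * star f := mul_comm _ _
        rw [this, ← two_mul] at h0
        simpa using h0
      simpa using h1
  -- Fitting decomposition of `W` reduces to that case
  let φ : W →ₗ[ℂ] W := N.mulVecLin.restrict (p := W) (q := W) (fun w hw => by simpa using hNW w hw)
  have hφ : ∀ k (w : W), ((φ ^ k) w : ι → ℂ) = N ^ k *ᵥ (w : ι → ℂ) := fun k => by
    induction k with
    | zero => simp
    | succ k ih => intro w; rw [pow_succ, Module.End.mul_apply, ih, pow_succ, ← mulVec_mulVec]; rfl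
  obtain ⟨K0, hK0⟩ := Filter.eventually_atTop.mp (LinearMap.eventually_isCompl_ker_pow_range_pow φ)
  have hK := hK0 (K0 + 2 * j) (by omega)
  have hwtop : (⟨w, hw⟩ : W) ∈ LinearMap.ker (φ ^ (K0 + 2 * j)) ⊔
      LinearMap.range (φ ^ (K0 + 2 * j)) := by
    rw [hK.sup_eq_top]; trivial
  obtain ⟨a, ha, b, ⟨b', hb'⟩, hab⟩ := Submodule.mem_sup.mp hwtop
  have hab' : w = (a : ι → ℂ) + N ^ (K0 + 2 * j) *ᵥ (b' : ι → ℂ) := by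
    rw [← hφ, hb', ← Submodule.coe_add, hab]
  rw [hab', form_add_left, hmove, mulVec_mulVec, ← pow_add,
    hy' (K0 + 2 * j + i) (by omega), form_zero_right, add_zero]
  refine main (2 * j) i hi (by omega) a a.2 (K0 + 2 * j) ?_
  rw [← hφ, LinearMap.mem_ker.mp ha]; rfl

/-- Jordan chains of odd length do not occur at real eigenvalues: every Jordan chain whose length
is odd can be prolonged. -/
lemma exists_pow_mulVec_eq_of_odd (h : IsDefiniteOn G S Λ) (lam : ℝ) {k : ℕ} (hk : Odd k)
    {x : ι → ℂ} (hx : (S - (lam : ℂ) • (1 : Matrix ι ι ℂ)) ^ k *ᵥ x = 0) :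
    ∃ y, (S - (lam : ℂ) • (1 : Matrix ι ι ℂ)) ^ k *ᵥ y =
      (S - (lam : ℂ) • (1 : Matrix ι ι ℂ)) ^ (k - 1) *ᵥ x := by
  have hadj := adjoint_sub_smul h.adjoint (lam : ℂ)
  rw [show star (lam : ℂ) = lam by simp] at hadj
  set N := S - (lam : ℂ) • (1 : Matrix ι ι ℂ) with hN
  have hmove : ∀ k a b, form G (N ^ k *ᵥ a) b = form G a (N ^ k *ᵥ b) := fun k =>
    form_mulVec_left (adjoint_pow hadj k)
  have hdiag : ∀ z, N ^ k *ᵥ z = 0 → form G z (N ^ (k - 1) *ᵥ z) = 0 := fun z hz => by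
    refine form_pow_eq_zero_of_even h lam k hz (Nat.Odd.sub_odd hk odd_one) fun l hl => ?_
    obtain ⟨d, rfl⟩ := Nat.exists_eq_add_of_le (show k ≤ l by omega)
    rw [add_comm, pow_add, ← mulVec_mulVec, hz, mulVec_zero, form_zero_right]
  have hmem : N ^ (k - 1) *ᵥ x ∈ LinearMap.range (N ^ k).mulVecLin := by
    refine mem_of_forall_form_eq_zero h.isHermitian h.mul_self _ _ fun u hu => ?_
    have hu0 : N ^ k *ᵥ u = 0 := by
      have : N ^ k *ᵥ u ∈ (⊥ : Submodule ℂ (ι → ℂ)) := by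
        refine mem_of_forall_form_eq_zero h.isHermitian h.mul_self _ _ fun v _ => ?_
        rw [← hmove, ← form_star h.isHermitian, hu (N ^ k *ᵥ v) ⟨v, rfl⟩, star_zero]
      simpa using this
    -- polarization with the scalar `c = u* G N^(k-1) x`
    set f := form G u (N ^ (k - 1) *ᵥ x) with hf
    have hz := hdiag (x + f • u) (by rw [mulVec_add, mulVec_smul, hx, hu0]; simp)
    have hxu : form G x (N ^ (k - 1) *ᵥ u) = star f := by
      rw [← hmove, form_star h.isHermitian]
    rw [mulVec_add, mulVec_smul] at hz
    simp only [form_add_left, form_add_right, form_smul_left, form_smul_right, hdiag x hx,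
      hdiag u hu0, hxu, ← hf] at hz
    have : f * star f + star f * f = 0 := by linear_combination hz
    have h1 : f * star f = 0 := by
      rw [mul_comm (star f), ← two_mul] at this
      simpa using this
    simpa using h1
  obtain ⟨y, hy⟩ := hmem
  exact ⟨y, by simpa using hy⟩

end Positivity

/-! ### Kronecker blocks -/

section Shift

variable {k : ℕ}

lemma shift_mulVec (v : Fin k → ℂ) (i : Fin k) :
    (shift k *ᵥ v) i = if h : (i : ℕ) + 1 < k then v ⟨i + 1, h⟩ else 0 := by
  simp only [shift, mulVec, dotProduct, of_apply, ite_mul, one_mul, zero_mul]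
  split_ifs with h
  · rw [Finset.sum_eq_single (⟨i + 1, h⟩ : Fin k)]
    · simp
    · intro b _ hb
      rw [if_neg]
      intro h'; exact hb (Fin.ext h'.symm)
    · simp
  · refine Finset.sum_eq_zero fun b _ => if_neg ?_
    have := b.2
    omega

lemma shift_pow_mulVec (a : ℕ) (v : Fin k → ℂ) (i : Fin k) :
    (shift k ^ a *ᵥ v) i = if h : (i : ℕ) + a < k then v ⟨i + a, h⟩ else 0 := by
  induction a generalizing v with
  | zero => simp
  | succ a ih =>
    rw [pow_succ, ← mulVec_mulVec, ih]
    simp only [shift_mulVec]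
    by_cases h : (i : ℕ) + a < k <;> by_cases h' : (i : ℕ) + (a + 1) < k
    · rw [dif_pos h, dif_pos h', dif_pos (show (i : ℕ) + a + 1 < k by omega)]
      rfl
    · rw [dif_pos h, dif_neg h', dif_neg (show ¬ (i : ℕ) + a + 1 < k by omega)]
    · omega
    · rw [dif_neg h, dif_neg h']

lemma shift_pow_eq_zero : shift k ^ k = 0 := by
  refine ext_of_mulVec_single fun i => ?_
  ext j
  rw [shift_pow_mulVec, dif_neg (by omega)]
  simp

lemma shift_pow_mulVec_single (a : ℕ) (i j : Fin k) (h : (j : ℕ) + a = i) :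
    shift k ^ a *ᵥ Pi.single i 1 = Pi.single j (1 : ℂ) := by
  ext l
  rw [shift_pow_mulVec]
  by_cases hl : l = j
  · subst hl
    rw [dif_pos (by omega), Pi.single_eq_same]
    simp only [h, Fin.eta, Pi.single_eq_same]
  · rw [Pi.single_eq_of_ne hl]
    split_ifs with h'
    · rw [Pi.single_eq_of_ne]
      intro h''
      rw [← h''] at h
      exact hl (Fin.ext (by simpa using h.symm))
    · rfl

lemma shift_pow_mulVec_single_eq_zero (a : ℕ) (i : Fin k) (h : (i : ℕ) < a) :
    shift k ^ a *ᵥ Pi.single i (1 : ℂ) = 0 := by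
  ext l
  rw [shift_pow_mulVec]
  split_ifs with h'
  · refine Pi.single_eq_of_ne (fun h'' => ?_) _
    have := congrArg Fin.val h''
    simp at this
    omega
  · rfl

lemma apply_eq_zero_of_shift_pow_mulVec {a : ℕ} {v : Fin k → ℂ} (h : shift k ^ a *ᵥ v = 0)
    {i : Fin k} (hi : a ≤ i) : v i = 0 := by
  have := congrFun h ⟨i - a, by omega⟩
  rw [shift_pow_mulVec, dif_pos (by simp; omega)] at this
  simpa [Nat.sub_add_cancel hi] using this

lemma isUnit_smul_one_add_smul_shift {c : ℂ} (hc : c ≠ 0) (d : ℂ) :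
    IsUnit (c • (1 : Matrix (Fin k) (Fin k) ℂ) + d • shift k) := by
  have h1 : IsUnit (c • (1 : Matrix (Fin k) (Fin k) ℂ)) :=
    (isUnit_one).smul (Units.mk0 c hc)
  have h2 : IsNilpotent (d • shift k) := ⟨k, by rw [smul_pow, shift_pow_eq_zero, smul_zero]⟩
  refine h2.isUnit_add_left_of_commute h1 ?_
  exact (Commute.one_right _).smul_right c

lemma commute_shift_inv {w : Matrix (Fin k) (Fin k) ℂ} (h : Commute (shift k) w)
    (hw : IsUnit w) : Commute (shift k) w⁻¹ := by
  obtain ⟨u, rfl⟩ := hw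
  rw [← coe_units_inv]
  exact h.units_inv_right

end Shift

lemma blockDiagonal'_mulVec {o : Type*} {s : o → Type*} [Fintype o] [DecidableEq o]
    [∀ j, Fintype (s j)] (M : ∀ j, Matrix (s j) (s j) ℂ) (v : (Σ j, s j) → ℂ) (p : Σ j, s j) :
    (blockDiagonal' M *ᵥ v) p = (M p.1 *ᵥ fun i => v ⟨p.1, i⟩) p.2 := by
  obtain ⟨j, i⟩ := p
  simp only [mulVec, dotProduct, ← Finset.univ_sigma_univ, Finset.sum_sigma]
  rw [Finset.sum_eq_single j]
  · simp [blockDiagonal'_apply_eq]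
  · intro j' _ hj'
    refine Finset.sum_eq_zero fun i' _ => ?_
    rw [blockDiagonal'_apply_ne _ _ _ hj'.symm, zero_mul]
  · simp

/-- The eigenvalue of `(a E - b A)⁻¹ i (E - A)` that corresponds to a Kronecker block. -/
def KBlock.theta (a b : ℂ) : KBlock → ℂ
  | w1 _ ev => Complex.I * (1 - ev) / (a - b * ev)
  | w2 _ => Complex.I / b

/-- The scalar part of `a E - b A` on a Kronecker block. -/
def KBlock.scalar (a b : ℂ) : KBlock → ℂ
  | w1 _ ev => a - b * ev
  | w2 _ => -b

lemma KBlock.size_pos (B : KBlock) : 0 < B.size := by cases B <;> exact PNat.pos _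

/-- On a Kronecker block, `(a E - b A)⁻¹ i (E - A)` is its eigenvalue plus the shift times an
invertible matrix commuting with the shift. -/
lemma KBlock.exists_unit (B : KBlock) {a b : ℂ} (hab : a ≠ b) (hb : b ≠ 0)
    (hB : B.scalar a b ≠ 0) : ∃ w : Matrix (Fin B.size) (Fin B.size) ℂ,
      Commute (shift B.size) w ∧ IsUnit w ∧
      (a • B.matE - b • B.matA) * (B.theta a b • 1 + shift B.size * w) =
        Complex.I • (B.matE - B.matA) := by
  have aux : ∀ (k : ℕ) (c d κ θ : ℂ), c ≠ 0 → κ ≠ 0 → ∃ w : Matrix (Fin k) (Fin k) ℂ,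
      Commute (shift k) w ∧ IsUnit w ∧
      (c • 1 + d • shift k) * (θ • 1 + shift k * w) = (θ * c) • 1 + (θ * d + κ) • shift k := by
    intro k c d κ θ hc hκ
    have hu := isUnit_smul_one_add_smul_shift (k := k) hc d
    have hcomm : Commute (shift k) (c • (1 : Matrix (Fin k) (Fin k) ℂ) + d • shift k) :=
      ((Commute.one_right _).smul_right c).add_right ((Commute.refl _).smul_right d)
    set Z := c • (1 : Matrix (Fin k) (Fin k) ℂ) + d • shift k with hZ
    have hdet : IsUnit Z.det := (isUnit_iff_isUnit_det Z).mp hu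
    refine ⟨κ • Z⁻¹, (commute_shift_inv hcomm hu).smul_right κ, ?_, ?_⟩
    · exact ((isUnit_nonsing_inv_iff).mpr hu).smul (Units.mk0 κ hκ)
    · rw [mul_add, ← mul_assoc, ← hcomm.eq, mul_smul_comm, mul_assoc (shift k),
        mul_smul_comm, mul_nonsing_inv _ hdet, mul_smul_comm, mul_one, mul_one, hZ]
      module
  cases B with
  | w1 k ev =>
    have hc : a - b * ev ≠ 0 := hB
    have hκ : b * (Complex.I * (1 - ev) / (a - b * ev)) - Complex.I ≠ 0 := by
      intro h
      apply hab
      field_simp at h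
      linear_combination Complex.I * h + (a - b) * Complex.I_mul_I
    obtain ⟨w, h1, h2, h3⟩ := aux k (a - b * ev) (-b) _ (Complex.I * (1 - ev) / (a - b * ev)) hc hκ
    refine ⟨w, h1, h2, ?_⟩
    have e1 : a • (1 : Matrix (Fin k) (Fin k) ℂ) - b • (ev • 1 + shift k) =
        (a - b * ev) • 1 + (-b) • shift k := by module
    have e2 : Complex.I • ((1 : Matrix (Fin k) (Fin k) ℂ) - (ev • 1 + shift k)) =
        (Complex.I * (1 - ev)) • 1 + (-Complex.I) • shift k := by module
    refine Eq.trans ?_ (e2.symm)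
    refine Eq.trans (b := ((a - b * ev) • 1 + (-b) • shift k) *
      ((Complex.I * (1 - ev) / (a - b * ev)) • 1 + shift k * w)) ?_ ?_
    · rw [← e1]; rfl
    · rw [h3]
      congr 2
      · rw [div_mul_cancel₀ _ hc]
      · ring
  | w2 k =>
    have hκ : Complex.I - Complex.I / b * a ≠ 0 := by
      intro h
      apply hab
      field_simp at h
      linear_combination Complex.I * h + (a - b) * Complex.I_mul_I
    obtain ⟨w, h1, h2, h3⟩ := aux k (-b) a _ (Complex.I / b) (neg_ne_zero.mpr hb) hκ
    refine ⟨w, h1, h2, ?_⟩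
    have e1 : a • shift k - b • (1 : Matrix (Fin k) (Fin k) ℂ) =
        (-b) • 1 + a • shift k := by module
    have e2 : Complex.I • (shift k - (1 : Matrix (Fin k) (Fin k) ℂ)) =
        (-Complex.I) • 1 + Complex.I • shift k := by module
    refine Eq.trans ?_ (e2.symm)
    refine Eq.trans (b := ((-b) • 1 + a • shift k) * ((Complex.I / b) • 1 + shift k * w)) ?_ ?_
    · rw [← e1]; rfl
    · rw [h3]
      congr 2
      · field_simp
      · ring

/-! ### Kronecker chains as Jordan chains of one operator -/

lemma pow_mul_inv_pow {k : ℕ} {w : Matrix (Fin k) (Fin k) ℂ} (hw : IsUnit w) (a : ℕ) :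
    w ^ a * w⁻¹ ^ a = 1 := by
  obtain ⟨u, rfl⟩ := hw
  rw [← coe_units_inv, ← Units.val_pow_eq_pow_val, ← Units.val_pow_eq_pow_val, ← Units.val_mul,
    inv_pow, mul_inv_cancel, Units.val_one]

namespace KroneckerForm

variable {ι : Type*} [Fintype ι] [DecidableEq ι] {E A S : Matrix ι ι ℂ}

/-- The columns of the right transformation, i.e. the vectors of the Kronecker chains. -/
def chain (K : KroneckerForm E A) (p : Σ j, Fin (K.block j).size) : ι → ℂ := fun a => K.Ur a p

/-- The vector with coordinates `v` with respect to the chain of the `j`-th block. -/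
def chainMap (K : KroneckerForm E A) (j : Fin K.count) (v : Fin (K.block j).size → ℂ) : ι → ℂ :=
  K.Ur *ᵥ fun p => (Pi.single j v : ∀ j, Fin (K.block j).size → ℂ) p.1 p.2

lemma chainMap_zero (K : KroneckerForm E A) (j : Fin K.count) : K.chainMap j 0 = 0 := by
  rw [chainMap, Pi.single_zero]; exact mulVec_zero _

lemma chainMap_single (K : KroneckerForm E A) (j : Fin K.count) (i : Fin (K.block j).size) :
    K.chainMap j (Pi.single i 1) = K.chain ⟨j, i⟩ := by
  have : (fun p : Σ j, Fin (K.block j).size =>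
      (Pi.single j (Pi.single i 1) : ∀ j, Fin (K.block j).size → ℂ) p.1 p.2) =
      Pi.single ⟨j, i⟩ 1 := by
    ext ⟨j', i'⟩
    by_cases hj : j' = j
    · subst hj
      by_cases hi : i' = i
      · subst hi; simp
      · rw [Pi.single_eq_same, Pi.single_eq_of_ne hi, Pi.single_eq_of_ne]
        simpa using hi
    · rw [Pi.single_eq_of_ne hj, Pi.single_eq_of_ne (by simp [hj])]; rfl
  rw [chainMap, this, mulVec_single_one]; rfl

lemma chainMap_eq_sum (K : KroneckerForm E A) (j : Fin K.count) (v : Fin (K.block j).size → ℂ) :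
    K.chainMap j v = ∑ i, v i • K.chain ⟨j, i⟩ := by
  ext x
  simp only [chainMap, mulVec, dotProduct, ← Finset.univ_sigma_univ, Finset.sum_sigma,
    Finset.sum_apply, Pi.smul_apply, smul_eq_mul, chain]
  rw [Finset.sum_eq_single j]
  · simp [mul_comm]
  · intro j' _ hj'
    simp [Pi.single_eq_of_ne hj']
  · simp

lemma Ur_mulVec_injective (K : KroneckerForm E A) : Function.Injective K.Ur.mulVec := by
  obtain ⟨T, -, hT⟩ := K.Ur_invertible
  intro x y h
  have := congrArg (T *ᵥ ·) h
  simpa [mulVec_mulVec, hT] using this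

lemma exists_Ur_mulVec (K : KroneckerForm E A) (x : ι → ℂ) : ∃ c, K.Ur *ᵥ c = x := by
  obtain ⟨T, hT, -⟩ := K.Ur_invertible
  exact ⟨T *ᵥ x, by rw [mulVec_mulVec, hT, one_mulVec]⟩

lemma linearIndependent_chain (K : KroneckerForm E A) : LinearIndependent ℂ K.chain :=
  mulVec_injective_iff.mp K.Ur_mulVec_injective

lemma sum_size (K : KroneckerForm E A) : ∑ j, (K.block j).size = Fintype.card ι := by
  obtain ⟨T, hT, hT'⟩ := K.Ur_invertible
  have := (toLin'OfInv hT hT').finrank_eq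
  simpa using this.symm

/-- The operator `S` acts on the chains of a Kronecker form like a matrix in Jordan form, up to an
invertible factor: on the `j`-th block it is `θ j` plus the shift times an invertible matrix that
commutes with the shift. -/
def IsChainOperator (K : KroneckerForm E A) (S : Matrix ι ι ℂ) (θ : Fin K.count → ℂ) : Prop :=
  ∃ w : ∀ j, Matrix (Fin (K.block j).size) (Fin (K.block j).size) ℂ,
    (∀ j, Commute (shift (K.block j).size) (w j)) ∧ (∀ j, IsUnit (w j)) ∧
    S * K.Ur = K.Ur * blockDiagonal' fun j => θ j • 1 + shift (K.block j).size * w j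

/-- The chains of `s E - A` are, up to invertible factors, Jordan chains of
`S = (a E - b A)⁻¹ i (E - A)`. -/
lemma isChainOperator (K : KroneckerForm E A) {a b : ℂ} (hab : a ≠ b) (hb : b ≠ 0)
    (hZ : IsUnit (a • E - b • A).det) (hS : (a • E - b • A) * S = Complex.I • (E - A)) :
    (∀ j, (K.block j).scalar a b ≠ 0) ∧
      K.IsChainOperator S fun j => (K.block j).theta a b := by
  set Z := a • E - b • A with hZdef
  have hblockZ : K.Ul * Z * K.Ur =
      blockDiagonal' fun j => a • (K.block j).matE - b • (K.block j).matA := by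
    have : (fun j => a • (K.block j).matE - b • (K.block j).matA) =
        a • (fun j => (K.block j).matE) - b • fun j => (K.block j).matA := rfl
    rw [this, blockDiagonal'_sub, blockDiagonal'_smul, blockDiagonal'_smul, ← K.eq_E, ← K.eq_A,
      hZdef]
    simp [Matrix.mul_sub, Matrix.sub_mul]
  obtain ⟨T, -, hT⟩ := K.Ul_invertible
  have hcancel : ∀ {κ : Type} (X Y : Matrix ι κ ℂ), K.Ul * (Z * X) = K.Ul * (Z * Y) → X = Y := by
    intro κ X Y h
    have hT' : ∀ M : Matrix ι κ ℂ, T * (K.Ul * M) = M := fun M => by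
      rw [← Matrix.mul_assoc, hT, Matrix.one_mul]
    have hZ' : ∀ M : Matrix ι κ ℂ, Z⁻¹ * (Z * M) = M := fun M => by
      rw [← Matrix.mul_assoc, nonsing_inv_mul _ hZ, Matrix.one_mul]
    rw [← hZ' X, ← hZ' Y, ← hT' (Z * X), ← hT' (Z * Y), h]
  have hscalar : ∀ j, (K.block j).scalar a b ≠ 0 := by
    intro j hj
    rcases hB : K.block j with ⟨k, ev⟩ | k
    · rw [hB] at hj
      have hpos := (K.block j).size_pos
      -- the first vector of the chain would be in the kernel of `a E - b A`
      have h0 : (K.Ul * Z * K.Ur) *ᵥ (fun p => (Pi.single j (Pi.single ⟨0, hpos⟩ 1) :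
          ∀ j, Fin (K.block j).size → ℂ) p.1 p.2) = 0 := by
        rw [hblockZ]
        ext ⟨j', i'⟩
        rw [blockDiagonal'_mulVec]
        by_cases hj' : j' = j
        · subst hj'
          have h1 : shift (K.block j').size *ᵥ (Pi.single ⟨0, hpos⟩ 1) = 0 := by
            simpa using shift_pow_mulVec_single_eq_zero 1 (⟨0, hpos⟩ : Fin (K.block j').size)
              (by simp)
          have h2 : a • (K.block j').matE - b • (K.block j').matA =
              -b • shift (K.block j').size := by
            have hj0 : a - b * ev = 0 := hj
            have : ∀ B : KBlock, B = KBlock.w1 k ev →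
                a • B.matE - b • B.matA = -b • shift B.size := by
              rintro _ rfl
              have : a • (1 : Matrix (Fin k) (Fin k) ℂ) - b • (ev • 1 + shift k) =
                  (a - b * ev) • 1 + (-b) • shift k := by module
              rw [hj0, zero_smul, zero_add] at this
              exact this
            exact this _ hB
          simp only [Pi.single_eq_same]
          rw [h2, smul_mulVec, h1]; simp
        · simp only [Pi.single_eq_of_ne hj']
          exact congrFun (mulVec_zero _) i'
      rw [Matrix.mul_assoc, ← mulVec_mulVec] at h0
      have h1 := congrArg (T *ᵥ ·) h0
      rw [mulVec_mulVec, hT, one_mulVec, mulVec_zero, ← mulVec_mulVec] at h1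
      have h2 := congrArg (Z⁻¹ *ᵥ ·) h1
      rw [mulVec_mulVec, nonsing_inv_mul _ hZ, one_mulVec, mulVec_zero] at h2
      have h3 := K.Ur_mulVec_injective (h2.trans (mulVec_zero _).symm)
      have h4 := congrFun h3 ⟨j, ⟨0, hpos⟩⟩
      simp at h4
    · rw [hB] at hj
      exact hb (by simpa [KBlock.scalar] using hj)
  refine ⟨hscalar, ?_⟩
  choose w hw1 hw2 hw3 using fun j => (K.block j).exists_unit hab hb (hscalar j)
  refine ⟨w, hw1, hw2, hcancel _ _ ?_⟩
  rw [← Matrix.mul_assoc Z S, hS, ← Matrix.mul_assoc Z, ← Matrix.mul_assoc K.Ul (Z * K.Ur),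
    ← Matrix.mul_assoc K.Ul Z, ← Matrix.mul_assoc, hblockZ, ← blockDiagonal'_mul]
  simp only [hw3]
  have : (fun j => Complex.I • ((K.block j).matE - (K.block j).matA)) =
      Complex.I • ((fun j => (K.block j).matE) - fun j => (K.block j).matA) := rfl
  rw [this, blockDiagonal'_smul, blockDiagonal'_sub, ← K.eq_E, ← K.eq_A]
  simp [Matrix.mul_sub, Matrix.sub_mul]

variable {K : KroneckerForm E A} {θ : Fin K.count → ℂ}

section ChainOperator

variable {w : ∀ j, Matrix (Fin (K.block j).size) (Fin (K.block j).size) ℂ}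

lemma sub_smul_pow_mulVec
    (h : S * K.Ur = K.Ur * blockDiagonal' fun j => θ j • 1 + shift (K.block j).size * w j)
    (c : ℂ) (a : ℕ) (v : (Σ j, Fin (K.block j).size) → ℂ) :
    (S - c • (1 : Matrix ι ι ℂ)) ^ a *ᵥ (K.Ur *ᵥ v) = K.Ur *ᵥ
      fun p => (((θ p.1 - c) • 1 + shift (K.block p.1).size * w p.1) ^ a *ᵥ
        fun i => v ⟨p.1, i⟩) p.2 := by
  have h1 : (S - c • (1 : Matrix ι ι ℂ)) * K.Ur =
      K.Ur * blockDiagonal' fun j => (θ j - c) • 1 + shift (K.block j).size * w j := by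
    have : (fun j => (θ j - c) • 1 + shift (K.block j).size * w j) =
        (fun j => θ j • 1 + shift (K.block j).size * w j) - c • 1 := by
      ext1 j
      simp only [Pi.sub_apply, Pi.smul_apply, Pi.one_apply]
      module
    rw [this, blockDiagonal'_sub, blockDiagonal'_smul, blockDiagonal'_one, Matrix.sub_mul, h,
      Matrix.mul_sub]
    simp
  have h2 : (S - c • (1 : Matrix ι ι ℂ)) ^ a * K.Ur =
      K.Ur * blockDiagonal' fun j => ((θ j - c) • 1 + shift (K.block j).size * w j) ^ a := by
    have h3 : (blockDiagonal' fun j => ((θ j - c) • 1 + shift (K.block j).size * w j) ^ a) =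
        (blockDiagonal' fun j => (θ j - c) • 1 + shift (K.block j).size * w j) ^ a :=
      blockDiagonal'_pow _ a
    rw [h3]
    induction a with
    | zero => simp
    | succ a ih =>
      rw [pow_succ, Matrix.mul_assoc, h1, ← Matrix.mul_assoc, ih (blockDiagonal'_pow _ a),
        Matrix.mul_assoc, pow_succ]
  rw [mulVec_mulVec, h2, ← mulVec_mulVec]
  congr 1
  ext p
  rw [blockDiagonal'_mulVec]

lemma sub_smul_pow_mulVec_chainMap
    (h : S * K.Ur = K.Ur * blockDiagonal' fun j => θ j • 1 + shift (K.block j).size * w j)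
    (a : ℕ) (j : Fin K.count) (v : Fin (K.block j).size → ℂ) :
    (S - θ j • (1 : Matrix ι ι ℂ)) ^ a *ᵥ K.chainMap j v =
      K.chainMap j ((shift (K.block j).size * w j) ^ a *ᵥ v) := by
  rw [chainMap, sub_smul_pow_mulVec h, chainMap]
  congr 1
  ext ⟨j', i⟩
  by_cases hj : j' = j
  · subst hj; simp
  · simp only [Pi.single_eq_of_ne hj]
    exact congrFun (mulVec_zero _) i

end ChainOperator

lemma IsChainOperator.pow_mulVec_chain (h : K.IsChainOperator S θ) (j : Fin K.count)
    (i : Fin (K.block j).size) :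
    (S - θ j • (1 : Matrix ι ι ℂ)) ^ ((i : ℕ) + 1) *ᵥ K.chain ⟨j, i⟩ = 0 := by
  obtain ⟨w, hw, -, h⟩ := h
  rw [← chainMap_single, sub_smul_pow_mulVec_chainMap h, (hw j).mul_pow,
    ((hw j).pow_pow _ _).eq, ← mulVec_mulVec, shift_pow_mulVec_single_eq_zero _ _ (by omega),
    mulVec_zero, chainMap_zero]

/-- The vectors in the first half of a chain are of the form `Nˡ y` with `N²ˡ y = 0`. -/
lemma IsChainOperator.exists_pow_mulVec_eq_chain (h : K.IsChainOperator S θ) (j : Fin K.count)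
    (i : Fin (K.block j).size) (hi : 2 * (i : ℕ) + 1 < (K.block j).size) :
    ∃ y, (S - θ j • (1 : Matrix ι ι ℂ)) ^ (2 * ((i : ℕ) + 1)) *ᵥ y = 0 ∧
      (S - θ j • (1 : Matrix ι ι ℂ)) ^ ((i : ℕ) + 1) *ᵥ y = K.chain ⟨j, i⟩ := by
  obtain ⟨w, hw, hwu, h⟩ := h
  have hinv := pow_mul_inv_pow (hwu j) ((i : ℕ) + 1)
  have hcw := commute_shift_inv (hw j) (hwu j)
  refine ⟨K.chainMap j ((w j)⁻¹ ^ ((i : ℕ) + 1) *ᵥ Pi.single ⟨2 * i + 1, hi⟩ 1), ?_, ?_⟩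
  · rw [sub_smul_pow_mulVec_chainMap h, (hw j).mul_pow, mulVec_mulVec,
      ((hw j).pow_pow _ _).eq, Matrix.mul_assoc, (hcw.pow_pow _ _).eq, ← mulVec_mulVec,
      ← mulVec_mulVec, shift_pow_mulVec_single_eq_zero _ _ (by simp; omega)]
    simp [chainMap_zero]
  · rw [sub_smul_pow_mulVec_chainMap h, (hw j).mul_pow, mulVec_mulVec, Matrix.mul_assoc, hinv,
      Matrix.mul_one, shift_pow_mulVec_single _ _ i (by simp; omega), chainMap_single]

/-- A chain cannot be prolonged within the generalized eigenspace. -/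
lemma IsChainOperator.exists_pow_mulVec_ne (h : K.IsChainOperator S θ) (j : Fin K.count) :
    ∃ x, (S - θ j • (1 : Matrix ι ι ℂ)) ^ (K.block j).size *ᵥ x = 0 ∧
      ∀ y, (S - θ j • (1 : Matrix ι ι ℂ)) ^ (K.block j).size *ᵥ y ≠
        (S - θ j • (1 : Matrix ι ι ℂ)) ^ ((K.block j).size - 1) *ᵥ x := by
  obtain ⟨w, hw, hwu, h⟩ := h
  have hpos := (K.block j).size_pos
  set k := (K.block j).size with hk
  have hinv := pow_mul_inv_pow (hwu j) (k - 1)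
  refine ⟨K.chainMap j ((w j)⁻¹ ^ (k - 1) *ᵥ Pi.single ⟨k - 1, by omega⟩ 1), ?_, ?_⟩
  · rw [sub_smul_pow_mulVec_chainMap h, (hw j).mul_pow, shift_pow_eq_zero]
    simp [chainMap_zero]
  · intro y hy
    rw [sub_smul_pow_mulVec_chainMap h, (hw j).mul_pow, mulVec_mulVec, Matrix.mul_assoc, hinv,
      Matrix.mul_one, shift_pow_mulVec_single _ _ ⟨0, hpos⟩ (by simp)] at hy
    obtain ⟨c, rfl⟩ := K.exists_Ur_mulVec y
    rw [sub_smul_pow_mulVec h] at hy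
    have h1 := congrFun (K.Ur_mulVec_injective hy) ⟨j, ⟨0, hpos⟩⟩
    simp only [sub_self, zero_smul, zero_add, Pi.single_eq_same] at h1
    rw [(hw j).mul_pow, shift_pow_eq_zero] at h1
    simp at h1

lemma IsChainOperator.mulVec_chain_mem (h : K.IsChainOperator S θ) (j : Fin K.count)
    (i : Fin (K.block j).size) {L : Submodule ℂ (ι → ℂ)} (hL : ∀ i' ≤ i, K.chain ⟨j, i'⟩ ∈ L) :
    S *ᵥ K.chain ⟨j, i⟩ ∈ L := by
  obtain ⟨w, hw, hwu, h⟩ := h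
  have h1 := sub_smul_pow_mulVec_chainMap h 1 j (Pi.single i 1)
  rw [pow_one, pow_one, sub_mulVec, smul_mulVec, one_mulVec, chainMap_single,
    sub_eq_iff_eq_add] at h1
  rw [h1]
  refine L.add_mem ?_ (L.smul_mem _ (hL i le_rfl))
  rw [chainMap_eq_sum]
  refine L.sum_mem fun i' _ => ?_
  by_cases hi' : i' ≤ i
  · exact L.smul_mem _ (hL i' hi')
  · have : ((shift (K.block j).size * w j) *ᵥ Pi.single i 1) i' = 0 := by
      refine apply_eq_zero_of_shift_pow_mulVec (a := (i : ℕ) + 1) ?_ (by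
        have := lt_of_not_ge hi'
        rw [Fin.lt_def] at this
        omega)
      have hc : Commute (shift (K.block j).size ^ ((i : ℕ) + 1)) (shift (K.block j).size * w j) :=
        ((Commute.refl _).mul_right (hw j)).pow_left _
      rw [mulVec_mulVec, hc.eq, ← mulVec_mulVec,
        shift_pow_mulVec_single_eq_zero _ _ (Nat.lt_succ_self _), mulVec_zero]
    rw [this, zero_smul]
    exact L.zero_mem

end KroneckerForm

/-! ### Semi-stable Lagrangian subspaces -/

section Lagrangian

variable {ι : Type*} [Fintype ι] {E A G S : Matrix ι ι ℂ}

lemma form_eq_zero_of_span {s t : Set (ι → ℂ)} (h : ∀ x ∈ s, ∀ y ∈ t, form G x y = 0)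
    {x y : ι → ℂ} (hx : x ∈ Submodule.span ℂ s) (hy : y ∈ Submodule.span ℂ t) :
    form G x y = 0 := by
  induction hx using Submodule.span_induction with
  | zero => simp
  | add _ _ _ _ h1 h2 => simp [h1, h2]
  | smul _ _ _ h1 => simp [h1]
  | mem x hx =>
    induction hy using Submodule.span_induction with
    | zero => simp
    | add _ _ _ _ h1 h2 => simp [h1, h2]
    | smul _ _ _ h1 => simp [h1]
    | mem y hy => exact h x hx y hy

variable [DecidableEq ι]

/-- Orthogonal families in a nondegenerate space have complementary dimensions at most. -/
lemma card_add_card_le (hG1 : G * G = 1) {κ κ' : Type*} [Fintype κ] [Fintype κ']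
    {u : κ → ι → ℂ} {v : κ' → ι → ℂ} (hu : LinearIndependent ℂ u) (hv : LinearIndependent ℂ v)
    (h : ∀ a b, form G (u a) (v b) = 0) : Fintype.card κ + Fintype.card κ' ≤ Fintype.card ι := by
  classical
  set M : Matrix κ ι ℂ := (of u)ᵀᴴ * G with hM
  have hdet : IsUnit G.det := by
    rw [← isUnit_iff_isUnit_det]
    exact IsUnit.of_mul_eq_one _ hG1
  have hrank : M.rank = Fintype.card κ := by
    rw [hM, rank_mul_eq_left_of_isUnit_det _ _ hdet, rank_conjTranspose, rank_transpose]
    exact LinearIndependent.rank_matrix hu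
  have hker : Submodule.span ℂ (Set.range v) ≤ LinearMap.ker M.mulVecLin := by
    rw [Submodule.span_le]
    rintro _ ⟨b, rfl⟩
    simp only [SetLike.mem_coe, LinearMap.mem_ker, mulVecLin_apply]
    ext a
    have := h a b
    rw [hM, ← mulVec_mulVec]
    simpa [form, mulVec, dotProduct] using this
  have h1 := Submodule.finrank_mono hker
  rw [finrank_span_eq_card hv] at h1
  have h2 := LinearMap.finrank_range_add_finrank_ker M.mulVecLin
  rw [Module.finrank_fintype_fun_eq_card] at h2
  rw [Matrix.rank] at hrank
  omega

/-- A neutral subspace has at most half the dimension of the space. -/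
lemma two_mul_finrank_le (hG1 : G * G = 1) {W : Submodule ℂ (ι → ℂ)}
    (hW : ∀ w ∈ W, ∀ w' ∈ W, form G w w' = 0) : 2 * Module.finrank ℂ W ≤ Fintype.card ι := by
  let b := Module.finBasis ℂ W
  have hb : LinearIndependent ℂ (fun i => (b i : ι → ℂ)) :=
    b.linearIndependent.map' W.subtype (Submodule.ker_subtype W)
  have := card_add_card_le hG1 hb hb fun i j => hW _ (b i).2 _ (b j).2
  simpa [two_mul] using this

/-- `W` is an `n`-dimensional neutral invariant subspace on which all eigenvalues of `S` lie in the
closed upper half-plane. -/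
structure IsSemiStableLagrangian (G S : Matrix ι ι ℂ) (n : ℕ) (W : Submodule ℂ (ι → ℂ)) :
    Prop where
  invariant : ∀ w ∈ W, S *ᵥ w ∈ W
  neutral : ∀ w ∈ W, ∀ w' ∈ W, form G w w' = 0
  im_nonneg : ∀ w ∈ W, ∀ θ : ℂ, w ≠ 0 → S *ᵥ w = θ • w → 0 ≤ θ.im
  finrank_eq : Module.finrank ℂ W = n

lemma sub_smul_pow_mulVec_of_eigenvector {c : ℂ} {w : ι → ℂ} (h : S *ᵥ w = c • w) (θ : ℂ) (k : ℕ) :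
    (S - θ • (1 : Matrix ι ι ℂ)) ^ k *ᵥ w = (c - θ) ^ k • w := by
  induction k with
  | zero => simp
  | succ k ih =>
    rw [pow_succ, ← mulVec_mulVec, sub_mulVec, smul_mulVec, one_mulVec, h, ← sub_smul, mulVec_smul,
      ih, smul_smul, pow_succ, mul_comm]

/-- Generalized eigenspaces of eigenvalues that are not complex conjugate are orthogonal. -/
lemma form_eq_zero_of_ne (hS : Sᴴ * G = G * S) {θ θ' : ℂ} (hθ : star θ ≠ θ') {k l : ℕ}
    {x y : ι → ℂ} (hx : (S - θ • (1 : Matrix ι ι ℂ)) ^ k *ᵥ x = 0)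
    (hy : (S - θ' • (1 : Matrix ι ι ℂ)) ^ l *ᵥ y = 0) : form G x y = 0 := by
  refine form_eq_zero_of_genEigenspace hS
    (W := LinearMap.ker ((S - θ • (1 : Matrix ι ι ℂ)) ^ k).mulVecLin) ?_ ?_ l hy ?_
  · intro w hw
    simp only [LinearMap.mem_ker, mulVecLin_apply] at hw ⊢
    have hc : Commute ((S - θ • (1 : Matrix ι ι ℂ)) ^ k) S :=
      (((Commute.refl S).sub_left ((Commute.one_left S).smul_left θ))).pow_left k
    rw [mulVec_mulVec, hc.eq, ← mulVec_mulVec, hw, mulVec_zero]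
  · intro w hw hw'
    simp only [LinearMap.mem_ker, mulVecLin_apply] at hw
    rw [sub_smul_pow_mulVec_of_eigenvector hw'] at hw
    refine (smul_eq_zero.mp hw).resolve_left (pow_ne_zero _ (sub_ne_zero.mpr ?_))
    rintro h
    exact hθ (by rw [← h, star_star])
  · simpa using hx

namespace KroneckerForm

variable {Λ : Submodule ℂ (ι → ℂ)} {K : KroneckerForm E A} {θ : Fin K.count → ℂ}

/-- The eigenvalue `θ j` has negative, zero or positive imaginary part according to whether the
`j`-th block belongs to an eigenvalue inside, on or outside the unit circle. -/
structure IsCompatible (K : KroneckerForm E A) (θ : Fin K.count → ℂ) : Prop where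
  dStable : ∀ j, (K.block j).DStable ↔ (θ j).im < 0
  dCritical : ∀ j, (K.block j).DCritical ↔ (θ j).im = 0
  dUnstable : ∀ j, (K.block j).DUnstable ↔ 0 < (θ j).im

/-- Chains at critical eigenvalues have even length. -/
lemma even_size (h : IsDefiniteOn G S Λ) (hK : K.IsChainOperator S θ) {j : Fin K.count}
    (hj : (θ j).im = 0) : Even (K.block j).size := by
  by_contra hodd
  obtain ⟨x, hx, hx'⟩ := hK.exists_pow_mulVec_ne j
  have hθ : θ j = ((θ j).re : ℂ) := Complex.ext (by simp) (by simp [hj])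
  rw [hθ] at hx hx'
  obtain ⟨y, hy⟩ := exists_pow_mulVec_eq_of_odd h (θ j).re (Nat.not_even_iff_odd.mp hodd) hx
  exact hx' y hy

lemma form_chain_eq_zero (hS : Sᴴ * G = G * S) (hK : K.IsChainOperator S θ)
    {p q : Σ j, Fin (K.block j).size} (hpq : star (θ p.1) ≠ θ q.1) :
    form G (K.chain p) (K.chain q) = 0 :=
  form_eq_zero_of_ne hS hpq (hK.pow_mulVec_chain p.1 p.2) (hK.pow_mulVec_chain q.1 q.2)

lemma card_subtype_sigma {c : ℕ} {s : Fin c → ℕ} (P : (Σ j, Fin (s j)) → Prop) [DecidablePred P] :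
    Fintype.card {p // P p} = ∑ j, ∑ i : Fin (s j), if P ⟨j, i⟩ then 1 else 0 := by
  rw [Fintype.card_subtype, Finset.card_filter, ← Finset.univ_sigma_univ, Finset.sum_sigma]

lemma sum_ite_lt_half (s : ℕ) : ∑ i : Fin s, (if (i : ℕ) < s / 2 then 1 else 0) = s / 2 := by
  rw [Fin.sum_univ_eq_sum_range (fun i => if i < s / 2 then 1 else 0), ← Finset.sum_filter]
  have : (Finset.range s).filter (· < s / 2) = Finset.range (s / 2) := by
    ext i; simp only [Finset.mem_filter, Finset.mem_range]; omega
  simp [this]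

open Classical in
/-- Orthogonality bounds the total lengths of the stable and of the unstable chains by half the
dimension less half the total length of the critical ones. As all lengths add up to the dimension,
both bounds are attained. -/
lemma weaklyDSplit (h : IsDefiniteOn G S Λ) (hK : K.IsChainOperator S θ) (hθ : K.IsCompatible θ)
    {n : ℕ} (hn : Fintype.card ι = 2 * n) : K.WeaklyDSplit n n := by
  have heven : ∀ j, (K.block j).DCritical → Even (K.block j).size := fun j hj =>
    even_size h hK ((hθ.dCritical j).mp hj)
  -- chains on one side of the critical line are orthogonal to all chains except those on the other
  -- side
  have hcount : ∀ P P' Q' : KBlock → Prop, (∀ j, P' (K.block j) → ¬ Q' (K.block j)) →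
      (∀ i j, P (K.block i) → P' (K.block j) ∨ Q' (K.block j) → star (θ i) ≠ θ j) →
      (∑ j, if P (K.block j) then (K.block j).size else 0) +
        ((∑ j, if P' (K.block j) then (K.block j).size else 0) +
          ∑ j, if Q' (K.block j) then (K.block j).size else 0) ≤ 2 * n := by
    intro P P' Q' hdisj hPP'
    have h1 := card_add_card_le h.mul_self
      (u := fun p : {p : Σ j, Fin (K.block j).size // P (K.block p.1)} => K.chain p)
      (v := fun p : {p : Σ j, Fin (K.block j).size // P' (K.block p.1) ∨ Q' (K.block p.1)} =>
        K.chain p)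
      (K.linearIndependent_chain.comp _ Subtype.val_injective)
      (K.linearIndependent_chain.comp _ Subtype.val_injective)
      fun p q => form_chain_eq_zero h.adjoint hK (hPP' _ _ p.2 q.2)
    rw [card_subtype_sigma, card_subtype_sigma, hn] at h1
    rw [← Finset.sum_add_distrib]
    refine le_trans (le_of_eq ?_) h1
    congr 1
    · refine Finset.sum_congr rfl fun j _ => ?_
      split_ifs <;> simp
    · refine Finset.sum_congr rfl fun j _ => ?_
      have := hdisj j
      by_cases h1 : P' (K.block j) <;> by_cases h2 : Q' (K.block j) <;> simp_all
  have htri : ∀ j, (if (K.block j).DStable then (K.block j).size else 0) +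
      (if (K.block j).DCritical then (K.block j).size else 0) +
      (if (K.block j).DUnstable then (K.block j).size else 0) = (K.block j).size := by
    intro j
    simp only [hθ.dStable, hθ.dCritical, hθ.dUnstable]
    rcases lt_trichotomy (θ j).im 0 with hj | hj | hj
    · simp [hj, hj.ne, hj.le]
    · simp [hj]
    · simp [hj, hj.ne', hj.le]
  have hsum := K.sum_size
  rw [hn, ← Finset.sum_congr rfl fun j _ => htri j, Finset.sum_add_distrib,
    Finset.sum_add_distrib] at hsum
  have hs := hcount KBlock.DStable KBlock.DStable KBlock.DCritical (by
    intro j hj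
    rw [hθ.dStable] at hj
    rw [hθ.dCritical]
    exact hj.ne) (by
    intro i j hi hj h'
    rw [hθ.dStable] at hi
    rw [hθ.dStable, hθ.dCritical, ← h'] at hj
    simp at hj
    rcases hj with hj | hj <;> linarith)
  have hu := hcount KBlock.DUnstable KBlock.DUnstable KBlock.DCritical (by
    intro j hj
    rw [hθ.dUnstable] at hj
    rw [hθ.dCritical]
    exact hj.ne') (by
    intro i j hi hj h'
    rw [hθ.dUnstable] at hi
    rw [hθ.dUnstable, hθ.dCritical, ← h'] at hj
    simp at hj
    rcases hj with hj | hj <;> linarith)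
  have hc : (∑ j, if (K.block j).DCritical then (K.block j).size else 0) =
      2 * ∑ j, if (K.block j).DCritical then (K.block j).size / 2 else 0 := by
    rw [Finset.mul_sum]
    refine Finset.sum_congr rfl fun j _ => ?_
    split_ifs with hj
    · obtain ⟨d, hd⟩ := heven j hj
      omega
    · rfl
  refine ⟨∑ j, if (K.block j).DCritical then (K.block j).size / 2 else 0, ?_, ?_, heven⟩ <;> omega

lemma dSemiUnstableSpan_eq (K : KroneckerForm E A) : K.dSemiUnstableSpan =
    Submodule.span ℂ (Set.range fun p : {p : Σ j, Fin (K.block j).size //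
      (K.block p.1).DUnstable ∨ (K.block p.1).DCritical ∧ (p.2 : ℕ) < (K.block p.1).size / 2} =>
      K.chain p) := by
  rw [dSemiUnstableSpan]
  congr 1
  ext v
  constructor
  · rintro ⟨j, i, hji, rfl⟩
    exact ⟨⟨⟨j, i⟩, hji⟩, rfl⟩
  · rintro ⟨⟨⟨j, i⟩, hji⟩, rfl⟩
    exact ⟨j, i, hji, rfl⟩

open Classical in
lemma finrank_dSemiUnstableSpan (hθ : K.IsCompatible θ) {n : ℕ}
    (hn : Fintype.card ι = 2 * n) (hsplit : K.WeaklyDSplit n n) :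
    Module.finrank ℂ K.dSemiUnstableSpan = n := by
  rw [dSemiUnstableSpan_eq]
  refine (finrank_span_eq_card
    (K.linearIndependent_chain.comp Subtype.val Subtype.val_injective)).trans ?_
  rw [card_subtype_sigma]
  have hj : ∀ j, (∑ i : Fin (K.block j).size, if (K.block j).DUnstable ∨
      (K.block j).DCritical ∧ (i : ℕ) < (K.block j).size / 2 then 1 else 0) =
      (if (K.block j).DUnstable then (K.block j).size else 0) +
      (if (K.block j).DCritical then (K.block j).size / 2 else 0) := by
    intro j
    by_cases hu : (K.block j).DUnstable
    · have hc : ¬ (K.block j).DCritical := by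
        rw [hθ.dUnstable] at hu
        rw [hθ.dCritical]
        exact hu.ne'
      simp [hu, hc]
    · by_cases hc : (K.block j).DCritical
      · simp only [hu, hc, false_or, true_and, if_false, if_true, zero_add]
        exact sum_ite_lt_half _
      · simp [hu, hc]
  rw [Finset.sum_congr rfl fun j _ => hj j, Finset.sum_add_distrib]
  obtain ⟨r, h1, h2, h3⟩ := hsplit
  have hsum := K.sum_size
  have htri : ∀ j, (K.block j).size = (if (K.block j).DStable then (K.block j).size else 0) +
      2 * (if (K.block j).DCritical then (K.block j).size / 2 else 0) +
      (if (K.block j).DUnstable then (K.block j).size else 0) := by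
    intro j
    have h3 := h3 j
    simp only [hθ.dStable, hθ.dCritical, hθ.dUnstable] at h3 ⊢
    rcases lt_trichotomy (θ j).im 0 with hj | hj | hj
    · simp [hj, hj.ne, hj.le]
    · obtain ⟨d, hd⟩ := h3 hj
      simp [hj]
      omega
    · simp [hj, hj.ne', hj.le]
  rw [hn, Finset.sum_congr rfl fun j _ => htri j, Finset.sum_add_distrib,
    Finset.sum_add_distrib, ← Finset.mul_sum] at hsum
  omega

/-- A semi-stable invariant neutral subspace is orthogonal to the canonical one. -/
lemma form_eq_zero_of_mem_dSemiUnstableSpan (h : IsDefiniteOn G S Λ)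
    (hK : K.IsChainOperator S θ) (hθ : K.IsCompatible θ)
    {W : Submodule ℂ (ι → ℂ)} (hW : ∀ w ∈ W, S *ᵥ w ∈ W)
    (hWn : ∀ w ∈ W, ∀ w' ∈ W, form G w w' = 0)
    (hWe : ∀ w ∈ W, ∀ θ : ℂ, w ≠ 0 → S *ᵥ w = θ • w → 0 ≤ θ.im)
    {w x : ι → ℂ} (hw : w ∈ W) (hx : x ∈ K.dSemiUnstableSpan) : form G w x = 0 := by
  rw [dSemiUnstableSpan_eq] at hx
  refine form_eq_zero_of_span (s := W) ?_ (Submodule.subset_span hw) hx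
  rintro w hw _ ⟨⟨⟨j, i⟩, hji⟩, rfl⟩
  rcases hji with hu | ⟨hc, hi⟩
  · rw [hθ.dUnstable] at hu
    refine form_eq_zero_of_genEigenspace h.adjoint hW ?_ _ (hK.pow_mulVec_chain j i) hw
    intro w' hw' he
    by_contra hne
    have := hWe w' hw' _ hne he
    simp at this
    linarith
  · rw [hθ.dCritical] at hc
    obtain ⟨y, hy, hy'⟩ := hK.exists_pow_mulVec_eq_chain j i (by simp at hi; omega)
    have hθj : θ j = ((θ j).re : ℂ) := Complex.ext (by simp) (by simp [hc])
    rw [hθj] at hy hy'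
    change form G w (K.chain ⟨j, i⟩) = 0
    rw [← hy']
    exact form_eq_zero_of_neutral h _ hW hWn hy le_rfl hw

/-- The span of the unstable chains and of the first halves of the critical ones is a semi-stable
Lagrangian subspace. -/
lemma isSemiStableLagrangian (h : IsDefiniteOn G S Λ)
    (hK : K.IsChainOperator S θ) (hθ : K.IsCompatible θ) {n : ℕ}
    (hn : Fintype.card ι = 2 * n) (hsplit : K.WeaklyDSplit n n) :
    IsSemiStableLagrangian G S n K.dSemiUnstableSpan := by
  have hgen : ∀ (j : Fin K.count) (i : Fin (K.block j).size), ((K.block j).DUnstable ∨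
      (K.block j).DCritical ∧ (i : ℕ) < (K.block j).size / 2) →
      K.chain ⟨j, i⟩ ∈ K.dSemiUnstableSpan := fun j i hji =>
    Submodule.subset_span ⟨j, i, hji, rfl⟩
  have hneutral : ∀ w ∈ K.dSemiUnstableSpan, ∀ w' ∈ K.dSemiUnstableSpan, form G w w' = 0 := by
    intro w hw w' hw'
    rw [dSemiUnstableSpan_eq] at hw hw'
    refine form_eq_zero_of_span ?_ hw hw'
    rintro _ ⟨⟨⟨j, i⟩, hji⟩, rfl⟩ _ ⟨⟨⟨j', i'⟩, hji'⟩, rfl⟩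
    by_cases hne : star (θ j) = θ j'
    · have him : -(θ j).im = (θ j').im := by rw [← hne]; simp
      simp only [hθ.dUnstable, hθ.dCritical] at hji hji'
      have hc : (θ j).im = 0 := by
        rcases hji with h1 | h1 <;> rcases hji' with h2 | h2 <;> linarith
      have hi : (i : ℕ) < (K.block j).size / 2 := by
        rcases hji with h1 | h1
        · linarith
        · exact h1.2
      have hi' : (i' : ℕ) < (K.block j').size / 2 := by
        rcases hji' with h1 | h1
        · linarith
        · exact h1.2
      obtain ⟨y, hy, hy'⟩ := hK.exists_pow_mulVec_eq_chain j i (by omega)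
      obtain ⟨z, hz, hz'⟩ := hK.exists_pow_mulVec_eq_chain j' i' (by omega)
      have hθj : star (θ j) = θ j := Complex.ext (by simp) (by simp [hc])
      rw [← hne, hθj] at hz hz'
      have hadj := adjoint_sub_smul h.adjoint (θ j)
      rw [hθj] at hadj
      change form G (K.chain ⟨j, i⟩) (K.chain ⟨j', i'⟩) = 0
      rw [← hy', ← hz']
      -- `N^(i+1) y` and `N^(i'+1) z` are orthogonal since `N^(i+i'+2)` kills `y` or `z`
      rcases le_total (i : ℕ) i' with hii | hii
      · rw [← form_star h.isHermitian, form_mulVec_left (adjoint_pow hadj _), mulVec_mulVec,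
          ← pow_add, show (i' : ℕ) + 1 + (i + 1) = (i' - i) + 2 * (i + 1) by omega, pow_add,
          ← mulVec_mulVec, hy]
        simp
      · rw [form_mulVec_left (adjoint_pow hadj _), mulVec_mulVec,
          ← pow_add, show (i : ℕ) + 1 + (i' + 1) = (i - i') + 2 * (i' + 1) by omega, pow_add,
          ← mulVec_mulVec, hz]
        simp
    · exact form_chain_eq_zero h.adjoint hK hne
  refine ⟨?_, hneutral, ?_, finrank_dSemiUnstableSpan hθ hn hsplit⟩
  · intro w hw
    have : K.dSemiUnstableSpan ≤ K.dSemiUnstableSpan.comap S.mulVecLin := by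
      conv_lhs => rw [dSemiUnstableSpan]
      rw [Submodule.span_le]
      rintro _ ⟨j, i, hji, rfl⟩
      refine hK.mulVec_chain_mem j i fun i' hi' => hgen j i' (hji.imp_right fun hc => ⟨hc.1, ?_⟩)
      have : (i' : ℕ) ≤ i := hi'
      omega
    exact this hw
  · intro w hw c hne he
    by_contra hneg
    -- an eigenvector for an eigenvalue in the open lower half-plane is orthogonal to all chains
    refine hne ?_
    have : w ∈ (⊥ : Submodule ℂ (ι → ℂ)) := by
      refine mem_of_forall_form_eq_zero h.isHermitian h.mul_self _ _ fun x _ => ?_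
      rw [← form_star h.isHermitian, star_eq_zero]
      obtain ⟨v, rfl⟩ := K.exists_Ur_mulVec x
      have hsum : K.Ur *ᵥ v = ∑ p, v p • K.chain p := by
        ext a
        simp [mulVec, dotProduct, chain, Finset.sum_apply, mul_comm]
      refine form_eq_zero_of_span (s := {w}) (t := Set.range K.chain) ?_
        (Submodule.subset_span rfl) ?_
      · rintro _ rfl _ ⟨⟨j, i⟩, rfl⟩
        by_cases hcj : star c = θ j
        · refine hneutral _ hw _ (hgen j i (Or.inl ?_))
          rw [hθ.dUnstable, ← hcj]
          simpa using hneg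
        · refine form_eq_zero_of_ne (k := 1) h.adjoint hcj ?_ (hK.pow_mulVec_chain j i)
          rw [sub_smul_pow_mulVec_of_eigenvector he]; simp
      · rw [hsum]
        exact Submodule.sum_mem _ fun p _ => Submodule.smul_mem _ _ (Submodule.subset_span ⟨p, rfl⟩)
    simpa using this

/-- There is only one semi-stable Lagrangian subspace. -/
lemma eq_dSemiUnstableSpan (h : IsDefiniteOn G S Λ)
    (hK : K.IsChainOperator S θ) (hθ : K.IsCompatible θ) {n : ℕ}
    (hn : Fintype.card ι = 2 * n) (hsplit : K.WeaklyDSplit n n) {W : Submodule ℂ (ι → ℂ)}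
    (hW : IsSemiStableLagrangian G S n W) : W = K.dSemiUnstableSpan := by
  have hL := isSemiStableLagrangian h hK hθ hn hsplit
  have horth : ∀ w ∈ W, ∀ x ∈ K.dSemiUnstableSpan, form G w x = 0 := fun w hw x hx =>
    form_eq_zero_of_mem_dSemiUnstableSpan h hK hθ hW.invariant hW.neutral hW.im_nonneg hw hx
  -- the sum of the two subspaces is neutral, so it cannot have dimension larger than `n`
  have hle := two_mul_finrank_le h.mul_self (W := W ⊔ K.dSemiUnstableSpan) (by
    intro x hx y hy
    obtain ⟨w, hw, l, hl, rfl⟩ := Submodule.mem_sup.mp hx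
    obtain ⟨w', hw', l', hl', rfl⟩ := Submodule.mem_sup.mp hy
    rw [form_add_left, form_add_right, form_add_right, hW.neutral w hw w' hw',
      hL.neutral l hl l' hl', horth w hw l' hl', ← form_star h.isHermitian, horth w' hw' l hl]
    simp)
  rw [hn] at hle
  have h1 := Submodule.eq_of_le_of_finrank_le (le_sup_left : W ≤ W ⊔ K.dSemiUnstableSpan)
    (by rw [hW.finrank_eq]; omega)
  have h2 := Submodule.eq_of_le_of_finrank_le
    (le_sup_right : K.dSemiUnstableSpan ≤ W ⊔ K.dSemiUnstableSpan)
    (by rw [hL.finrank_eq]; omega)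
  exact h1.trans h2.symm

end KroneckerForm

end Lagrangian

/-! ### Existence of Jordan and Kronecker forms -/

open Polynomial DirectSum in
/-- A basis of Jordan chains of `f`; the chain of the index `j` belongs to the eigenvalue `φ j`. -/
lemma exists_jordan_basis {V : Type} [AddCommGroup V] [Module ℂ V] [FiniteDimensional ℂ V]
    (f : Module.End ℂ V) : ∃ (c : ℕ) (s : Fin c → ℕ+) (φ : Fin c → ℂ)
      (b : Module.Basis (Σ j, Fin (s j)) ℂ V), ∀ j (a : Fin (s j)),
        f (b ⟨j, a⟩) = φ j • b ⟨j, a⟩ +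
          if h : 0 < (a : ℕ) then b ⟨j, ⟨a - 1, by omega⟩⟩ else 0 := by
  classical
  have htors : Module.IsTorsion ℂ[X] (Module.AEval' f) :=
    Module.AEval.isTorsion_of_finiteDimensional ℂ V f
  obtain ⟨I, hI, p, hp, e, ⟨Φ⟩⟩ := Module.equiv_directSum_of_isTorsion htors
  have hroot : ∀ i, ∃ φ : ℂ, Associated (X - C φ) (p i) := by
    intro i
    obtain ⟨φ, hφ⟩ := exists_root_of_degree_eq_one
      (IsAlgClosed.degree_eq_one_of_irreducible ℂ (hp i))
    exact ⟨φ, (irreducible_X_sub_C φ).associated_of_dvd (hp i) (dvd_iff_isRoot.mpr hφ)⟩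
  choose φ hφ using hroot
  let mkq : ∀ i, ℂ[X] →ₗ[ℂ[X]] (⨁ i, ℂ[X] ⧸ (ℂ[X] ∙ p i ^ e i)) := fun i =>
    (DirectSum.lof ℂ[X] I (fun i => ℂ[X] ⧸ (ℂ[X] ∙ p i ^ e i)) i).comp (Submodule.mkQ _)
  have hzero : ∀ i k, e i ≤ k → mkq i ((X - C (φ i)) ^ k) = 0 := by
    intro i k hk
    have : (X - C (φ i)) ^ k ∈ (ℂ[X] ∙ p i ^ e i) := by
      refine Ideal.mem_span_singleton.mpr ?_
      exact (((hφ i).pow_pow (n := e i)).symm.dvd).trans (pow_dvd_pow _ hk)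
    simp only [mkq, LinearMap.comp_apply, Submodule.mkQ_apply]
    rw [(Submodule.Quotient.mk_eq_zero _).mpr this, map_zero]
  let Ψ : V ≃ₗ[ℂ] (⨁ i, ℂ[X] ⧸ (ℂ[X] ∙ p i ^ e i)) :=
    (Module.AEval'.of f).trans (Φ.restrictScalars ℂ)
  have hΨ : ∀ x : (⨁ i, ℂ[X] ⧸ (ℂ[X] ∙ p i ^ e i)), Ψ.symm ((X : ℂ[X]) • x) = f (Ψ.symm x) := by
    intro x
    apply Ψ.injective
    rw [LinearEquiv.apply_symm_apply]
    have h1 : Ψ (f (Ψ.symm x)) = Φ (Module.AEval'.of f (f (Ψ.symm x))) := rfl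
    rw [h1, ← Module.AEval'.X_smul_of, map_smul]
    congr 1
    exact (Ψ.apply_symm_apply x).symm
  -- the chain vectors
  let v : (Σ i, Fin (e i)) → V := fun q => Ψ.symm (mkq q.1 ((X - C (φ q.1)) ^ (e q.1 - 1 - q.2)))
  have hspan : ⊤ ≤ Submodule.span ℂ (Set.range v) := by
    have hmem : ∀ y, Ψ.symm y ∈ Submodule.span ℂ (Set.range v) := by
      intro y
      induction y using DirectSum.induction_on with
      | zero => simp
      | add x y hx hy => rw [map_add]; exact Submodule.add_mem _ hx hy
      | of i x =>
        obtain ⟨g, rfl⟩ := Submodule.mkQ_surjective _ x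
        change Ψ.symm (mkq i g) ∈ _
        rw [← sum_taylor_eq g (φ i), Polynomial.sum, map_sum, map_sum]
        refine Submodule.sum_mem _ fun k _ => ?_
        rw [← smul_eq_C_mul, LinearMap.map_smul_of_tower, map_smul]
        refine Submodule.smul_mem _ _ ?_
        by_cases hk : e i ≤ k
        · rw [hzero i k hk, map_zero]; exact Submodule.zero_mem _
        · refine Submodule.subset_span ⟨⟨i, ⟨e i - 1 - k, by omega⟩⟩, ?_⟩
          simp only [v]
          congr 3
          omega
    intro x _
    simpa using hmem (Ψ x)
  have hcard : Fintype.card (Σ i, Fin (e i)) = Module.finrank ℂ V := by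
    have hq : ∀ i, Module.finrank ℂ (ℂ[X] ⧸ (ℂ[X] ∙ p i ^ e i)) = e i := by
      intro i
      have h1 : p i ^ e i ≠ 0 := pow_ne_zero _ (hp i).ne_zero
      have h2 := finrank_quotient_span_eq_natDegree (f := p i ^ e i)
      rw [natDegree_pow, natDegree_eq_of_degree_eq_some
        (IsAlgClosed.degree_eq_one_of_irreducible ℂ (hp i))] at h2
      exact h2.trans (Nat.mul_one _)
    have hfin : ∀ i, Module.Finite ℂ (ℂ[X] ⧸ (ℂ[X] ∙ p i ^ e i)) := by
      intro i
      have : Function.Injective (DirectSum.lof ℂ I (fun i => ℂ[X] ⧸ (ℂ[X] ∙ p i ^ e i)) i) :=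
        DirectSum.of_injective (β := fun i => ℂ[X] ⧸ (ℂ[X] ∙ p i ^ e i)) i
      have := isNoetherian_of_linearEquiv Ψ
      exact Module.Finite.of_injective _ ‹Function.Injective _›
    rw [Ψ.finrank_eq, Module.finrank_directSum, Fintype.card_sigma]
    simp [hq]
  let c := Fintype.card {i // 0 < e i}
  let ε : {i // 0 < e i} ≃ Fin c := Fintype.equivFin _
  let s : Fin c → ℕ+ := fun j => ⟨e (ε.symm j).1, (ε.symm j).2⟩
  let κ : (Σ j, Fin (s j)) ≃ Σ i, Fin (e i) := Equiv.ofBijective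
    (fun q => ⟨(ε.symm q.1).1, q.2⟩) (by
      constructor
      · rintro ⟨j, a⟩ ⟨j', a'⟩ h
        have h1 : (ε.symm j).1 = (ε.symm j').1 := congrArg Sigma.fst h
        obtain rfl : j = j' := ε.symm.injective (Subtype.ext h1)
        obtain rfl : a = a' := eq_of_heq (Sigma.mk.inj h).2
        rfl
      · rintro ⟨i, a⟩
        have hi : 0 < e i := lt_of_le_of_lt (Nat.zero_le _) a.2
        obtain ⟨j, hj⟩ := ε.symm.surjective ⟨i, hi⟩
        have hj' : i = (ε.symm j).1 := by rw [hj]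
        subst hj'
        exact ⟨⟨j, a⟩, rfl⟩)
  let b := (basisOfTopLeSpanOfCardEqFinrank v hspan hcard).reindex κ.symm
  have hb : ∀ j (a : Fin (s j)), b ⟨j, a⟩ =
      Ψ.symm (mkq (ε.symm j).1 ((X - C (φ (ε.symm j).1)) ^ ((s j : ℕ) - 1 - a))) := by
    intro j a
    simp only [b, Module.Basis.reindex_apply, coe_basisOfTopLeSpanOfCardEqFinrank, Equiv.symm_symm]
    rfl
  refine ⟨c, s, fun j => φ (ε.symm j).1, b, fun j a => ?_⟩
  set i := (ε.symm j).1 with hi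
  have hmul : ∀ k, f (Ψ.symm (mkq i ((X - C (φ i)) ^ k))) =
      φ i • Ψ.symm (mkq i ((X - C (φ i)) ^ k)) + Ψ.symm (mkq i ((X - C (φ i)) ^ (k + 1))) := by
    intro k
    rw [← hΨ, ← map_smul, ← map_smul, ← LinearMap.map_smul_of_tower, ← map_add, ← map_add]
    congr 2
    rw [smul_eq_C_mul, smul_eq_mul, pow_succ]
    ring
  rw [hb, hmul]
  congr 1
  split_ifs with ha
  · rw [hb]
    congr 3
    have := a.2
    simp only
    omega
  · have : (s j : ℕ) = e i := rfl
    rw [hzero i _ (by omega), map_zero]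

/-- The shift and its product with a commuting invertible matrix are similar: the basis
`wᵏ⁻¹⁻ⁱ eᵢ` is a Jordan chain of the product. -/
lemma exists_isUnit_mul_eq_mul_shift {k : ℕ} {w : Matrix (Fin k) (Fin k) ℂ}
    (hw : Commute (shift k) w) (hwu : IsUnit w) :
    ∃ g : Matrix (Fin k) (Fin k) ℂ, IsUnit g ∧ shift k * w * g = g * shift k := by
  let g : Matrix (Fin k) (Fin k) ℂ := of fun a i => (w ^ (k - 1 - (i : ℕ)) *ᵥ Pi.single i 1) a
  have hg : ∀ i, g *ᵥ Pi.single i 1 = w ^ (k - 1 - (i : ℕ)) *ᵥ Pi.single i 1 := by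
    intro i
    ext a
    simp only [mulVec_single_one, g]
    simp
  have hrel : shift k * w * g = g * shift k := by
    refine ext_of_mulVec_single fun i => ?_
    rw [← mulVec_mulVec _ (shift k * w), ← mulVec_mulVec _ g, hg, mulVec_mulVec _ (shift k * w),
      Matrix.mul_assoc, ← pow_succ', (hw.pow_right _).eq, ← mulVec_mulVec]
    by_cases hi : (i : ℕ) = 0
    · have h0 : shift k *ᵥ Pi.single i 1 = 0 := by
        simpa using shift_pow_mulVec_single_eq_zero 1 i (by omega)
      rw [h0, mulVec_zero, mulVec_zero]
    · have h0 : shift k *ᵥ Pi.single i 1 = Pi.single ⟨i - 1, by omega⟩ 1 := by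
        simpa using shift_pow_mulVec_single 1 i ⟨i - 1, by omega⟩ (by simp; omega)
      rw [h0, hg]
      congr 2
      simp only
      omega
  refine ⟨g, ?_, hrel⟩
  rw [← mulVec_injective_iff_isUnit, ← coe_mulVecLin, ← LinearMap.ker_eq_bot,
    LinearMap.ker_eq_bot']
  have key : ∀ (a : ℕ) (c : Fin k → ℂ), shift k ^ a *ᵥ c = 0 → g *ᵥ c = 0 → c = 0 := by
    intro a
    induction a with
    | zero => intro c hc _; simpa using hc
    | succ a ih =>
      intro c hc hgc
      have h1 := ih (shift k *ᵥ c) (by rwa [mulVec_mulVec, ← pow_succ])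
        (by rw [mulVec_mulVec, ← hrel, ← mulVec_mulVec, hgc, mulVec_zero])
      rcases Nat.eq_zero_or_pos k with rfl | hk
      · ext i; exact i.elim0
      have h2 : c = c ⟨0, hk⟩ • Pi.single ⟨0, hk⟩ 1 := by
        ext i
        by_cases hi : i = ⟨0, hk⟩
        · subst hi; simp
        · have h0 : (i : ℕ) ≠ 0 := fun h => hi (Fin.ext h)
          have hci : c i = 0 := apply_eq_zero_of_shift_pow_mulVec (a := 1) (by simpa using h1)
            (by omega)
          simp [Pi.single_eq_of_ne hi, hci]
      rw [h2, mulVec_smul, hg] at hgc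
      rcases smul_eq_zero.mp hgc with h3 | h3
      · rw [h2, h3, zero_smul]
      · exfalso
        have h4 : Function.Injective (w ^ (k - 1)).mulVec :=
          mulVec_injective_iff_isUnit.mpr (hwu.pow _)
        have h5 := congrFun (h4 (h3.trans (mulVec_zero _).symm)) ⟨0, hk⟩
        simp at h5
  intro c hc
  exact key k c (by rw [shift_pow_eq_zero, zero_mulVec]) hc

/-- A Jordan block of `(μ E - A)⁻¹ E` gives rise to a Kronecker block of `s E - A`. -/
lemma exists_kBlock (μ : ℂ) (k : ℕ+) (φ : ℂ) :
    ∃ (B : KBlock) (L L' : Matrix (Fin B.size) (Fin k) ℂ) (R R' : Matrix (Fin k) (Fin B.size) ℂ),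
      L * R' = 1 ∧ R' * L = 1 ∧ R * L' = 1 ∧ L' * R = 1 ∧
      L * (φ • 1 + shift k) * R = B.matE ∧
      L * (μ • (φ • 1 + shift k) - 1) * R = B.matA := by
  set N : Matrix (Fin k) (Fin k) ℂ := shift k with hN
  by_cases hφ : φ = 0
  · subst hφ
    have hZu : IsUnit (μ • N - 1) := by
      have := isUnit_smul_one_add_smul_shift (k := k) (c := -1) (by simp) μ
      convert this using 1
      rw [hN]; module
    have hcomm : Commute N (μ • N - 1) :=
      ((Commute.refl N).smul_right μ).sub_right (Commute.one_right N)
    set Z := μ • N - 1 with hZ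
    have hdet : IsUnit Z.det := (isUnit_iff_isUnit_det Z).mp hZu
    obtain ⟨g, hg, hgN⟩ := exists_isUnit_mul_eq_mul_shift (commute_shift_inv hcomm hZu)
      (isUnit_nonsing_inv_iff.mpr hZu)
    have hgd : IsUnit g.det := (isUnit_iff_isUnit_det g).mp hg
    have h1 : g⁻¹ * Z⁻¹ * (Z * g) = 1 := by
      rw [Matrix.mul_assoc, ← Matrix.mul_assoc Z⁻¹, nonsing_inv_mul _ hdet, Matrix.one_mul,
        nonsing_inv_mul _ hgd]
    have h2 : Z * g * (g⁻¹ * Z⁻¹) = 1 := by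
      rw [Matrix.mul_assoc, ← Matrix.mul_assoc g, mul_nonsing_inv _ hgd, Matrix.one_mul,
        mul_nonsing_inv _ hdet]
    have h5 : g⁻¹ * Z⁻¹ * ((0 : ℂ) • 1 + N) * g = N := by
      have h3 : Z⁻¹ * N = N * Z⁻¹ := (commute_shift_inv hcomm hZu).symm
      rw [zero_smul, zero_add, Matrix.mul_assoc g⁻¹, h3, Matrix.mul_assoc, hgN, ← Matrix.mul_assoc,
        nonsing_inv_mul _ hgd, Matrix.one_mul]
    have h6 : g⁻¹ * Z⁻¹ * (μ • ((0 : ℂ) • 1 + N) - 1) * g = 1 := by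
      rw [zero_smul, zero_add, ← hZ, Matrix.mul_assoc, h1]
    have h3 := mul_nonsing_inv _ hgd
    have h4 := nonsing_inv_mul _ hgd
    generalize g⁻¹ * Z⁻¹ = L at h1 h2 h5 h6
    generalize Z * g = R' at h1 h2
    generalize g⁻¹ = L' at h3 h4
    exact ⟨KBlock.w2 k, L, L', g, R', h1, h2, h3, h4, h5, h6⟩
  · have hXu : IsUnit (φ • 1 + N) := by
      have := isUnit_smul_one_add_smul_shift (k := k) hφ 1
      rwa [one_smul] at this
    have hcomm : Commute N (φ • 1 + N) :=
      ((Commute.one_right N).smul_right φ).add_right (Commute.refl N)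
    set X := φ • 1 + N with hX
    have hdet : IsUnit X.det := (isUnit_iff_isUnit_det X).mp hXu
    obtain ⟨g, hg, hgN⟩ := exists_isUnit_mul_eq_mul_shift (w := φ⁻¹ • X⁻¹)
      ((commute_shift_inv hcomm hXu).smul_right _)
      ((isUnit_nonsing_inv_iff.mpr hXu).smul (Units.mk0 φ⁻¹ (inv_ne_zero hφ)))
    have hgd : IsUnit g.det := (isUnit_iff_isUnit_det g).mp hg
    have h1 : g⁻¹ * X⁻¹ * (X * g) = 1 := by
      rw [Matrix.mul_assoc, ← Matrix.mul_assoc X⁻¹, nonsing_inv_mul _ hdet, Matrix.one_mul,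
        nonsing_inv_mul _ hgd]
    have h2 : X * g * (g⁻¹ * X⁻¹) = 1 := by
      rw [Matrix.mul_assoc, ← Matrix.mul_assoc g, mul_nonsing_inv _ hgd, Matrix.one_mul,
        mul_nonsing_inv _ hdet]
    have h5 : g⁻¹ * X⁻¹ * X * g = 1 := by rw [Matrix.mul_assoc, h1]
    have h6 : g⁻¹ * X⁻¹ * (μ • X - 1) * g = (μ - φ⁻¹) • 1 + N := by
      have h3 : X⁻¹ = φ⁻¹ • 1 - N * (φ⁻¹ • X⁻¹) := by
        have : X⁻¹ * X = 1 := nonsing_inv_mul _ hdet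
        have h4 : φ⁻¹ • (X * X⁻¹) = X⁻¹ + φ⁻¹ • (N * X⁻¹) := by
          conv_lhs => rw [hX, Matrix.add_mul, smul_mul_assoc, Matrix.one_mul, smul_add, smul_smul,
            inv_mul_cancel₀ hφ, one_smul, ← hX]
        rw [mul_nonsing_inv _ hdet] at h4
        rw [h4, mul_smul_comm]; abel
      have h4 : g⁻¹ * X⁻¹ * g = φ⁻¹ • 1 - N := by
        rw [h3, Matrix.mul_sub, Matrix.sub_mul, Matrix.mul_assoc g⁻¹ (N * _), hgN]
        rw [mul_smul_comm, smul_mul_assoc, Matrix.mul_one, nonsing_inv_mul _ hgd,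
          ← Matrix.mul_assoc, nonsing_inv_mul _ hgd, Matrix.one_mul]
      rw [Matrix.mul_sub, Matrix.sub_mul, mul_smul_comm, smul_mul_assoc, Matrix.mul_one, h4,
        Matrix.mul_assoc, h1]
      module
    have h3 := mul_nonsing_inv _ hgd
    have h4 := nonsing_inv_mul _ hgd
    generalize g⁻¹ * X⁻¹ = L at h1 h2 h5 h6
    generalize X * g = R' at h1 h2
    generalize g⁻¹ = L' at h3 h4
    exact ⟨KBlock.w1 k (μ - φ⁻¹), L, L', g, R', h1, h2, h3, h4, h5, h6⟩

/-- Weierstrass: every regular pencil has a Kronecker canonical form. -/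
theorem IsRegular.nonempty_kroneckerForm {ι : Type} [Fintype ι] [DecidableEq ι]
    {E A : Matrix ι ι ℂ} (h : IsRegular E A) : Nonempty (KroneckerForm E A) := by
  obtain ⟨μ, hμ⟩ := h
  set Z := μ • E - A with hZ
  have hdet : IsUnit Z.det := isUnit_iff_ne_zero.mpr hμ
  obtain ⟨c, s, φ, b, hb⟩ := exists_jordan_basis (Z⁻¹ * E).mulVecLin
  set U : Matrix ι (Σ j, Fin (s j)) ℂ := of fun a p => b p a with hU
  have hUb : U = (Pi.basisFun ℂ ι).toMatrix b := by
    ext a p; simp [hU, Module.Basis.toMatrix_apply]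
  set T : Matrix (Σ j, Fin (s j)) ι ℂ := b.toMatrix (Pi.basisFun ℂ ι) with hT
  have hUT : U * T = 1 := by rw [hUb, hT, Module.Basis.toMatrix_mul_toMatrix_flip]
  have hTU : T * U = 1 := by rw [hUb, hT, Module.Basis.toMatrix_mul_toMatrix_flip]
  have hJ : Z⁻¹ * E * U = U * blockDiagonal' fun j => φ j • 1 + shift (s j) := by
    ext x ⟨j, a⟩
    have h1 := congrFun (hb j a) x
    have h2 : (Z⁻¹ * E * U) x ⟨j, a⟩ = ((Z⁻¹ * E).mulVecLin (b ⟨j, a⟩)) x := rfl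
    rw [h2, h1, Matrix.mul_apply, ← Finset.univ_sigma_univ, Finset.sum_sigma,
      Finset.sum_eq_single j]
    · simp only [blockDiagonal'_apply_eq, Matrix.add_apply, Matrix.smul_apply, mul_add,
        Finset.sum_add_distrib, Pi.add_apply, Pi.smul_apply]
      congr 1
      · rw [Finset.sum_eq_single a]
        · simp [hU, mul_comm]
        · intro a' _ ha'; simp [Matrix.one_apply_ne ha']
        · simp
      · split_ifs with ha
        · rw [Finset.sum_eq_single (⟨a - 1, by omega⟩ : Fin (s j))]
          · simp [hU, shift, Nat.sub_add_cancel ha]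
          · intro a' _ ha'
            simp only [shift, of_apply]
            rw [if_neg, mul_zero]
            intro h'
            exact ha' (Fin.ext (by simp; omega))
          · simp
        · rw [Finset.sum_eq_zero]
          · rfl
          · intro a' _
            simp only [shift, of_apply]
            rw [if_neg (by omega), mul_zero]
    · intro j' _ hj'
      refine Finset.sum_eq_zero fun a' _ => ?_
      rw [blockDiagonal'_apply_ne _ _ _ hj', mul_zero]
    · simp
  choose B L L' R R' h1 h2 h3 h4 h5 h6 using fun j => exists_kBlock μ (s j) (φ j)
  have hone : ∀ {s' : Fin c → ℕ},
      (blockDiagonal' fun j => (1 : Matrix (Fin (s' j)) (Fin (s' j)) ℂ)) =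
      1 := blockDiagonal'_one
  have hTE : T * Z⁻¹ * E * U = blockDiagonal' fun j => φ j • 1 + shift (s j) := by
    rw [Matrix.mul_assoc T, Matrix.mul_assoc T, hJ, ← Matrix.mul_assoc, hTU, Matrix.one_mul]
  have hTA : T * Z⁻¹ * A * U = blockDiagonal' fun j => μ • (φ j • 1 + shift (s j)) - 1 := by
    have hA : A = μ • E - Z := by rw [hZ]; abel
    have : (fun j => μ • (φ j • (1 : Matrix (Fin (s j)) (Fin (s j)) ℂ) + shift (s j)) - 1) =
        μ • (fun j => φ j • (1 : Matrix (Fin (s j)) (Fin (s j)) ℂ) + shift (s j)) - 1 := rfl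
    rw [this, blockDiagonal'_sub, blockDiagonal'_smul, ← hTE, blockDiagonal'_one, hA,
      Matrix.mul_sub, Matrix.sub_mul, Matrix.mul_assoc T Z⁻¹ Z, nonsing_inv_mul _ hdet,
      Matrix.mul_one, hTU]
    simp
  refine ⟨{ count := c, block := B, Ul := blockDiagonal' L * (T * Z⁻¹),
            Ur := U * blockDiagonal' R, Ul_invertible := ⟨Z * U * blockDiagonal' R', ?_, ?_⟩,
            Ur_invertible := ⟨blockDiagonal' L' * T, ?_, ?_⟩, eq_E := ?_, eq_A := ?_ }⟩
  · rw [Matrix.mul_assoc, ← Matrix.mul_assoc (T * Z⁻¹), Matrix.mul_assoc T, ← Matrix.mul_assoc Z⁻¹,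
      nonsing_inv_mul _ hdet, Matrix.one_mul, hTU, Matrix.one_mul, ← blockDiagonal'_mul]
    simp only [h1, hone]
  · rw [Matrix.mul_assoc, ← Matrix.mul_assoc (blockDiagonal' R'), ← blockDiagonal'_mul]
    simp only [h2, hone]
    rw [Matrix.one_mul, Matrix.mul_assoc, ← Matrix.mul_assoc U, hUT, Matrix.one_mul,
      mul_nonsing_inv _ hdet]
  · rw [Matrix.mul_assoc, ← Matrix.mul_assoc (blockDiagonal' R), ← blockDiagonal'_mul]
    simp only [h3, hone]
    rw [Matrix.one_mul, hUT]
  · rw [Matrix.mul_assoc, ← Matrix.mul_assoc T, hTU, Matrix.one_mul, ← blockDiagonal'_mul]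
    simp only [h4, hone]
  · rw [show blockDiagonal' L * (T * Z⁻¹) * E * (U * blockDiagonal' R) =
      blockDiagonal' L * (T * Z⁻¹ * E * U) * blockDiagonal' R by simp only [Matrix.mul_assoc], hTE,
      ← blockDiagonal'_mul, ← blockDiagonal'_mul]
    simp only [h5]
  · rw [show blockDiagonal' L * (T * Z⁻¹) * A * (U * blockDiagonal' R) =
      blockDiagonal' L * (T * Z⁻¹ * A * U) * blockDiagonal' R by simp only [Matrix.mul_assoc], hTA,
      ← blockDiagonal'_mul, ← blockDiagonal'_mul]
    simp only [h6]

/-! ### The even pencil on the imaginary axis -/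

/-- A regular pencil is invertible at some point of the imaginary axis. -/
lemma IsRegular.exists_imaginary {ι : Type*} [Fintype ι] [DecidableEq ι] {E A : Matrix ι ι ℂ}
    (h : IsRegular E A) : ∃ ω : ℝ, ((Complex.I * ω) • E - A).det ≠ 0 := by
  obtain ⟨s, hs⟩ := h
  let p : Polynomial ℂ := ((Polynomial.X : Polynomial ℂ) • E.map Polynomial.C -
    A.map Polynomial.C).det
  have hp : ∀ z, p.eval z = (z • E - A).det := by
    intro z
    rw [← Polynomial.coe_evalRingHom, RingHom.map_det]
    congr 1
    ext i j
    simp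
    ring
  by_contra! hcon
  have hp0 : p = 0 := by
    refine Polynomial.eq_zero_of_infinite_isRoot p ?_
    refine Set.Infinite.mono (s := Set.range fun ω : ℝ => Complex.I * ω) ?_ ?_
    · rintro _ ⟨ω, rfl⟩
      change p.eval _ = 0
      rw [hp, hcon]
    · refine Set.infinite_range_of_injective fun a b hab => ?_
      simpa using hab
  exact hs (by rw [← hp, hp0, Polynomial.eval_zero])

section Pencil

variable {n m : ℕ}

/-- The Hermitian form `i ℰ` on the quotient of `ℂ²ⁿ⁺ᵐ` by the kernel of `ℰ`. -/
def gram (n : ℕ) : Matrix (Fin n ⊕ Fin n) (Fin n ⊕ Fin n) ℂ :=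
  Complex.I • fromBlocks 0 (-1) 1 0

/-- The operator on `ℂ²ⁿ` induced by `i (iω ℰ - 𝒜)⁻¹ ℰ` modulo the kernel of `ℰ`. -/
def shiftInvert (A Q : Matrix (Fin n) (Fin n) ℂ) (B C : Matrix (Fin n) (Fin m) ℂ)
    (R : Matrix (Fin m) (Fin m) ℂ) (ω : ℝ) : Matrix (Fin n ⊕ Fin n) (Fin n ⊕ Fin n) ℂ :=
  (((Complex.I * ω) • evenE n m - evenA A Q B C R)⁻¹).toBlocks₁₁ * gram n

/-- The Lagrangian subspace of `ℂ²ⁿ` consisting of the vectors with vanishing second half, the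
subspace `Λ` of the sign condition. -/
def firstHalf (n : ℕ) : Submodule ℂ (Fin n ⊕ Fin n → ℂ) :=
  LinearMap.ker (LinearMap.funLeft ℂ ℂ (Sum.inr : Fin n → Fin n ⊕ Fin n))

lemma gram_isHermitian : (gram n).IsHermitian := by
  rw [gram, IsHermitian, conjTranspose_smul, fromBlocks_conjTranspose]
  ext (i | i) (j | j) <;> simp

lemma gram_mul_gram : gram n * gram n = 1 := by
  rw [gram, smul_mul_smul_comm, fromBlocks_multiply, Complex.I_mul_I, ← fromBlocks_one]
  ext (i | i) (j | j) <;> simp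

lemma gram_mulVec (u a : Fin n → ℂ) :
    gram n *ᵥ Sum.elim u a = Sum.elim (-(Complex.I • a)) (Complex.I • u) := by
  rw [gram, smul_mulVec, fromBlocks_mulVec]
  ext (i | i) <;> simp [neg_mulVec]

lemma form_gram (u a u' a' : Fin n → ℂ) :
    form (gram n) (Sum.elim u a) (Sum.elim u' a') =
      Complex.I * (star a ⬝ᵥ u') - Complex.I * (star u ⬝ᵥ a') := by
  rw [form, gram_mulVec]
  have : star (Sum.elim u a) = Sum.elim (star u) (star a) := by ext (i | i) <;> rfl
  rw [this, sumElim_dotProduct_sumElim]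
  simp only [dotProduct_neg, dotProduct_smul, smul_eq_mul]
  ring

lemma mem_firstHalf {u a : Fin n → ℂ} : Sum.elim u a ∈ firstHalf n ↔ a = 0 := by
  rw [firstHalf, LinearMap.mem_ker]
  constructor
  · intro h; ext i; exact congrFun h i
  · intro h; ext i; exact congrFun h i

variable {A Q : Matrix (Fin n) (Fin n) ℂ} {B C : Matrix (Fin n) (Fin m) ℂ}
  {R : Matrix (Fin m) (Fin m) ℂ}

lemma smul_evenE_sub_evenA (s : ℂ) : s • evenE n m - evenA A Q B C R =
    fromBlocks (fromBlocks 0 (A - s • 1) (Aᴴ + s • 1) Q) (fromRows B C) (fromCols Bᴴ Cᴴ) R := by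
  rw [evenE, evenA]
  ext ((i | i) | i) ((j | j) | j) <;> simp <;> ring

lemma smul_evenE_sub_evenA_mulVec (s : ℂ) (u a : Fin n → ℂ) (b : Fin m → ℂ) :
    (s • evenE n m - evenA A Q B C R) *ᵥ Sum.elim (Sum.elim u a) b =
      Sum.elim (Sum.elim (A *ᵥ a - s • a + B *ᵥ b) (Aᴴ *ᵥ u + s • u + Q *ᵥ a + C *ᵥ b))
        (Bᴴ *ᵥ u + Cᴴ *ᵥ a + R *ᵥ b) := by
  rw [smul_evenE_sub_evenA, fromBlocks_mulVec]
  simp only [Sum.elim_comp_inl, Sum.elim_comp_inr, fromBlocks_mulVec, fromRows_mulVec,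
    fromCols_mulVec, zero_mulVec, zero_add, sub_mulVec, add_mulVec, smul_mulVec, one_mulVec]
  ext ((i | i) | i) <;> simp

lemma evenE_mulVec (x : Fin n ⊕ Fin n → ℂ) (b : Fin m → ℂ) :
    Complex.I • (evenE n m *ᵥ Sum.elim x b) = Sum.elim (gram n *ᵥ x) 0 := by
  rw [evenE, gram, fromBlocks_mulVec]
  ext (i | i) <;> simp [smul_mulVec]

lemma smul_evenE_sub_evenA_isHermitian (hQ : Q.IsHermitian) (hR : R.IsHermitian) (ω : ℝ) :
    ((Complex.I * ω) • evenE n m - evenA A Q B C R).IsHermitian := by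
  rw [smul_evenE_sub_evenA, IsHermitian, fromBlocks_conjTranspose, fromBlocks_conjTranspose,
    conjTranspose_fromRows_eq_fromCols_conjTranspose,
    conjTranspose_fromCols_eq_fromRows_conjTranspose, hQ.eq, hR.eq]
  congr 1
  · congr 1
    · simp
    · rw [conjTranspose_add, conjTranspose_conjTranspose, conjTranspose_smul, conjTranspose_one]
      simp [sub_eq_add_neg]
    · rw [conjTranspose_sub, conjTranspose_smul, conjTranspose_one]
      simp
  · simp

lemma SolvesLMI.R_isHermitian {Y : Matrix (Fin n) (Fin n) ℂ} (h : SolvesLMI A Q B C R Y) :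
    R.IsHermitian := by
  have := h.2.isHermitian
  rw [isHermitian_fromBlocks_iff] at this
  exact this.2.2.2

/-- The equation `S x = y` in terms of the even pencil; the last `m` components of the resolvent are
free. -/
lemma shiftInvert_mulVec_iff {ω : ℝ}
    (hω : IsUnit ((Complex.I * ω) • evenE n m - evenA A Q B C R).det)
    (x y : Fin n ⊕ Fin n → ℂ) :
    shiftInvert A Q B C R ω *ᵥ x = y ↔ ∃ b : Fin m → ℂ,
      ((Complex.I * ω) • evenE n m - evenA A Q B C R) *ᵥ Sum.elim y b =
        Sum.elim (gram n *ᵥ x) 0 := by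
  set H := (Complex.I * ω) • evenE n m - evenA A Q B C R with hH
  have h1 : H⁻¹ *ᵥ Sum.elim (gram n *ᵥ x) 0 =
      Sum.elim (shiftInvert A Q B C R ω *ᵥ x) (H⁻¹.toBlocks₂₁ *ᵥ gram n *ᵥ x) := by
    conv_lhs => rw [← fromBlocks_toBlocks H⁻¹, fromBlocks_mulVec]
    simp only [Sum.elim_comp_inl, Sum.elim_comp_inr, mulVec_zero, add_zero, shiftInvert,
      ← mulVec_mulVec]
    rfl
  constructor
  · rintro rfl
    refine ⟨H⁻¹.toBlocks₂₁ *ᵥ gram n *ᵥ x, ?_⟩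
    rw [← h1, mulVec_mulVec, mul_nonsing_inv _ hω, one_mulVec]
  · rintro ⟨b, hb⟩
    rw [← hb, mulVec_mulVec, nonsing_inv_mul _ hω, one_mulVec] at h1
    ext i
    exact (congrFun h1 (Sum.inl i)).symm

lemma shiftInvert_adjoint (hQ : Q.IsHermitian) (hR : R.IsHermitian) (ω : ℝ) :
    (shiftInvert A Q B C R ω)ᴴ * gram n = gram n * shiftInvert A Q B C R ω := by
  have h1 := (smul_evenE_sub_evenA_isHermitian (A := A) (B := B) (C := C) hQ hR ω).inv
  have h2 : ((((Complex.I * ω) • evenE n m - evenA A Q B C R)⁻¹).toBlocks₁₁).IsHermitian := by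
    ext i j
    exact congrFun (congrFun h1.eq (Sum.inl i)) (Sum.inl j)
  rw [shiftInvert, conjTranspose_mul, h2.eq, gram_isHermitian.eq, Matrix.mul_assoc]

/-! ### The quadratic form of the linear matrix inequality -/

/-- The Hermitian matrix of the linear matrix inequality. -/
def lmi (A Q : Matrix (Fin n) (Fin n) ℂ) (B C : Matrix (Fin n) (Fin m) ℂ)
    (R : Matrix (Fin m) (Fin m) ℂ) (Y : Matrix (Fin n) (Fin n) ℂ) :
    Matrix (Fin n ⊕ Fin m) (Fin n ⊕ Fin m) ℂ :=
  fromBlocks (Aᴴ * Y + Y * A + Q) (Y * B + C) (Bᴴ * Y + Cᴴ) R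

lemma lmi_mulVec (Y : Matrix (Fin n) (Fin n) ℂ) (a : Fin n → ℂ) (b : Fin m → ℂ) :
    lmi A Q B C R Y *ᵥ Sum.elim a b =
      Sum.elim (Aᴴ *ᵥ Y *ᵥ a + Y *ᵥ (A *ᵥ a + B *ᵥ b) + (Q *ᵥ a + C *ᵥ b))
        (Bᴴ *ᵥ Y *ᵥ a + (Cᴴ *ᵥ a + R *ᵥ b)) := by
  rw [lmi, fromBlocks_mulVec]
  simp only [Sum.elim_comp_inl, Sum.elim_comp_inr, add_mulVec, mulVec_add, mulVec_mulVec]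
  congr 1 <;> abel

lemma star_dotProduct_conjTranspose_mulVec {k l : ℕ} (M : Matrix (Fin k) (Fin l) ℂ)
    (a : Fin l → ℂ) (y : Fin k → ℂ) : star a ⬝ᵥ (Mᴴ *ᵥ y) = star (M *ᵥ a) ⬝ᵥ y := by
  rw [star_mulVec, dotProduct_mulVec]

/-- Replacing `X` by `Y` changes the quadratic form of the linear matrix inequality by
`2 Re a* (Y - X) (A a + B b)`. -/
lemma star_dotProduct_lmi_mulVec (Y X : Matrix (Fin n) (Fin n) ℂ) (a : Fin n → ℂ)
    (b : Fin m → ℂ) :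
    star (Sum.elim a b) ⬝ᵥ (lmi A Q B C R Y *ᵥ Sum.elim a b) =
      star (Sum.elim a b) ⬝ᵥ (lmi A Q B C R X *ᵥ Sum.elim a b) +
        (star (A *ᵥ a + B *ᵥ b) ⬝ᵥ ((Y - X) *ᵥ a) + star a ⬝ᵥ ((Y - X) *ᵥ (A *ᵥ a + B *ᵥ b))) := by
  have : star (Sum.elim a b) = Sum.elim (star a) (star b) := by ext (i | i) <;> rfl
  rw [this, lmi_mulVec, lmi_mulVec]
  simp only [sumElim_dotProduct_sumElim, dotProduct_add, star_dotProduct_conjTranspose_mulVec,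
    star_add, add_dotProduct, sub_mulVec, dotProduct_sub]
  ring

lemma star_dotProduct_mulVec_of_parallel (Y : Matrix (Fin n) (Fin n) ℂ) (ρ κ : ℝ) (e : Fin n → ℂ) :
    star ((Complex.I * κ) • e) ⬝ᵥ (Y *ᵥ ((ρ : ℂ) • e)) +
      star ((ρ : ℂ) • e) ⬝ᵥ (Y *ᵥ ((Complex.I * κ) • e)) = 0 := by
  simp only [star_smul, smul_dotProduct, mulVec_smul, dotProduct_smul, smul_eq_mul, star_mul']
  simp
  ring

/-- The Popov function is nonnegative on the imaginary axis, infinity included: the frequency is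
`κ / ρ`. On such vectors the quadratic form does not depend on the Hermitian matrix. -/
lemma re_popov_nonneg {Y : Matrix (Fin n) (Fin n) ℂ} (hY : SolvesLMI A Q B C R Y)
    (X : Matrix (Fin n) (Fin n) ℂ) {ρ κ : ℝ} {e : Fin n → ℂ} {b : Fin m → ℂ}
    (h : A *ᵥ ((ρ : ℂ) • e) + B *ᵥ b = (Complex.I * κ) • e) :
    0 ≤ star (Sum.elim ((ρ : ℂ) • e) b) ⬝ᵥ (lmi A Q B C R X *ᵥ Sum.elim ((ρ : ℂ) • e) b) := by
  rw [star_dotProduct_lmi_mulVec X Y, h, star_dotProduct_mulVec_of_parallel, add_zero]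
  exact hY.2.dotProduct_mulVec_nonneg _

/-! ### Sign condition and controllability of the even pencil -/

/-- The Hautus test in dual form. -/
lemma Stabilizable.eq_zero (hstab : Stabilizable A B) {s : ℂ} (hs : 0 ≤ s.re) {q : Fin n → ℂ}
    (hA : Aᴴ *ᵥ q = star s • q) (hB : Bᴴ *ᵥ q = 0) : q = 0 := by
  have h1 := hstab s hs
  set M := fromCols (s • (1 : Matrix (Fin n) (Fin n) ℂ) - A) B with hM
  have h2 : LinearMap.range M.mulVecLin = ⊤ := by
    apply Submodule.eq_top_of_finrank_eq
    rw [Module.finrank_fintype_fun_eq_card, Fintype.card_fin]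
    exact h1
  obtain ⟨v, hv⟩ : q ∈ LinearMap.range M.mulVecLin := by rw [h2]; trivial
  have h3 : star q ⬝ᵥ M.mulVecLin v = 0 := by
    rw [← Sum.elim_comp_inl_inr v]
    set a := v ∘ Sum.inl
    set b := v ∘ Sum.inr
    rw [mulVecLin_apply, hM, fromCols_mulVec]
    simp only [Sum.elim_comp_inl, Sum.elim_comp_inr]
    have hA' : star q ⬝ᵥ (A *ᵥ a) = s * (star q ⬝ᵥ a) := by
      have := star_dotProduct_conjTranspose_mulVec Aᴴ q a
      rw [conjTranspose_conjTranspose, hA] at this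
      rw [this]; simp
    have hB' : star q ⬝ᵥ (B *ᵥ b) = 0 := by
      have := star_dotProduct_conjTranspose_mulVec Bᴴ q b
      rw [conjTranspose_conjTranspose, hB] at this
      rw [this]; simp
    simp only [dotProduct_add, sub_mulVec, smul_mulVec, one_mulVec, dotProduct_sub, hA', hB',
      dotProduct_smul, smul_eq_mul]
    ring
  rw [hv] at h3
  exact dotProduct_star_self_eq_zero.mp h3

/-- Homogeneous version of the controllability of imaginary eigenvalues: the eigenvalue is
`i (1 - ω θ) / θ`, and `θ = 0` corresponds to infinity. -/
lemma Stabilizable.eq_zero_of_smul (hstab : Stabilizable A B) {ω θ : ℝ} {q : Fin n → ℂ}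
    (hA : (θ : ℂ) • (Aᴴ *ᵥ q) = (Complex.I * (1 - ω * θ)) • q)
    (hB : (θ : ℂ) • (Bᴴ *ᵥ q) = 0) : q = 0 := by
  by_cases hθ : θ = 0
  · subst hθ
    simpa using hA.symm
  · have hθ' : (θ : ℂ) ≠ 0 := by exact_mod_cast hθ
    refine hstab.eq_zero (s := Complex.I * ((ω - 1 / θ : ℝ) : ℂ)) (by simp) ?_
      ((smul_eq_zero.mp hB).resolve_left hθ')
    have := congrArg ((θ : ℂ)⁻¹ • ·) hA
    simp only [smul_smul, inv_mul_cancel₀ hθ', one_smul] at this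
    rw [this]
    congr 1
    simp
    field_simp
    ring

/-- Solvability of the linear matrix inequality gives the sign condition, and stabilizability
excludes eigenvectors orthogonal to `firstHalf`. -/
lemma isDefiniteOn (hQ : Q.IsHermitian) (hstab : Stabilizable A B)
    {Y : Matrix (Fin n) (Fin n) ℂ} (hY : SolvesLMI A Q B C R Y) {ω : ℝ}
    (hω : IsUnit ((Complex.I * ω) • evenE n m - evenA A Q B C R).det) :
    IsDefiniteOn (gram n) (shiftInvert A Q B C R ω) (firstHalf n) where
  isHermitian := gram_isHermitian
  mul_self := gram_mul_gram
  adjoint := shiftInvert_adjoint hQ hY.R_isHermitian ω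
  nonpos := by
    intro ρ r hr
    rw [← Sum.elim_comp_inl_inr r] at hr ⊢
    set r₁ := r ∘ Sum.inl
    set r₂ := r ∘ Sum.inr
    set x := (shiftInvert A Q B C R ω - (ρ : ℂ) • (1 : Matrix _ _ ℂ)) *ᵥ Sum.elim r₁ r₂ with hx
    rw [← Sum.elim_comp_inl_inr x, mem_firstHalf] at hr
    have hx' : x = Sum.elim (x ∘ Sum.inl) 0 := by
      rw [← hr, Sum.elim_comp_inl_inr]
    set x₁ := x ∘ Sum.inl
    rw [hx', form_gram]
    have hS : shiftInvert A Q B C R ω *ᵥ Sum.elim r₁ r₂ =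
        Sum.elim ((ρ : ℂ) • r₁ + x₁) ((ρ : ℂ) • r₂) := by
      have : shiftInvert A Q B C R ω *ᵥ Sum.elim r₁ r₂ = (ρ : ℂ) • Sum.elim r₁ r₂ + x := by
        rw [hx, sub_mulVec, smul_mulVec, one_mulVec]; abel
      rw [this, hx']
      ext (i | i) <;> simp
    obtain ⟨b, hb⟩ := (shiftInvert_mulVec_iff hω _ _).mp hS
    rw [smul_evenE_sub_evenA_mulVec, gram_mulVec] at hb
    obtain ⟨h12, h3⟩ := Sum.elim_eq_iff.mp hb
    obtain ⟨h1, h2⟩ := Sum.elim_eq_iff.mp h12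
    set y := (ρ : ℂ) • r₁ + x₁ with hy
    -- the linear matrix inequality without the terms containing `Y`, evaluated along `(ρ r₂, b)`
    have hpop := re_popov_nonneg hY 0 (ρ := ρ) (κ := ω * ρ - 1) (e := r₂) (b := b) (by
      have : A *ᵥ ((ρ : ℂ) • r₂) + B *ᵥ b = -(Complex.I • r₂) + (Complex.I * ω) • (ρ : ℂ) • r₂ := by
        rw [← h1]; abel
      rw [this]
      push_cast
      module)
    have hst : star (Sum.elim ((ρ : ℂ) • r₂) b) = Sum.elim (star ((ρ : ℂ) • r₂)) (star b) := by
      ext (i | i) <;> rfl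
    rw [lmi_mulVec, hst, sumElim_dotProduct_sumElim] at hpop
    simp only [zero_mulVec, mulVec_zero, zero_add] at hpop
    have e2 : Q *ᵥ ((ρ : ℂ) • r₂) + C *ᵥ b = Complex.I • r₁ - (Aᴴ *ᵥ y + (Complex.I * ω) • y) := by
      rw [← h2]; abel
    have e3 : Cᴴ *ᵥ ((ρ : ℂ) • r₂) + R *ᵥ b = -(Bᴴ *ᵥ y) := by
      rw [eq_neg_iff_add_eq_zero, ← h3]; abel
    have e1 : star (A *ᵥ ((ρ : ℂ) • r₂) + B *ᵥ b) ⬝ᵥ y =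
        star (-(Complex.I • r₂) + (Complex.I * ω) • (ρ : ℂ) • r₂) ⬝ᵥ y := by
      rw [← h1]; congr 2; abel
    rw [e2, e3] at hpop
    have e4 : star ((ρ : ℂ) • r₂) ⬝ᵥ (Complex.I • r₁ - (Aᴴ *ᵥ y + (Complex.I * ω) • y)) +
        star b ⬝ᵥ (-(Bᴴ *ᵥ y)) = -(Complex.I * (star r₂ ⬝ᵥ x₁)) := by
      simp only [star_add, star_neg, add_dotProduct, neg_dotProduct, star_smul, smul_dotProduct,
        smul_eq_mul, star_mul'] at e1
      rw [hy] at e1 ⊢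
      simp only [dotProduct_sub, dotProduct_add, dotProduct_neg, mulVec_smul,
        star_dotProduct_conjTranspose_mulVec, dotProduct_smul, smul_eq_mul, star_smul,
        smul_dotProduct] at e1 ⊢
      simp only [Complex.star_def, Complex.conj_I, Complex.conj_ofReal] at e1 ⊢
      linear_combination -e1
    rw [e4] at hpop
    have := (Complex.nonneg_iff.mp hpop).1
    simp at this ⊢
    linarith
  eq_zero := by
    intro θ v hv horth
    rw [← Sum.elim_comp_inl_inr v] at hv horth ⊢
    set v₁ := v ∘ Sum.inl
    set v₂ := v ∘ Sum.inr
    have hv₂ : v₂ = 0 := by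
      have := horth (Sum.elim v₂ 0) (mem_firstHalf.mpr rfl)
      rw [form_gram] at this
      simpa using this
    rw [hv₂] at hv ⊢
    have hS : shiftInvert A Q B C R ω *ᵥ Sum.elim v₁ 0 = Sum.elim ((θ : ℂ) • v₁) 0 := by
      rw [hv]; ext (i | i) <;> simp
    obtain ⟨b, hb⟩ := (shiftInvert_mulVec_iff hω _ _).mp hS
    rw [smul_evenE_sub_evenA_mulVec, gram_mulVec] at hb
    obtain ⟨h12, h3⟩ := Sum.elim_eq_iff.mp hb
    obtain ⟨h1, h2⟩ := Sum.elim_eq_iff.mp h12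
    simp only [mulVec_zero, smul_zero, neg_zero, zero_add, sub_zero, add_zero] at h1 h2 h3
    have hq : star (Sum.elim 0 b) ⬝ᵥ (lmi A Q B C R Y *ᵥ Sum.elim 0 b) = 0 := by
      have hst : star (Sum.elim (0 : Fin n → ℂ) b) = Sum.elim (0 : Fin n → ℂ) (star b) := by
        ext (i | i) <;> simp
      rw [lmi_mulVec, hst, sumElim_dotProduct_sumElim]
      have hR : R *ᵥ b = -(Bᴴ *ᵥ ((θ : ℂ) • v₁)) := by
        rw [eq_neg_iff_add_eq_zero, ← h3]; abel
      simp [hR, star_dotProduct_conjTranspose_mulVec, h1]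
    have hk := (hY.2.dotProduct_mulVec_zero_iff _).mp hq
    change lmi A Q B C R Y *ᵥ Sum.elim 0 b = 0 at hk
    rw [lmi_mulVec] at hk
    have hk1 : C *ᵥ b = 0 := by
      ext i
      have := congrFun hk (Sum.inl i)
      simpa [h1] using this
    have hk2 : R *ᵥ b = 0 := by
      ext i
      have := congrFun hk (Sum.inr i)
      simpa using this
    rw [hk1, add_zero] at h2
    rw [hk2, add_zero] at h3
    have : v₁ = 0 := by
      refine hstab.eq_zero_of_smul (ω := ω) (θ := θ) ?_ ?_
      · rw [mulVec_smul] at h2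
        have : (θ : ℂ) • (Aᴴ *ᵥ v₁) = Complex.I • v₁ - (Complex.I * ω) • (θ : ℂ) • v₁ := by
          rw [← h2]; abel
        rw [this]; module
      · rw [← mulVec_smul]; exact h3
    rw [this]
    ext (i | i) <;> rfl

end Pencil

/-! ### The reduced pencil -/

section Reduced

variable {n m : ℕ} {A Q : Matrix (Fin n) (Fin n) ℂ} {B C : Matrix (Fin n) (Fin m) ℂ}
  {R : Matrix (Fin m) (Fin m) ℂ} {γ : ℝ}

lemma cayleyE_even : cayleyE γ (evenE n m) (evenA A Q B C R) =
    -(ssfLeft A Q B C R γ * fromBlocks (fromBlocks 1 0 0 0) 0 0 1 +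
      ssfRight A Q B C R γ * fromBlocks (fromBlocks 0 0 0 1) 0 0 0) := by
  rw [cayleyE, evenE, evenA, ssfLeft, ssfRight]
  simp only [fromBlocks_multiply, fromCols_mul_fromBlocks, Matrix.mul_zero, Matrix.mul_one,
    add_zero, zero_add]
  ext ((i | i) | i) ((j | j) | j) <;> simp <;> ring

lemma cayleyA_even : cayleyA γ (evenE n m) (evenA A Q B C R) =
    -(ssfRight A Q B C R γ * fromBlocks (fromBlocks 1 0 0 0) 0 0 0 +
      ssfLeft A Q B C R γ * fromBlocks (fromBlocks 0 0 0 1) 0 0 1) := by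
  rw [cayleyA, evenE, evenA, ssfLeft, ssfRight]
  simp only [fromBlocks_multiply, fromCols_mul_fromBlocks, Matrix.mul_zero, Matrix.mul_one,
    add_zero, zero_add]
  ext ((i | i) | i) ((j | j) | j) <;> simp <;> ring

/-- The Cayley transform of the even pencil is reduced by `P = -T₋⁻¹`: the columns of `-(s (𝒜 + γ ℰ)
- (𝒜 - γ ℰ))` are columns of `T₋` and `T₊`. -/
lemma exists_reduction (hssf : IsUnit (ssfLeft A Q B C R γ).det) :
    ∃ Z₁ Z₂ : Matrix (Fin m) (Fin n ⊕ Fin n) ℂ,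
      -(ssfLeft A Q B C R γ)⁻¹ * cayleyE γ (evenE n m) (evenA A Q B C R) =
        fromBlocks (redE A Q B C R γ) 0 Z₁ 1 ∧
      -(ssfLeft A Q B C R γ)⁻¹ * cayleyA γ (evenE n m) (evenA A Q B C R) =
        fromBlocks (redA A Q B C R γ) 0 Z₂ 1 := by
  set T := (ssfLeft A Q B C R γ)⁻¹ * ssfRight A Q B C R γ with hT
  have hTb : T = fromBlocks (hatA A Q B C R γ) T.toBlocks₁₂ T.toBlocks₂₁ T.toBlocks₂₂ :=
    (fromBlocks_toBlocks T).symm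
  have hh := (fromBlocks_toBlocks (hatA A Q B C R γ)).symm
  refine ⟨T.toBlocks₂₁ * fromBlocks 0 0 0 1, T.toBlocks₂₁ * fromBlocks 1 0 0 0, ?_, ?_⟩
  · rw [cayleyE_even, neg_mul_neg, Matrix.mul_add, ← Matrix.mul_assoc, ← Matrix.mul_assoc,
      nonsing_inv_mul _ hssf, Matrix.one_mul, ← hT, hTb, fromBlocks_multiply, redE, hh]
    simp only [fromBlocks_multiply, fromBlocks_add, Matrix.mul_zero,
      Matrix.mul_one, add_zero, zero_add, toBlocks_fromBlocks₁₂, toBlocks_fromBlocks₂₁,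
      toBlocks_fromBlocks₂₂]
    rfl
  · rw [cayleyA_even, neg_mul_neg, Matrix.mul_add, ← Matrix.mul_assoc, ← Matrix.mul_assoc,
      nonsing_inv_mul _ hssf, Matrix.one_mul, ← hT, hTb, fromBlocks_multiply, redA, hh]
    simp only [fromBlocks_multiply, fromBlocks_add, Matrix.mul_zero,
      Matrix.mul_one, add_zero, zero_add, toBlocks_fromBlocks₁₁, toBlocks_fromBlocks₂₁]
    rfl

lemma ssfLeft_isHermitian (hQ : Q.IsHermitian) (hR : R.IsHermitian) :
    (ssfLeft A Q B C R γ).IsHermitian := by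
  rw [ssfLeft, IsHermitian, fromBlocks_conjTranspose, fromBlocks_conjTranspose,
    conjTranspose_fromRows_eq_fromCols_conjTranspose,
    conjTranspose_fromCols_eq_fromRows_conjTranspose, hQ.eq, hR.eq]
  simp

lemma hatA_eq (hssf : IsUnit (ssfLeft A Q B C R γ).det) :
    hatA A Q B C R γ =
      1 + (2 * γ : ℂ) • (((ssfLeft A Q B C R γ)⁻¹).toBlocks₁₁ * fromBlocks 0 1 1 0) := by
  have h : ssfRight A Q B C R γ = ssfLeft A Q B C R γ +
      (2 * γ : ℂ) • fromBlocks (fromBlocks 0 1 1 0) 0 0 0 := by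
    rw [ssfLeft, ssfRight]
    ext ((i | i) | i) ((j | j) | j) <;> simp
    all_goals ring
  rw [hatA, h, Matrix.mul_add, nonsing_inv_mul _ hssf, Matrix.mul_smul]
  set N := (ssfLeft A Q B C R γ)⁻¹
  conv_lhs => rw [← fromBlocks_toBlocks N, fromBlocks_multiply]
  ext i j
  simp [toBlocks₁₁, Matrix.one_apply]

/-- Symplecticity comes from `hatA = I + 2γ N [[0, I], [I, 0]]` with `N` Hermitian. -/
lemma isSymplectic_red (hQ : Q.IsHermitian) (hR : R.IsHermitian)
    (hssf : IsUnit (ssfLeft A Q B C R γ).det) :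
    IsSymplectic (redE A Q B C R γ) (redA A Q B C R γ) := by
  have hN : (((ssfLeft A Q B C R γ)⁻¹).toBlocks₁₁).IsHermitian := by
    ext i j
    exact congrFun (congrFun (ssfLeft_isHermitian (A := A) (B := B) (C := C) (γ := γ) hQ hR).inv.eq
      (Sum.inl i)) (Sum.inl j)
  have hh := hatA_eq hssf
  set N := ((ssfLeft A Q B C R γ)⁻¹).toBlocks₁₁
  rw [← fromBlocks_toBlocks N, isHermitian_fromBlocks_iff] at hN
  obtain ⟨h1, h2, h3, h4⟩ := hN
  rw [← fromBlocks_toBlocks N, fromBlocks_multiply, ← fromBlocks_one, fromBlocks_smul,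
    fromBlocks_add] at hh
  rw [IsSymplectic, redE, redA, hh]
  simp only [toBlocks_fromBlocks₁₁, toBlocks_fromBlocks₁₂, toBlocks_fromBlocks₂₁,
    toBlocks_fromBlocks₂₂, fromBlocks_conjTranspose, fromBlocks_multiply]
  simp [h1.eq, h4.eq, h2, h3]

lemma I_smul_inv_mul_evenE (ω : ℝ) :
    Complex.I • (((Complex.I * ω) • evenE n m - evenA A Q B C R)⁻¹ * evenE n m) =
      fromBlocks (shiftInvert A Q B C R ω) 0
        (((Complex.I * ω) • evenE n m - evenA A Q B C R)⁻¹.toBlocks₂₁ * gram n) 0 := by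
  set H := (Complex.I * ω) • evenE n m - evenA A Q B C R with hH
  conv_lhs => rw [← fromBlocks_toBlocks H⁻¹, evenE, fromBlocks_multiply, fromBlocks_smul]
  simp only [Matrix.mul_zero, add_zero, smul_zero, ← Matrix.mul_smul]
  rfl

/-- The Cayley transform satisfies `(iω - γ) (𝒜 + γ ℰ) - (iω + γ) (𝒜 - γ ℰ) = 2γ (iω ℰ - 𝒜)`, so
that the reduced pencil determines the operator `shiftInvert`. -/
lemma reduced_mul_shiftInvert (hγ : 0 < γ) (hssf : IsUnit (ssfLeft A Q B C R γ).det) {ω : ℝ}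
    (hω : IsUnit ((Complex.I * ω) • evenE n m - evenA A Q B C R).det) :
    IsUnit ((Complex.I * ω - γ) • redE A Q B C R γ - (Complex.I * ω + γ) • redA A Q B C R γ).det ∧
    ((Complex.I * ω - γ) • redE A Q B C R γ - (Complex.I * ω + γ) • redA A Q B C R γ) *
      shiftInvert A Q B C R ω = Complex.I • (redE A Q B C R γ - redA A Q B C R γ) := by
  obtain ⟨Z₁, Z₂, h₁, h₂⟩ := exists_reduction hssf
  set P := -(ssfLeft A Q B C R γ)⁻¹ with hP
  have hPdet : IsUnit P.det := by
    rw [hP, det_neg]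
    exact ((isUnit_one.neg).pow _).mul ((isUnit_nonsing_inv_det_iff).mpr hssf)
  set H := (Complex.I * ω) • evenE n m - evenA A Q B C R with hH
  set Er := redE A Q B C R γ
  set Ar := redA A Q B C R γ
  have hγ' : (2 * γ : ℂ) ≠ 0 := by
    have : (γ : ℂ) ≠ 0 := by exact_mod_cast hγ.ne'
    simp [this]
  have e1 : P * ((2 * γ : ℂ) • H) = fromBlocks
      ((Complex.I * ω - γ) • Er - (Complex.I * ω + γ) • Ar) 0
      ((Complex.I * ω - γ) • Z₁ - (Complex.I * ω + γ) • Z₂)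
      ((-(2 * γ) : ℂ) • (1 : Matrix (Fin m) (Fin m) ℂ)) := by
    have : (2 * γ : ℂ) • H =
        (Complex.I * ω - γ) • cayleyE γ (evenE n m) (evenA A Q B C R) -
        (Complex.I * ω + γ) • cayleyA γ (evenE n m) (evenA A Q B C R) := by
      rw [cayleyE, cayleyA, hH]; module
    rw [this, Matrix.mul_sub, Matrix.mul_smul, Matrix.mul_smul, h₁, h₂, fromBlocks_smul,
      fromBlocks_smul, sub_eq_add_neg, fromBlocks_neg, fromBlocks_add]
    congr 1
    · rw [smul_zero, smul_zero, neg_zero, add_zero]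
    · rw [← sub_eq_add_neg, ← sub_smul]
      congr 1
      ring
  have e2 : P * ((2 * γ : ℂ) • evenE n m) = fromBlocks (Er - Ar) 0 (Z₁ - Z₂) 0 := by
    have : (2 * γ : ℂ) • evenE n m =
        cayleyE γ (evenE n m) (evenA A Q B C R) - cayleyA γ (evenE n m) (evenA A Q B C R) := by
      rw [cayleyE, cayleyA]; module
    rw [this, Matrix.mul_sub, h₁, h₂, sub_eq_add_neg, fromBlocks_neg, fromBlocks_add]
    simp [sub_eq_add_neg]
  constructor
  · have h3 : IsUnit (P * ((2 * γ : ℂ) • H)).det := by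
      rw [det_mul, det_smul]
      exact hPdet.mul ((hγ'.isUnit.pow _).mul hω)
    rw [e1, det_fromBlocks_zero₁₂] at h3
    exact isUnit_of_mul_isUnit_left h3
  · have e3 : (P * ((2 * γ : ℂ) • H)) * (H⁻¹ * evenE n m) = P * ((2 * γ : ℂ) • evenE n m) := by
      rw [Matrix.mul_assoc, Matrix.smul_mul, ← Matrix.mul_assoc H, mul_nonsing_inv _ hω,
        Matrix.one_mul]
    have e4 := I_smul_inv_mul_evenE (A := A) (Q := Q) (B := B) (C := C) (R := R) ω
    rw [← hH] at e4
    have e5 := congrArg (fun M => (Complex.I • M).toBlocks₁₁) e3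
    rw [← Matrix.mul_smul (P * _), e4, e1, e2, fromBlocks_multiply, fromBlocks_smul] at e5
    simpa using e5

/-- `θ = I (1 - ev) / (a - b ev)` lies in the upper half-plane exactly if `1 < |ev|`. -/
lemma im_cayley (hγ : 0 < γ) (ω : ℝ) (ev : ℂ)
    (h : Complex.I * ω - γ - (Complex.I * ω + γ) * ev ≠ 0) :
    ∃ c > 0, (Complex.I * (1 - ev) / (Complex.I * ω - γ - (Complex.I * ω + γ) * ev)).im =
      c * (‖ev‖ ^ 2 - 1) := by
  refine ⟨γ / Complex.normSq (Complex.I * ω - γ - (Complex.I * ω + γ) * ev),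
    div_pos hγ (Complex.normSq_pos.mpr h), ?_⟩
  rw [Complex.div_im, ← Complex.normSq_eq_norm_sq, Complex.normSq_apply ev]
  simp
  ring

/-- The map `KBlock.theta` takes the exterior of the unit circle, infinity included, to the upper
half-plane. -/
lemma isCompatible (hγ : 0 < γ) (ω : ℝ) {E' A' : Matrix (Fin n ⊕ Fin n) (Fin n ⊕ Fin n) ℂ}
    (K : KroneckerForm E' A')
    (h : ∀ j, (K.block j).scalar (Complex.I * ω - γ) (Complex.I * ω + γ) ≠ 0) :
    K.IsCompatible fun j => (K.block j).theta (Complex.I * ω - γ) (Complex.I * ω + γ) := by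
  have key : ∀ B : KBlock, B.scalar (Complex.I * ω - γ) (Complex.I * ω + γ) ≠ 0 →
      (B.DStable ↔ (B.theta (Complex.I * ω - γ) (Complex.I * ω + γ)).im < 0) ∧
      (B.DCritical ↔ (B.theta (Complex.I * ω - γ) (Complex.I * ω + γ)).im = 0) ∧
      (B.DUnstable ↔ 0 < (B.theta (Complex.I * ω - γ) (Complex.I * ω + γ)).im) := by
    rintro (⟨k, ev⟩ | k) hB
    · obtain ⟨c, hc, h⟩ := im_cayley hγ ω ev hB
      simp only [KBlock.DStable, KBlock.DCritical, KBlock.DUnstable, KBlock.theta, h]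
      have h0 := norm_nonneg ev
      refine ⟨?_, ?_, ?_⟩
      · rw [← sq_lt_one_iff₀ h0]
        constructor <;> intro h <;> nlinarith
      · rw [mul_eq_zero, or_iff_right hc.ne', sub_eq_zero, pow_eq_one_iff_of_nonneg h0 two_ne_zero]
      · rw [mul_pos_iff_of_pos_left hc, sub_pos, one_lt_sq_iff₀ h0]
    · have hb : Complex.I * ω + γ ≠ 0 := fun hb => hB (by simp [KBlock.scalar, hb])
      have him : 0 < (Complex.I / (Complex.I * ω + γ)).im := by
        rw [Complex.div_im]
        have := Complex.normSq_pos.mpr hb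
        simp
        positivity
      simp only [KBlock.DStable, KBlock.DCritical, KBlock.DUnstable, KBlock.theta]
      exact ⟨by simpa using him.le, by simpa using him.ne', by simpa using him⟩
  exact ⟨fun j => (key _ (h j)).1, fun j => (key _ (h j)).2.1, fun j => (key _ (h j)).2.2⟩

end Reduced

/-! ### Deflating subspaces of the even pencil -/

section ColSpan

variable {ι : Type*}

lemma mulVec_injective_of_rank {κ : Type*} [Fintype κ] {V : Matrix ι κ ℂ}
    (h : V.rank = Fintype.card κ) : Function.Injective V.mulVec := by
  have h1 := LinearMap.finrank_range_add_finrank_ker V.mulVecLin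
  rw [Module.finrank_fintype_fun_eq_card] at h1
  have h2 : Module.finrank ℂ (LinearMap.ker V.mulVecLin) = 0 := by
    have : Module.finrank ℂ (LinearMap.range V.mulVecLin) = Fintype.card κ := h
    omega
  exact LinearMap.ker_eq_bot.mp (Submodule.finrank_eq_zero.mp h2)

lemma exists_colSpan_eq [Fintype ι] (𝒱 : Submodule ℂ (ι → ℂ)) {k : ℕ}
    (hk : Module.finrank ℂ 𝒱 = k) :
    ∃ V : Matrix ι (Fin k) ℂ, colSpan V = 𝒱 ∧ V.rank = k := by
  let b := Module.finBasisOfFinrankEq ℂ 𝒱 hk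
  have h : colSpan (Matrix.of fun i j => (b j : ι → ℂ) i) = 𝒱 := by
    rw [colSpan, range_mulVecLin]
    have h2 := congrArg (Submodule.map 𝒱.subtype) b.span_eq
    rw [Submodule.map_span, Submodule.map_top, Submodule.range_subtype, ← Set.range_comp] at h2
    exact h2
  exact ⟨_, h, (congrArg (fun U : Submodule ℂ (ι → ℂ) => Module.finrank ℂ U) h).trans hk⟩

/-- The matrix of the restriction of `Φ` to an invariant column span. -/
lemma exists_mul_eq_mul [Fintype ι] {κ : Type*} [Fintype κ] {V : Matrix ι κ ℂ} {Φ : Matrix ι ι ℂ}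
    (h : ∀ x ∈ colSpan V, Φ *ᵥ x ∈ colSpan V) : ∃ Θ : Matrix κ κ ℂ, Φ * V = V * Θ := by
  classical
  choose θ hθ using fun j => h (V *ᵥ Pi.single j 1) ⟨_, rfl⟩
  refine ⟨Matrix.of fun i j => θ j i, ?_⟩
  ext i j
  have := congrFun (hθ j) i
  rw [mulVec_mulVec, mulVec_single_one] at this
  exact this.symm

end ColSpan

section Correspondence

variable {n m : ℕ} {A Q : Matrix (Fin n) (Fin n) ℂ} {B C : Matrix (Fin n) (Fin m) ℂ}
  {R : Matrix (Fin m) (Fin m) ℂ} {ω : ℝ}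

/-- The quotient map of `ℂ²ⁿ⁺ᵐ` by the kernel `ℂᵐ` of `ℰ`. -/
def proj (n m : ℕ) : ((Fin n ⊕ Fin n) ⊕ Fin m → ℂ) →ₗ[ℂ] (Fin n ⊕ Fin n → ℂ) :=
  LinearMap.funLeft ℂ ℂ Sum.inl

lemma proj_sumElim (x : Fin n ⊕ Fin n → ℂ) (b : Fin m → ℂ) : proj n m (Sum.elim x b) = x := rfl

lemma sumElim_proj (x : (Fin n ⊕ Fin n) ⊕ Fin m → ℂ) :
    Sum.elim (proj n m x) (x ∘ Sum.inr) = x := Sum.elim_comp_inl_inr x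

lemma finrank_comap_proj (W : Submodule ℂ (Fin n ⊕ Fin n → ℂ)) :
    Module.finrank ℂ (W.comap (proj n m)) = Module.finrank ℂ W + m := by
  let e := (LinearEquiv.sumArrowLequivProdArrow (Fin n ⊕ Fin n) (Fin m) ℂ ℂ).symm
  let f : (W × (Fin m → ℂ)) →ₗ[ℂ] ((Fin n ⊕ Fin n) ⊕ Fin m → ℂ) :=
    e.toLinearMap ∘ₗ LinearMap.prodMap W.subtype LinearMap.id
  have hf : Function.Injective f := e.injective.comp
    (Function.Injective.prodMap W.injective_subtype Function.injective_id)
  have hr : LinearMap.range f = W.comap (proj n m) := by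
    ext x
    constructor
    · rintro ⟨⟨w, b⟩, rfl⟩
      exact w.2
    · intro hx
      exact ⟨(⟨proj n m x, hx⟩, x ∘ Sum.inr), sumElim_proj x⟩
  rw [← hr, LinearMap.finrank_range_of_inj hf, Module.finrank_prod]
  simp

/-- The matrix `i (iω ℰ - 𝒜)⁻¹ ℰ`. -/
def resolvent (A Q : Matrix (Fin n) (Fin n) ℂ) (B C : Matrix (Fin n) (Fin m) ℂ)
    (R : Matrix (Fin m) (Fin m) ℂ) (ω : ℝ) :
    Matrix ((Fin n ⊕ Fin n) ⊕ Fin m) ((Fin n ⊕ Fin n) ⊕ Fin m) ℂ :=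
  Complex.I • (((Complex.I * ω) • evenE n m - evenA A Q B C R)⁻¹ * evenE n m)

lemma proj_resolvent_mulVec (x : (Fin n ⊕ Fin n) ⊕ Fin m → ℂ) :
    proj n m (resolvent A Q B C R ω *ᵥ x) = shiftInvert A Q B C R ω *ᵥ proj n m x := by
  conv_lhs => rw [resolvent, I_smul_inv_mul_evenE, ← sumElim_proj x, fromBlocks_mulVec]
  simp [proj_sumElim]

lemma resolvent_mulVec_congr {x x' : (Fin n ⊕ Fin n) ⊕ Fin m → ℂ} (h : proj n m x = proj n m x') :
    resolvent A Q B C R ω *ᵥ x = resolvent A Q B C R ω *ᵥ x' := by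
  rw [resolvent, I_smul_inv_mul_evenE, ← sumElim_proj x, ← sumElim_proj x', h, fromBlocks_mulVec,
    fromBlocks_mulVec]
  simp

lemma form_gram_proj (x y : (Fin n ⊕ Fin n) ⊕ Fin m → ℂ) :
    form (gram n) (proj n m x) (proj n m y) = Complex.I * (star x ⬝ᵥ (evenE n m *ᵥ y)) := by
  rw [← smul_eq_mul, ← dotProduct_smul]
  conv_rhs => rw [← sumElim_proj x, ← sumElim_proj y, evenE_mulVec]
  have : star (Sum.elim (proj n m x) (x ∘ Sum.inr)) =
    Sum.elim (star (proj n m x)) (star (x ∘ Sum.inr)) := by ext (i | i) <;> rfl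
  rw [this, sumElim_dotProduct_sumElim, dotProduct_zero, add_zero, form]

/-- The preimage of a semi-stable Lagrangian subspace is a semi-stable deflating subspace of the
even pencil. If
`i (iω ℰ - 𝒜)⁻¹ ℰ V = V Θ`, it carries the pencil `s (-i Θ) - (ω Θ - 1)`, whose eigenvalues `z`
belong to the nonzero eigenvalues `-i / (z - iω)` of `Θ`. -/
lemma IsSemiStableLagrangian.isStableLagrangian
    (hω : IsUnit ((Complex.I * ω) • evenE n m - evenA A Q B C R).det)
    {W : Submodule ℂ (Fin n ⊕ Fin n → ℂ)}
    (hW : IsSemiStableLagrangian (gram n) (shiftInvert A Q B C R ω) n W) :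
    IsStableLagrangian A Q B C R (W.comap (proj n m)) := by
  have hdim : Module.finrank ℂ (W.comap (proj n m)) = n + m := by
    rw [finrank_comap_proj, hW.finrank_eq]
  refine ⟨hdim, ?_, ?_⟩
  · intro x hx y hy
    have := hW.neutral _ hx _ hy
    rw [form_gram_proj] at this
    exact (mul_eq_zero.mp this).resolve_left Complex.I_ne_zero
  obtain ⟨V, hV, hVr⟩ := exists_colSpan_eq _ hdim
  obtain ⟨Θ, hΘ⟩ := exists_mul_eq_mul (V := V) (Φ := resolvent A Q B C R ω) (by
    intro x hx
    rw [hV, Submodule.mem_comap] at hx ⊢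
    rw [proj_resolvent_mulVec]
    exact hW.invariant _ hx)
  set H := (Complex.I * ω) • evenE n m - evenA A Q B C R with hH
  have hEV : evenE n m * V = H * V * (-Complex.I • Θ) := by
    rw [Matrix.mul_assoc, Matrix.mul_smul, ← hΘ, resolvent, ← hH, Matrix.smul_mul, smul_smul,
      Matrix.mul_smul, Matrix.mul_assoc, ← Matrix.mul_assoc H, mul_nonsing_inv _ hω,
      Matrix.one_mul]
    simp
  refine ⟨n + m, n + m, V, H * V, -Complex.I • Θ, (Complex.I * ω) • (-Complex.I • Θ) - 1,
    ⟨le_rfl, hVr, ?_⟩, hV, ?_⟩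
  · intro s
    have : s • evenE n m - evenA A Q B C R = H + (s - Complex.I * ω) • evenE n m := by
      rw [hH]; module
    rw [this, Matrix.add_mul, Matrix.smul_mul, hEV, ← Matrix.mul_smul]
    nth_rw 1 [← Matrix.mul_one (H * V)]
    rw [← Matrix.mul_add]
    congr 1
    module
  · rintro z ⟨s, hs⟩
    have hlt := hs.trans_le ((rank_le_card_width _).trans_eq (Fintype.card_fin _))
    have hdet : (z • (-Complex.I • Θ) - ((Complex.I * ω) • (-Complex.I • Θ) - 1)).det = 0 := by
      by_contra hne
      rw [rank_of_det_ne_zero hne, Fintype.card_fin] at hlt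
      exact lt_irrefl _ hlt
    obtain ⟨c, hc, hc0⟩ := exists_mulVec_eq_zero_iff.mpr hdet
    have hc1 : c = (Complex.I * (z - Complex.I * ω)) • (Θ *ᵥ c) := by
      simp only [sub_mulVec, smul_mulVec, one_mulVec] at hc0
      rw [← sub_eq_zero, ← hc0]
      module
    set ζ := Complex.I * (z - Complex.I * ω) with hζ
    have hζ0 : ζ ≠ 0 := by
      intro h
      rw [h, zero_smul] at hc1
      exact hc hc1
    have hx : resolvent A Q B C R ω *ᵥ (V *ᵥ c) = ζ⁻¹ • (V *ᵥ c) := by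
      conv_rhs => rw [hc1]
      rw [mulVec_mulVec, hΘ, mulVec_smul, smul_smul, inv_mul_cancel₀ hζ0, one_smul, mulVec_mulVec]
    have hVc : V *ᵥ c ≠ 0 := by
      intro h
      exact hc (mulVec_injective_of_rank (by rw [hVr, Fintype.card_fin])
        (h.trans (mulVec_zero V).symm))
    have hmem : V *ᵥ c ∈ W.comap (proj n m) := by rw [← hV]; exact ⟨c, rfl⟩
    have hS : shiftInvert A Q B C R ω *ᵥ proj n m (V *ᵥ c) = ζ⁻¹ • proj n m (V *ᵥ c) := by
      rw [← proj_resolvent_mulVec, hx, map_smul]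
    have hy : proj n m (V *ᵥ c) ≠ 0 := by
      intro h
      have h2 := resolvent_mulVec_congr (A := A) (Q := Q) (B := B) (C := C) (R := R) (ω := ω)
        (x := V *ᵥ c) (x' := 0) (by rw [h, map_zero])
      rw [hx, mulVec_zero] at h2
      exact hVc ((smul_eq_zero.mp h2).resolve_left (inv_ne_zero hζ0))
    have him := hW.im_nonneg _ hmem _ hy hS
    rw [Complex.inv_im] at him
    have hpos := Complex.normSq_pos.mpr hζ0
    have h1 : 0 ≤ -ζ.im := by
      by_contra hneg
      exact absurd him (not_le.mpr (div_neg_of_neg_of_pos (not_le.mp hneg) hpos))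
    simp [hζ] at h1
    exact h1

/-- An `(n+m)`-dimensional semi-stable neutral deflating subspace of the even pencil is the preimage
of a semi-stable Lagrangian subspace: its image is neutral, hence at most `n`-dimensional, so that
it contains the kernel of `ℰ`. -/
lemma IsStableLagrangian.exists_eq_comap
    (hω : IsUnit ((Complex.I * ω) • evenE n m - evenA A Q B C R).det)
    {𝒱 : Submodule ℂ ((Fin n ⊕ Fin n) ⊕ Fin m → ℂ)} (h : IsStableLagrangian A Q B C R 𝒱) :
    ∃ W, IsSemiStableLagrangian (gram n) (shiftInvert A Q B C R ω) n W ∧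
      𝒱 = W.comap (proj n m) := by
  obtain ⟨hdim, hneu, k, l, V, W, Et, At, ⟨hlk, hVr, hpen⟩, hV, heig⟩ := h
  set H := (Complex.I * ω) • evenE n m - evenA A Q B C R with hH
  have h1 : H * V = W * ((Complex.I * ω) • Et - At) := hpen _
  -- at `s = iω` the even pencil is invertible, so the carried pencil is square and invertible there
  have hrD : ((Complex.I * ω) • Et - At).rank = k := by
    apply le_antisymm ((rank_le_card_width _).trans_eq (Fintype.card_fin _))
    have : (H * V).rank = k := by rw [rank_mul_eq_right_of_isUnit_det _ _ hω, hVr]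
    rw [h1] at this
    exact this.symm.trans_le (rank_mul_le_right _ _)
  have hkl : k = l := le_antisymm
    (hrD ▸ (rank_le_card_height _).trans_eq (Fintype.card_fin _)) hlk
  subst hkl
  set D := (Complex.I * ω) • Et - At with hD
  have hDinj := mulVec_injective_of_rank (V := D) (by rw [hrD, Fintype.card_fin])
  have hDdet : IsUnit D.det := (isUnit_iff_isUnit_det _).mp (mulVec_injective_iff_isUnit.mp hDinj)
  have h2 : evenE n m * V = W * Et := by
    have h3 := hpen (Complex.I * ω + 1)
    rw [add_smul, one_smul, add_smul, one_smul, add_sub_right_comm, ← hH, Matrix.add_mul, h1,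
      add_sub_right_comm, ← hD, Matrix.mul_add] at h3
    exact add_left_cancel h3
  have hW : W = H * V * D⁻¹ := by
    rw [h1, Matrix.mul_assoc, mul_nonsing_inv _ hDdet, Matrix.mul_one]
  have hΦ : resolvent A Q B C R ω * V = V * (Complex.I • (D⁻¹ * Et)) := by
    rw [resolvent, ← hH, Matrix.smul_mul, Matrix.mul_assoc, h2, hW, Matrix.mul_smul]
    congr 1
    simp only [← Matrix.mul_assoc]
    rw [nonsing_inv_mul _ hω, Matrix.one_mul]
  have hinv : ∀ x ∈ 𝒱, resolvent A Q B C R ω *ᵥ x ∈ 𝒱 := by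
    intro x hx
    rw [← hV] at hx ⊢
    obtain ⟨c, rfl⟩ := hx
    refine ⟨(Complex.I • (D⁻¹ * Et)) *ᵥ c, ?_⟩
    rw [mulVecLin_apply, mulVecLin_apply, mulVec_mulVec, mulVec_mulVec, hΦ]
  have hneutral : ∀ w ∈ 𝒱.map (proj n m), ∀ w' ∈ 𝒱.map (proj n m), form (gram n) w w' = 0 := by
    rintro _ ⟨x, hx, rfl⟩ _ ⟨y, hy, rfl⟩
    rw [form_gram_proj, hneu x hx y hy, mul_zero]
  have hle := two_mul_finrank_le gram_mul_gram hneutral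
  rw [Fintype.card_sum, Fintype.card_fin] at hle
  have hcomap := finrank_comap_proj (m := m) (𝒱.map (proj n m))
  have hsub := Submodule.finrank_mono (Submodule.le_comap_map (proj n m) 𝒱)
  refine ⟨𝒱.map (proj n m), ⟨?_, hneutral, ?_, by omega⟩,
    Submodule.eq_of_le_of_finrank_le (Submodule.le_comap_map _ _) (by omega)⟩
  · rintro _ ⟨x, hx, rfl⟩
    exact ⟨_, hinv x hx, proj_resolvent_mulVec x⟩
  · rintro _ ⟨x, hx, rfl⟩ θ hx0 hθ
    by_cases hθ0 : θ = 0
    · simp [hθ0]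
    -- replace `x` by an eigenvector of the lifted operator with the same image
    obtain ⟨c, hc⟩ : θ⁻¹ • (resolvent A Q B C R ω *ᵥ x) ∈ colSpan V := by
      rw [hV]; exact 𝒱.smul_mem _ (hinv x hx)
    rw [mulVecLin_apply] at hc
    have hpc : proj n m (V *ᵥ c) = proj n m x := by
      rw [hc, map_smul, proj_resolvent_mulVec, hθ, smul_smul, inv_mul_cancel₀ hθ0, one_smul]
    have heigc : (Complex.I • (D⁻¹ * Et)) *ᵥ c = θ • c := by
      apply mulVec_injective_of_rank (V := V) (by rw [hVr, Fintype.card_fin])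
      rw [mulVec_mulVec, ← hΦ, ← mulVec_mulVec, resolvent_mulVec_congr hpc, mulVec_smul, hc,
        smul_smul, mul_inv_cancel₀ hθ0, one_smul]
    have hc0 : c ≠ 0 := by
      rintro rfl
      rw [mulVec_zero, map_zero] at hpc
      exact hx0 hpc.symm
    have hEt : Et *ᵥ c = (-Complex.I * θ) • (D *ᵥ c) := by
      have := congrArg (fun v => -Complex.I • (D *ᵥ v)) heigc
      simp only [smul_mulVec, mulVec_smul, smul_smul, mulVec_mulVec, ← Matrix.mul_assoc,
        mul_nonsing_inv _ hDdet, Matrix.one_mul] at this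
      simpa using this
    have hz := heig (Complex.I * ω - Complex.I / θ) ⟨Complex.I * ω, by
      rw [← hD, hrD]
      refine lt_of_le_of_ne ((rank_le_card_width _).trans_eq (Fintype.card_fin _)) fun hr => ?_
      refine hc0 (mulVec_injective_of_rank (hr.trans (Fintype.card_fin _).symm) ?_)
      have : (Complex.I * ω - Complex.I / θ) • Et - At = D - (Complex.I / θ) • Et := by
        rw [hD]; module
      rw [this, mulVec_zero, sub_mulVec, smul_mulVec, hEt, smul_smul]
      have : Complex.I / θ * (-Complex.I * θ) = 1 := by
        field_simp
        simp
      rw [this, one_smul, sub_self]⟩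
    have hpos := Complex.normSq_pos.mpr hθ0
    rw [Complex.sub_re, Complex.div_re] at hz
    simp at hz
    by_contra hneg
    have := div_neg_of_neg_of_pos (not_le.mp hneg) hpos
    linarith

end Correspondence

/-! ### A Lyapunov argument on the upper half-plane -/

section Lyapunov

variable {ι : Type*} [Fintype ι] [DecidableEq ι] {Δ T : Matrix ι ι ℂ}

/-- The powers of `M` decay like `rᵏ` on the generalized eigenspace of `c` for any `r > |c|`. -/
lemma exists_norm_pow_mulVec_le {M : Matrix ι ι ℂ} {c : ℂ} {r : ℝ} (hr : ‖c‖ < r) (p : ℕ) :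
    ∀ v, (M - c • (1 : Matrix ι ι ℂ)) ^ p *ᵥ v = 0 → ∃ b, ∀ k : ℕ, ‖M ^ k *ᵥ v‖ ≤ b * r ^ k := by
  have hr0 : 0 < r := (norm_nonneg c).trans_lt hr
  induction p with
  | zero =>
    intro v hv
    rw [pow_zero, one_mulVec] at hv
    exact ⟨0, by simp [hv]⟩
  | succ p ih =>
    intro v hv
    obtain ⟨b, hb⟩ := ih ((M - c • (1 : Matrix ι ι ℂ)) *ᵥ v) (by rw [mulVec_mulVec, ← pow_succ, hv])
    refine ⟨max ‖v‖ (b / (r - ‖c‖)), fun k => ?_⟩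
    set d := max ‖v‖ (b / (r - ‖c‖)) with hd
    have hbd : b ≤ d * (r - ‖c‖) := (div_le_iff₀ (sub_pos.mpr hr)).mp (le_max_right _ _)
    induction k with
    | zero => rw [pow_zero, one_mulVec, pow_zero, mul_one]; exact le_max_left _ _
    | succ k ihk =>
      have : M ^ (k + 1) *ᵥ v =
          c • (M ^ k *ᵥ v) + M ^ k *ᵥ (M - c • (1 : Matrix ι ι ℂ)) *ᵥ v := by
        rw [sub_mulVec, smul_mulVec, one_mulVec, mulVec_sub, mulVec_smul, mulVec_mulVec, ← pow_succ]
        abel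
      rw [this]
      refine (norm_add_le _ _).trans ?_
      rw [norm_smul]
      have h1 := mul_le_mul_of_nonneg_left ihk (norm_nonneg c)
      have h2 := mul_le_mul_of_nonneg_right hbd (pow_nonneg hr0.le k)
      have h3 := hb k
      rw [pow_succ]
      nlinarith

/-- The powers of a matrix tend to zero on the generalized eigenspaces of the open unit disc. -/
lemma tendsto_pow_mulVec {M : Matrix ι ι ℂ} {c : ℂ} (hc : ‖c‖ < 1) {p : ℕ} {v : ι → ℂ}
    (hv : (M - c • (1 : Matrix ι ι ℂ)) ^ p *ᵥ v = 0) :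
    Filter.Tendsto (fun k : ℕ => M ^ k *ᵥ v) Filter.atTop (nhds 0) := by
  obtain ⟨r, hcr, hr⟩ := exists_between hc
  obtain ⟨b, hb⟩ := exists_norm_pow_mulVec_le hcr p v hv
  refine squeeze_zero_norm hb ?_
  simpa using (tendsto_pow_atTop_nhds_zero_of_lt_one ((norm_nonneg c).trans hcr.le) hr).const_mul b

lemma mem_of_forall_genEigenvector {U : Submodule ℂ (ι → ℂ)}
    (h : ∀ (θ : ℂ) (k : ℕ) (x : ι → ℂ), (T - θ • (1 : Matrix ι ι ℂ)) ^ k *ᵥ x = 0 → x ∈ U)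
    (x : ι → ℂ) : x ∈ U := by
  have htop := Module.End.iSup_maxGenEigenspace_eq_top (toLin' T)
  have : (⨆ θ, Module.End.maxGenEigenspace (toLin' T) θ) ≤ U := by
    refine iSup_le fun θ y hy => ?_
    obtain ⟨k, hk⟩ := (Module.End.mem_maxGenEigenspace _ _ _).mp hy
    refine h θ k y ?_
    rw [← hk]
    have : toLin' T - θ • 1 = toLin' (T - θ • (1 : Matrix ι ι ℂ)) := by
      rw [map_sub, map_smul, toLin'_one]; rfl
    rw [this, ← toLin'_pow, toLin'_apply]
  exact this (htop ▸ Submodule.mem_top)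

/-- If `T` is dissipative with respect to the Hermitian form `Δ`, has its eigenvalues in the closed
upper half-plane, and has no real eigenvalues modulo the kernel of `Δ`, then `Δ` is positive
semidefinite: the form decreases along the powers of the Cayley transform of `T`, which
converge to zero. -/
theorem posSemidef_of_dissipative (hΔ : Δ.IsHermitian)
    (hdiss : ∀ a, 0 ≤ Complex.I * (star (T *ᵥ a) ⬝ᵥ (Δ *ᵥ a)) -
      Complex.I * (star a ⬝ᵥ (Δ *ᵥ (T *ᵥ a))))
    (heig : ∀ (θ : ℂ) (a : ι → ℂ), a ≠ 0 → T *ᵥ a = θ • a → 0 ≤ θ.im)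
    (hreal : ∀ (θ : ℝ) (a : ι → ℂ), Δ *ᵥ (T *ᵥ a - (θ : ℂ) • a) = 0 → Δ *ᵥ a = 0) :
    Δ.PosSemidef := by
  have hinj : ∀ θ : ℂ, θ.im < 0 → IsUnit (T - θ • (1 : Matrix ι ι ℂ)) := by
    intro θ hθ
    rw [← mulVec_injective_iff_isUnit]
    intro x y hxy
    by_contra hne
    refine absurd (heig θ (x - y) (sub_ne_zero.mpr hne) ?_) (not_le.mpr hθ)
    have : (T - θ • (1 : Matrix ι ι ℂ)) *ᵥ (x - y) = 0 := by
      rw [mulVec_sub, sub_eq_zero]; exact hxy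
    rwa [sub_mulVec, smul_mulVec, one_mulVec, sub_eq_zero] at this
  set D := T - (-Complex.I) • (1 : Matrix ι ι ℂ) with hD
  have hDu : IsUnit D.det := (isUnit_iff_isUnit_det _).mp (hinj _ (by simp))
  set M := (T - Complex.I • (1 : Matrix ι ι ℂ)) * D⁻¹ with hM
  have hTD : Commute T D := (Commute.refl T).sub_right ((Commute.one_right T).smul_right _)
  have hTD' : Commute T D⁻¹ := by
    have : D⁻¹ * (T * D) * D⁻¹ = D⁻¹ * (D * T) * D⁻¹ := by rw [hTD.eq]
    rw [Matrix.mul_assoc, Matrix.mul_assoc T D, mul_nonsing_inv _ hDu, ← Matrix.mul_assoc D⁻¹ D,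
      nonsing_inv_mul _ hDu, Matrix.mul_one, Matrix.one_mul] at this
    exact this.symm
  have hmono : ∀ x, star (M *ᵥ x) ⬝ᵥ (Δ *ᵥ (M *ᵥ x)) ≤ star x ⬝ᵥ (Δ *ᵥ x) := by
    intro x
    set y := D⁻¹ *ᵥ x with hy
    have h1 : x = T *ᵥ y + Complex.I • y := by
      have : x = D *ᵥ y := by rw [hy, mulVec_mulVec, mul_nonsing_inv _ hDu, one_mulVec]
      rw [this, hD, sub_mulVec, smul_mulVec, one_mulVec, neg_smul, sub_neg_eq_add]
    have h2 : M *ᵥ x = T *ᵥ y - Complex.I • y := by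
      rw [hM, ← mulVec_mulVec, ← hy, sub_mulVec, smul_mulVec, one_mulVec]
    rw [← sub_nonneg, h2, h1]
    have h3 := add_nonneg (hdiss y) (hdiss y)
    refine h3.trans_eq ?_
    simp only [mulVec_add, mulVec_sub, mulVec_smul, star_add, star_sub, star_smul, add_dotProduct,
      sub_dotProduct, dotProduct_add, dotProduct_sub, smul_dotProduct, dotProduct_smul, smul_eq_mul,
      Complex.star_def, Complex.conj_I]
    ring
  have hmono' : ∀ (k : ℕ) x,
      star (M ^ k *ᵥ x) ⬝ᵥ (Δ *ᵥ (M ^ k *ᵥ x)) ≤ star x ⬝ᵥ (Δ *ᵥ x) := by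
    intro k x
    induction k with
    | zero => simp
    | succ k ih =>
      rw [pow_succ', ← mulVec_mulVec]
      exact (hmono _).trans ih
  -- split into the part on which the powers of `M` tend to zero and a part in the kernel of `Δ`
  let D₀ : Submodule ℂ (ι → ℂ) :=
    { carrier := {v | Filter.Tendsto (fun k : ℕ => M ^ k *ᵥ v) Filter.atTop (nhds 0)}
      zero_mem' := by simp
      add_mem' := fun {a b} ha hb => by simpa [mulVec_add] using Filter.Tendsto.add ha hb
      smul_mem' := fun c a ha => by simpa [mulVec_smul] using Filter.Tendsto.const_smul ha c }
  let D₁ : Submodule ℂ (ι → ℂ) :=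
    { carrier := {v | ∀ k : ℕ, Δ *ᵥ (M ^ k *ᵥ v) = 0}
      zero_mem' := by simp
      add_mem' := fun {a b} ha hb k => by rw [mulVec_add, mulVec_add, ha k, hb k, add_zero]
      smul_mem' := fun c a ha k => by rw [mulVec_smul, mulVec_smul, ha k, smul_zero] }
  have hsup : ∀ x, x ∈ D₀ ⊔ D₁ := by
    refine mem_of_forall_genEigenvector (T := T) fun θ p x hx => ?_
    rcases lt_trichotomy θ.im 0 with hθ | hθ | hθ
    · have := mulVec_injective_iff_isUnit.mpr ((hinj θ hθ).pow p)
      have hx0 : x = 0 := this (hx.trans (mulVec_zero _).symm)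
      rw [hx0]
      exact Submodule.zero_mem _
    · have hθ' : θ = (θ.re : ℂ) := Complex.ext (by simp) (by simp [hθ])
      rw [hθ'] at hx
      have key : ∀ (p : ℕ) (x : ι → ℂ), (T - (θ.re : ℂ) • (1 : Matrix ι ι ℂ)) ^ p *ᵥ x = 0 →
          Δ *ᵥ x = 0 := by
        intro p
        induction p with
        | zero => intro x hx; rw [pow_zero, one_mulVec] at hx; rw [hx, mulVec_zero]
        | succ p ih =>
          intro x hx
          refine hreal θ.re x ?_
          have := ih ((T - (θ.re : ℂ) • (1 : Matrix ι ι ℂ)) *ᵥ x)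
            (by rw [mulVec_mulVec, ← pow_succ, hx])
          rwa [sub_mulVec, smul_mulVec, one_mulVec] at this
      refine Submodule.mem_sup_right fun k => key p _ ?_
      have hc : Commute (T - (θ.re : ℂ) • (1 : Matrix ι ι ℂ)) M := by
        have hcT : Commute T M :=
          ((Commute.refl T).sub_right ((Commute.one_right T).smul_right _)).mul_right hTD'
        exact hcT.sub_left ((Commute.one_left M).smul_left _)
      rw [mulVec_mulVec, (hc.pow_pow p k).eq, ← mulVec_mulVec, hx, mulVec_zero]
    · refine Submodule.mem_sup_left ?_
      have hθI : θ + Complex.I ≠ 0 := fun h => by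
        have := congrArg Complex.im h
        simp at this
        linarith
      have hnorm : ‖(θ - Complex.I) / (θ + Complex.I)‖ < 1 := by
        rw [norm_div, div_lt_one (norm_pos_iff.mpr hθI),
          ← sq_lt_sq₀ (norm_nonneg _) (norm_nonneg _),
          ← Complex.normSq_eq_norm_sq, ← Complex.normSq_eq_norm_sq, Complex.normSq_apply,
          Complex.normSq_apply]
        simp
        nlinarith
      refine tendsto_pow_mulVec hnorm (p := p) ?_
      have hfac : M - ((θ - Complex.I) / (θ + Complex.I)) • (1 : Matrix ι ι ℂ) =
          ((2 * Complex.I / (θ + Complex.I)) • D⁻¹) * (T - θ • (1 : Matrix ι ι ℂ)) := by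
        have h1 : (M - ((θ - Complex.I) / (θ + Complex.I)) • (1 : Matrix ι ι ℂ)) =
            ((T - Complex.I • (1 : Matrix ι ι ℂ)) - ((θ - Complex.I) / (θ + Complex.I)) • D) *
              D⁻¹ := by
          rw [Matrix.sub_mul, Matrix.smul_mul, mul_nonsing_inv _ hDu]
        have h2 : (T - Complex.I • (1 : Matrix ι ι ℂ)) - ((θ - Complex.I) / (θ + Complex.I)) • D =
            (2 * Complex.I / (θ + Complex.I)) • (T - θ • (1 : Matrix ι ι ℂ)) := by
          rw [hD]
          match_scalars <;> field_simp <;> ring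
        have hc : Commute (T - θ • (1 : Matrix ι ι ℂ)) D⁻¹ :=
          hTD'.sub_left ((Commute.one_left _).smul_left _)
        rw [h1, h2, Matrix.smul_mul, hc.eq, Matrix.smul_mul]
      have hc : Commute ((2 * Complex.I / (θ + Complex.I)) • D⁻¹) (T - θ • (1 : Matrix ι ι ℂ)) :=
        (hTD'.sub_left ((Commute.one_left _).smul_left _)).symm.smul_left _
      rw [hfac, hc.mul_pow, ← mulVec_mulVec, hx, mulVec_zero]
  refine PosSemidef.of_dotProduct_mulVec_nonneg hΔ fun x => ?_
  obtain ⟨u, hu, v, hv, rfl⟩ := Submodule.mem_sup.mp (hsup x)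
  have hlim : Filter.Tendsto (fun k : ℕ => star (M ^ k *ᵥ u) ⬝ᵥ (Δ *ᵥ (M ^ k *ᵥ u)))
      Filter.atTop (nhds 0) := by
    have hcont : Continuous fun y : ι → ℂ => star y ⬝ᵥ (Δ *ᵥ y) := by fun_prop
    have := (hcont.tendsto 0).comp (show Filter.Tendsto _ _ _ from hu)
    rwa [mulVec_zero, dotProduct_zero] at this
  refine le_of_tendsto' hlim fun k => ?_
  refine le_trans (le_of_eq ?_) (hmono' k (u + v))
  have hv' : star (M ^ k *ᵥ v) ⬝ᵥ (Δ *ᵥ (M ^ k *ᵥ u)) = 0 := by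
    have h1 := star_mulVec Δ (M ^ k *ᵥ v)
    rw [hv k, hΔ.eq, star_zero] at h1
    rw [dotProduct_mulVec, ← h1, zero_dotProduct]
  rw [mulVec_add, mulVec_add, hv k, add_zero, star_add, add_dotProduct, hv', add_zero]

end Lyapunov

/-! ### The maximal solution of the Lur'e equations -/

/-- A positive semidefinite matrix of rank at most `m` is `F* F` for some `F` with `m` rows. -/
lemma exists_eq_conjTranspose_mul_self {ι : Type*} [Fintype ι] [DecidableEq ι] {M : Matrix ι ι ℂ}
    (hM : M.PosSemidef) {m : ℕ} (hm : M.rank ≤ m) : ∃ F : Matrix (Fin m) ι ℂ, M = Fᴴ * F := by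
  have hH := hM.isHermitian
  set U : Matrix ι ι ℂ := (hH.eigenvectorUnitary : Matrix ι ι ℂ) with hU
  set N : Matrix ι ι ℂ := diagonal (fun j => ((Real.sqrt (hH.eigenvalues j) : ℝ) : ℂ)) * Uᴴ with hN
  have hMN : M = Nᴴ * N := by
    have h1 := hH.spectral_theorem
    rw [Unitary.conjStarAlgAut_apply] at h1
    rw [hN, conjTranspose_mul, conjTranspose_conjTranspose, diagonal_conjTranspose]
    conv_lhs => rw [h1]
    rw [← hU, ← Matrix.mul_assoc, Matrix.mul_assoc U (diagonal _) (diagonal _),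
      diagonal_mul_diagonal]
    congr 3
    ext i
    have := Real.mul_self_sqrt (hM.eigenvalues_nonneg i)
    simp only [Function.comp_apply, Pi.star_apply, Complex.star_def, Complex.conj_ofReal]
    rw [← Complex.ofReal_mul, this]
    rfl
  have hcard : Fintype.card {i // hH.eigenvalues i ≠ 0} ≤ Fintype.card (Fin m) := by
    rw [← hH.rank_eq_card_non_zero_eigs, Fintype.card_fin]
    exact hm
  obtain ⟨f⟩ := Function.Embedding.nonempty_of_card_le hcard
  refine ⟨Matrix.of fun i k => Function.extend f (fun j => N j.1 k) 0 i, ?_⟩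
  ext k l
  refine (congrFun (congrFun hMN k) l).trans ?_
  rw [mul_apply, mul_apply]
  trans ∑ j : {i // hH.eigenvalues i ≠ 0}, Nᴴ k j.1 * N j.1 l
  · refine (Fintype.sum_of_injective Subtype.val Subtype.val_injective _ _ ?_ fun _ => rfl).symm
    intro i hi
    have hi0 : hH.eigenvalues i = 0 := by
      by_contra h
      exact hi ⟨⟨i, h⟩, rfl⟩
    simp [hN, hi0]
  · refine Fintype.sum_of_injective f f.injective _ _ ?_ ?_
    · intro i hi
      have : ¬ ∃ a, f a = i := hi
      simp [Function.extend_apply' _ _ _ this]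
    · intro j
      simp [f.injective.extend_apply]

section Maximal

variable {n m : ℕ} {A Q : Matrix (Fin n) (Fin n) ℂ} {B C : Matrix (Fin n) (Fin m) ℂ}
  {R : Matrix (Fin m) (Fin m) ℂ} {ω : ℝ} {X Y : Matrix (Fin n) (Fin n) ℂ}

lemma eq_zero_of_forall_star_dotProduct_mulVec {M : Matrix (Fin n) (Fin n) ℂ}
    (h : ∀ a b, star a ⬝ᵥ (M *ᵥ b) = 0) : M = 0 := by
  refine ext_of_mulVec_single fun j => ?_
  rw [zero_mulVec]
  exact dotProduct_star_self_eq_zero.mp (h _ _)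

lemma fromRows_one_mulVec (a : Fin n → ℂ) :
    fromRows X (1 : Matrix (Fin n) (Fin n) ℂ) *ᵥ a = Sum.elim (X *ᵥ a) a := by
  rw [fromRows_mulVec, one_mulVec]

lemma isHermitian_of_isSemiStableLagrangian
    (hW : IsSemiStableLagrangian (gram n) (shiftInvert A Q B C R ω) n
      (colSpan (fromRows X (1 : Matrix (Fin n) (Fin n) ℂ)))) : X.IsHermitian := by
  refine (sub_eq_zero.mp (eq_zero_of_forall_star_dotProduct_mulVec fun a b => ?_) :)
  have h := hW.neutral _ ⟨a, fromRows_one_mulVec a⟩ _ ⟨b, fromRows_one_mulVec b⟩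
  rw [form_gram, ← mul_sub] at h
  have h2 := (mul_eq_zero.mp h).resolve_left Complex.I_ne_zero
  rw [sub_mulVec, dotProduct_sub, star_dotProduct_conjTranspose_mulVec, ← neg_sub, h2, neg_zero]

/-- The operator `T` on `ℂⁿ` to which `S` restricts on an invariant graph, and the vectors `(T a,
b)` in the kernel of the matrix of the linear matrix inequality which it provides. -/
lemma exists_closedLoop
    (hω : IsUnit ((Complex.I * ω) • evenE n m - evenA A Q B C R).det)
    (hW : ∀ w ∈ colSpan (fromRows X (1 : Matrix (Fin n) (Fin n) ℂ)),
      shiftInvert A Q B C R ω *ᵥ w ∈ colSpan (fromRows X (1 : Matrix (Fin n) (Fin n) ℂ))) :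
    ∃ T : Matrix (Fin n) (Fin n) ℂ, ∀ a,
      shiftInvert A Q B C R ω *ᵥ Sum.elim (X *ᵥ a) a = Sum.elim (X *ᵥ (T *ᵥ a)) (T *ᵥ a) ∧
      ∃ b, A *ᵥ (T *ᵥ a) + B *ᵥ b = (Complex.I * ω) • (T *ᵥ a) - Complex.I • a ∧
        lmi A Q B C R X *ᵥ Sum.elim (T *ᵥ a) b = 0 := by
  obtain ⟨T, hT⟩ := exists_mul_eq_mul hW
  refine ⟨T, fun a => ?_⟩
  have hS : shiftInvert A Q B C R ω *ᵥ Sum.elim (X *ᵥ a) a =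
      Sum.elim (X *ᵥ (T *ᵥ a)) (T *ᵥ a) := by
    rw [← fromRows_one_mulVec, mulVec_mulVec, hT, ← mulVec_mulVec, fromRows_one_mulVec]
  refine ⟨hS, ?_⟩
  obtain ⟨b, hb⟩ := (shiftInvert_mulVec_iff hω _ _).mp hS
  rw [smul_evenE_sub_evenA_mulVec, gram_mulVec] at hb
  obtain ⟨h12, h3⟩ := Sum.elim_eq_iff.mp hb
  obtain ⟨h1, h2⟩ := Sum.elim_eq_iff.mp h12
  have h1' : A *ᵥ (T *ᵥ a) + B *ᵥ b = (Complex.I * ω) • (T *ᵥ a) - Complex.I • a := by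
    rw [sub_eq_add_neg, ← h1]; abel
  refine ⟨b, h1', ?_⟩
  rw [lmi_mulVec, h1', mulVec_sub, mulVec_smul, mulVec_smul, ← h2]
  ext (i | i)
  · simp only [Sum.elim_inl, Pi.add_apply, Pi.sub_apply, Pi.zero_apply]; ring
  · have := congrFun h3 i
    simp only [Sum.elim_inr, Pi.add_apply, Pi.zero_apply] at this ⊢
    linear_combination this

lemma lmi_isHermitian (hQ : Q.IsHermitian) (hR : R.IsHermitian) (hX : X.IsHermitian) :
    (lmi A Q B C R X).IsHermitian := by
  rw [lmi, isHermitian_fromBlocks_iff]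
  refine ⟨?_, ?_, ?_, hR⟩
  · rw [IsHermitian, conjTranspose_add, conjTranspose_add, conjTranspose_mul, conjTranspose_mul,
      conjTranspose_conjTranspose, hQ.eq, hX.eq, add_comm (X * A)]
  · rw [conjTranspose_add, conjTranspose_mul, hX.eq]
  · rw [conjTranspose_add, conjTranspose_mul, conjTranspose_conjTranspose,
      conjTranspose_conjTranspose, hX.eq]

lemma star_dotProduct_mulVec_comm {ι : Type*} [Fintype ι] {M : Matrix ι ι ℂ} (hM : M.IsHermitian)
    (x y : ι → ℂ) : star x ⬝ᵥ (M *ᵥ y) = star (M *ᵥ x) ⬝ᵥ y := by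
  rw [star_mulVec, hM.eq, dotProduct_mulVec]

/-- If the kernel of the matrix of the linear matrix inequality is mapped onto `ℂⁿ` by
`[A - iω I, B]`, the matrix is positive semidefinite and its rank is at most `m`. -/
lemma posSemidef_lmi (hQ : Q.IsHermitian) (hX : X.IsHermitian) (hY : SolvesLMI A Q B C R Y)
    (h : ∀ c, ∃ (a : Fin n → ℂ) (b : Fin m → ℂ), A *ᵥ a + B *ᵥ b - (Complex.I * ω) • a = c ∧
      lmi A Q B C R X *ᵥ Sum.elim a b = 0) :
    (lmi A Q B C R X).PosSemidef ∧ (lmi A Q B C R X).rank ≤ m := by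
  have hH := lmi_isHermitian (A := A) (B := B) (C := C) hQ hY.R_isHermitian hX
  constructor
  · refine PosSemidef.of_dotProduct_mulVec_nonneg hH fun v => ?_
    rw [← Sum.elim_comp_inl_inr v]
    set a₀ := v ∘ Sum.inl
    set b₀ := v ∘ Sum.inr
    obtain ⟨a, b, hab, hk⟩ := h (A *ᵥ a₀ + B *ᵥ b₀ - (Complex.I * ω) • a₀)
    have hpop := re_popov_nonneg hY X (ρ := 1) (κ := ω) (e := a₀ - a) (b := b₀ - b) (by
      rw [Complex.ofReal_one, one_smul, mulVec_sub, mulVec_sub, smul_sub]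
      linear_combination (exp := 1) -hab)
    have hsub : Sum.elim (((1 : ℝ) : ℂ) • (a₀ - a)) (b₀ - b) = Sum.elim a₀ b₀ - Sum.elim a b := by
      ext (i | i) <;> simp
    have hk' : star (Sum.elim a b) ⬝ᵥ (lmi A Q B C R X *ᵥ Sum.elim a₀ b₀) = 0 := by
      rw [star_dotProduct_mulVec_comm hH, hk, star_zero, zero_dotProduct]
    rwa [hsub, mulVec_sub, hk, sub_zero, star_sub, sub_dotProduct, hk', sub_zero] at hpop
  · have h1 := LinearMap.finrank_range_add_finrank_ker (lmi A Q B C R X).mulVecLin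
    rw [Module.finrank_fintype_fun_eq_card, Fintype.card_sum, Fintype.card_fin,
      Fintype.card_fin] at h1
    have h2 : n ≤ Module.finrank ℂ (LinearMap.ker (lmi A Q B C R X).mulVecLin) := by
      let f : (Fin n ⊕ Fin m → ℂ) →ₗ[ℂ] (Fin n → ℂ) :=
        (fromCols (A - (Complex.I * ω) • (1 : Matrix (Fin n) (Fin n) ℂ)) B).mulVecLin
      have hf : Function.Surjective
          (f.domRestrict (LinearMap.ker (lmi A Q B C R X).mulVecLin)) := by
        intro c
        obtain ⟨a, b, hab, hk⟩ := h c
        refine ⟨⟨Sum.elim a b, hk⟩, ?_⟩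
        rw [LinearMap.domRestrict_apply, mulVecLin_apply, fromCols_mulVec, ← hab]
        simp only [Sum.elim_comp_inl, Sum.elim_comp_inr, sub_mulVec, smul_mulVec, one_mulVec]
        abel
      have := LinearMap.finrank_le_finrank_of_surjective hf
      simpa using this
    have h3 : (lmi A Q B C R X).rank =
      Module.finrank ℂ (LinearMap.range (lmi A Q B C R X).mulVecLin) := rfl
    omega

/-- The Lur'e equations cannot be solved with fewer than `m` rows: otherwise `[[A - iω, B], [K, L]]`
has a nonzero kernel vector `(a, b)`, and `(X a, a, b)` is in the kernel of `iω ℰ - 𝒜`. -/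
lemma LureEq.le_of_isUnit (hω : IsUnit ((Complex.I * ω) • evenE n m - evenA A Q B C R).det)
    {q : ℕ} {K : Matrix (Fin q) (Fin n) ℂ} {L : Matrix (Fin q) (Fin m) ℂ}
    (h : LureEq A Q B C R X K L) : m ≤ q := by
  obtain ⟨hX, h1, h2, h3⟩ := h
  by_contra! hlt
  let N := fromBlocks (A - (Complex.I * ω) • (1 : Matrix (Fin n) (Fin n) ℂ)) B K L
  have hker : LinearMap.ker N.mulVecLin ≠ ⊥ := by
    refine LinearMap.ker_ne_bot_of_finrank_lt ?_
    simpa using hlt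
  obtain ⟨v, hv, hv0⟩ := Submodule.exists_mem_ne_zero_of_ne_bot hker
  rw [← Sum.elim_comp_inl_inr v] at hv hv0
  set a := v ∘ Sum.inl
  set b := v ∘ Sum.inr
  rw [LinearMap.mem_ker, mulVecLin_apply, fromBlocks_mulVec] at hv
  simp only [Sum.elim_comp_inl, Sum.elim_comp_inr] at hv
  have e1 : A *ᵥ a - (Complex.I * ω) • a + B *ᵥ b = 0 := by
    have : (A - (Complex.I * ω) • (1 : Matrix (Fin n) (Fin n) ℂ)) *ᵥ a + B *ᵥ b = 0 := by
      ext i; exact congrFun hv (Sum.inl i)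
    rwa [sub_mulVec, smul_mulVec, one_mulVec] at this
  have e2 : K *ᵥ a + L *ᵥ b = 0 := by ext i; exact congrFun hv (Sum.inr i)
  have h2' : Bᴴ * X + Cᴴ = Lᴴ * K := by
    have := congrArg conjTranspose h2
    rwa [conjTranspose_add, conjTranspose_mul, conjTranspose_mul, conjTranspose_conjTranspose,
      hX.eq] at this
  have f1 : Aᴴ *ᵥ X *ᵥ a + X *ᵥ A *ᵥ a + Q *ᵥ a + X *ᵥ B *ᵥ b + C *ᵥ b = 0 := by
    have : (Aᴴ * X + X * A + Q) *ᵥ a + (X * B + C) *ᵥ b = 0 := by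
      rw [h1, h2, ← mulVec_mulVec, ← mulVec_mulVec, ← mulVec_add, e2, mulVec_zero]
    rw [← this]
    simp only [add_mulVec, mulVec_mulVec]
    abel
  have f2 : Bᴴ *ᵥ X *ᵥ a + Cᴴ *ᵥ a + R *ᵥ b = 0 := by
    have : (Bᴴ * X + Cᴴ) *ᵥ a + R *ᵥ b = 0 := by
      rw [h2', h3, ← mulVec_mulVec, ← mulVec_mulVec, ← mulVec_add, e2, mulVec_zero]
    rw [← this]
    simp only [add_mulVec, mulVec_mulVec]
  have hz : ((Complex.I * ω) • evenE n m - evenA A Q B C R) *ᵥ Sum.elim (Sum.elim (X *ᵥ a) a) b =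
      0 := by
    rw [smul_evenE_sub_evenA_mulVec, e1, f2]
    have : Aᴴ *ᵥ X *ᵥ a + (Complex.I * ω) • X *ᵥ a + Q *ᵥ a + C *ᵥ b = 0 := by
      have e3 := congrArg (X *ᵥ ·) e1
      simp only [mulVec_add, mulVec_sub, mulVec_smul, mulVec_zero] at e3
      linear_combination (exp := 1) f1 - e3
    rw [this]
    ext ((i | i) | i) <;> rfl
  have hinj := mulVec_injective_iff_isUnit.mpr ((isUnit_iff_isUnit_det _).mpr hω)
  have hab := hinj (hz.trans (mulVec_zero _).symm)
  refine hv0 ?_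
  ext (i | i)
  · exact congrFun hab (Sum.inl (Sum.inr i))
  · exact congrFun hab (Sum.inr i)

/-- If the graph of `X` is a semi-stable Lagrangian subspace, `X` is the maximal solution of the
Lur'e equations. -/
theorem isMaximalSolution (hQ : Q.IsHermitian) (hstab : Stabilizable A B)
    (hfeas : ∃ Y, SolvesLMI A Q B C R Y)
    (hω : IsUnit ((Complex.I * ω) • evenE n m - evenA A Q B C R).det)
    (hW : IsSemiStableLagrangian (gram n) (shiftInvert A Q B C R ω) n
      (colSpan (fromRows X (1 : Matrix (Fin n) (Fin n) ℂ)))) :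
    IsMaximalSolution A Q B C R X := by
  have hX := isHermitian_of_isSemiStableLagrangian hW
  obtain ⟨T, hT⟩ := exists_closedLoop hω hW.invariant
  obtain ⟨Y₀, hY₀⟩ := hfeas
  constructor
  · obtain ⟨hpsd, hrank⟩ := posSemidef_lmi (ω := ω) hQ hX hY₀ (fun c => by
      obtain ⟨-, b, hb, hk⟩ := hT (Complex.I • c)
      refine ⟨_, b, ?_, hk⟩
      rw [hb, smul_smul, Complex.I_mul_I]
      module)
    obtain ⟨F, hF⟩ := exists_eq_conjTranspose_mul_self hpsd hrank
    refine ⟨m, ⟨F.toCols₁, F.toCols₂, ?_⟩, fun q X' K' L' h => h.le_of_isUnit hω⟩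
    rw [← fromCols_toCols F, conjTranspose_fromCols_eq_fromRows_conjTranspose,
      fromRows_mul_fromCols, lmi, fromBlocks_inj] at hF
    exact ⟨hX, hF.1, hF.2.1, hF.2.2.2⟩
  · intro Y hY
    set Δ := X - Y with hΔdef
    have hΔ : Δ.IsHermitian := hX.sub hY.1
    -- the quadratic form of `Y` along the trajectories on which that of `X` vanishes
    have hform : ∀ a b, A *ᵥ (T *ᵥ a) + B *ᵥ b = (Complex.I * ω) • (T *ᵥ a) - Complex.I • a →
        lmi A Q B C R X *ᵥ Sum.elim (T *ᵥ a) b = 0 →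
        star (Sum.elim (T *ᵥ a) b) ⬝ᵥ (lmi A Q B C R Y *ᵥ Sum.elim (T *ᵥ a) b) =
          Complex.I * (star (T *ᵥ a) ⬝ᵥ (Δ *ᵥ a)) -
            Complex.I * (star a ⬝ᵥ (Δ *ᵥ (T *ᵥ a))) := by
      intro a b hb hk
      rw [star_dotProduct_lmi_mulVec Y X, hk, hb, dotProduct_zero, zero_add, ← neg_sub X Y, ← hΔdef]
      simp only [neg_mulVec, mulVec_sub, mulVec_smul, star_sub, star_smul, sub_dotProduct,
        smul_dotProduct, dotProduct_neg, dotProduct_sub, dotProduct_smul, smul_eq_mul,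
        Complex.star_def, map_mul, Complex.conj_I, Complex.conj_ofReal]
      ring
    refine posSemidef_of_dissipative (T := T) hΔ ?_ ?_ ?_
    · intro a
      obtain ⟨-, b, hb, hk⟩ := hT a
      rw [← hform a b hb hk]
      exact hY.2.dotProduct_mulVec_nonneg _
    · intro θ a ha hθ
      refine hW.im_nonneg _ ⟨a, fromRows_one_mulVec a⟩ θ ?_ ?_
      · intro h
        exact ha (funext fun i => congrFun h (Sum.inr i))
      · rw [(hT a).1, hθ, mulVec_smul]
        ext (i | i) <;> rfl
    · intro θ a ha
      obtain ⟨-, b, hb, hk⟩ := hT a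
      have hTa : Δ *ᵥ (T *ᵥ a) = (θ : ℂ) • (Δ *ᵥ a) := by
        rwa [mulVec_sub, mulVec_smul, sub_eq_zero] at ha
      have hzero : lmi A Q B C R Y *ᵥ Sum.elim (T *ᵥ a) b = 0 := by
        refine (hY.2.dotProduct_mulVec_zero_iff _).mp ?_
        refine (hform a b hb hk).trans ?_
        rw [star_dotProduct_mulVec_comm hΔ (T *ᵥ a), hTa, dotProduct_smul,
          star_dotProduct_mulVec_comm hΔ a, star_smul, smul_dotProduct, Complex.star_def,
          Complex.conj_ofReal, sub_self]
      have hdiff : lmi A Q B C R X *ᵥ Sum.elim (T *ᵥ a) b -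
          lmi A Q B C R Y *ᵥ Sum.elim (T *ᵥ a) b = 0 := by rw [hk, hzero, sub_zero]
      rw [lmi_mulVec, lmi_mulVec, hb] at hdiff
      have d1 : Aᴴ *ᵥ (Δ *ᵥ (T *ᵥ a)) +
          Δ *ᵥ ((Complex.I * ω) • (T *ᵥ a) - Complex.I • a) = 0 := by
        rw [hΔdef, sub_mulVec, sub_mulVec, mulVec_sub Aᴴ]
        ext i
        have := congrFun hdiff (Sum.inl i)
        simp only [Pi.sub_apply, Sum.elim_inl, Pi.add_apply, Pi.zero_apply] at this ⊢
        linear_combination this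
      have d2 : Bᴴ *ᵥ (Δ *ᵥ (T *ᵥ a)) = 0 := by
        rw [hΔdef, sub_mulVec, mulVec_sub Bᴴ]
        ext i
        have := congrFun hdiff (Sum.inr i)
        simp only [Pi.sub_apply, Sum.elim_inr, Pi.add_apply, Pi.zero_apply] at this ⊢
        linear_combination this
      refine hstab.eq_zero_of_smul (ω := ω) (θ := θ) ?_ ?_
      · rw [mulVec_sub, mulVec_smul, mulVec_smul, hTa, mulVec_smul] at d1
        rw [← sub_eq_zero, ← d1]
        module
      · rw [← mulVec_smul, ← hTa, d2]

end Maximal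

lemma comap_proj_colSpan {n m : ℕ} (V₁ : Matrix (Fin n ⊕ Fin n) (Fin n) ℂ) :
    (colSpan V₁).comap (proj n m) =
      colSpan (fromBlocks V₁ 0 0 (1 : Matrix (Fin m) (Fin m) ℂ)) := by
  ext x
  constructor
  · rintro ⟨c, hc⟩
    refine ⟨Sum.elim c (x ∘ Sum.inr), ?_⟩
    rw [mulVecLin_apply] at hc ⊢
    rw [fromBlocks_mulVec, Sum.elim_comp_inl, Sum.elim_comp_inr, zero_mulVec, zero_mulVec, add_zero,
      zero_add, one_mulVec, hc, sumElim_proj]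
  · rintro ⟨c, rfl⟩
    refine ⟨c ∘ Sum.inl, ?_⟩
    rw [mulVecLin_apply, mulVecLin_apply, fromBlocks_mulVec, proj_sumElim, zero_mulVec, add_zero]

end Lure

end

theorem theorem6p1 (n m : ℕ)
    (A Q : Matrix (Fin n) (Fin n) ℂ) (B C : Matrix (Fin n) (Fin m) ℂ)
    (R : Matrix (Fin m) (Fin m) ℂ) (hQ : Q.IsHermitian)
    (hstab : Lure.Stabilizable A B)
    (hreg : Lure.IsRegular (Lure.evenE n m) (Lure.evenA A Q B C R))
    (hfeas : ∃ Y, Lure.SolvesLMI A Q B C R Y)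
    (γ : ℝ) (hγ : 0 < γ) (hssf : IsUnit (Lure.ssfLeft A Q B C R γ).det) :
    -- the reduced pencil arises from the Cayley transform by splitting off `(s - 1) I_m`
    (∃ (P : Matrix ((Fin n ⊕ Fin n) ⊕ Fin m) ((Fin n ⊕ Fin n) ⊕ Fin m) ℂ)
        (Z₁ Z₂ : Matrix (Fin m) (Fin n ⊕ Fin n) ℂ), IsUnit P.det ∧
        P * Lure.cayleyE γ (Lure.evenE n m) (Lure.evenA A Q B C R) =
          Matrix.fromBlocks (Lure.redE A Q B C R γ) 0 Z₁ 1 ∧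
        P * Lure.cayleyA γ (Lure.evenE n m) (Lure.evenA A Q B C R) =
          Matrix.fromBlocks (Lure.redA A Q B C R γ) 0 Z₂ 1) ∧
    -- it is symplectic and weakly d-split, and has a canonical d-semi-unstable subspace
    Lure.IsSymplectic (Lure.redE A Q B C R γ) (Lure.redA A Q B C R γ) ∧
    Lure.IsWeaklyDSplit (Lure.redE A Q B C R γ) (Lure.redA A Q B C R γ) n n ∧
    (∃ V₁ : Matrix (Fin n ⊕ Fin n) (Fin n) ℂ, Lure.IsCanonicalDSemiUnstable
      (Lure.redE A Q B C R γ) (Lure.redA A Q B C R γ) n n (Lure.colSpan V₁)) ∧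
    ∃ 𝒱 : Submodule ℂ ((Fin n ⊕ Fin n) ⊕ Fin m → ℂ),
      (Lure.IsStableLagrangian A Q B C R 𝒱 ∧
        ∀ 𝒱', Lure.IsStableLagrangian A Q B C R 𝒱' → 𝒱' = 𝒱) ∧
      ∀ V₁ : Matrix (Fin n ⊕ Fin n) (Fin n) ℂ,
        Lure.IsCanonicalDSemiUnstable (Lure.redE A Q B C R γ) (Lure.redA A Q B C R γ) n n
          (Lure.colSpan V₁) →
        (∃ V₂ : Matrix (Fin m) (Fin n) ℂ,
          𝒱 = Lure.colSpan (Matrix.fromBlocks V₁ 0 V₂ (1 : Matrix (Fin m) (Fin m) ℂ))) ∧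
        ∀ X : Matrix (Fin n) (Fin n) ℂ,
          Lure.colSpan V₁ = Lure.colSpan (Matrix.fromRows X (1 : Matrix (Fin n) (Fin n) ℂ)) →
          Lure.IsMaximalSolution A Q B C R X := by
  obtain ⟨Y, hY⟩ := hfeas
  obtain ⟨ω, hω⟩ := hreg.exists_imaginary
  have hω' := isUnit_iff_ne_zero.mpr hω
  obtain ⟨hZ, hS⟩ := Lure.reduced_mul_shiftInvert hγ hssf hω'
  have hdef := Lure.isDefiniteOn hQ hstab hY hω'
  have hcard : Fintype.card (Fin n ⊕ Fin n) = 2 * n := by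
    rw [Fintype.card_sum, Fintype.card_fin, two_mul]
  have hab : Complex.I * ω - γ ≠ Complex.I * ω + γ := by
    intro h
    have := congrArg Complex.re h
    simp at this
    linarith
  have hb : Complex.I * ω + γ ≠ 0 := by
    intro h
    have := congrArg Complex.re h
    simp at this
    exact hγ.ne' this
  have hregr : Lure.IsRegular (Lure.redE A Q B C R γ) (Lure.redA A Q B C R γ) := by
    refine ⟨(Complex.I * ω - γ) / (Complex.I * ω + γ), fun h => hZ.ne_zero ?_⟩
    have : (Complex.I * ω - γ) • Lure.redE A Q B C R γ -
        (Complex.I * ω + γ) • Lure.redA A Q B C R γ = (Complex.I * ω + γ) •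
          (((Complex.I * ω - γ) / (Complex.I * ω + γ)) • Lure.redE A Q B C R γ -
            Lure.redA A Q B C R γ) := by
      rw [smul_sub, smul_smul, mul_div_cancel₀ _ hb]
    rw [this, det_smul, h, mul_zero]
  have hK : ∀ K : Lure.KroneckerForm (Lure.redE A Q B C R γ) (Lure.redA A Q B C R γ),
      K.IsChainOperator (Lure.shiftInvert A Q B C R ω)
        (fun j => (K.block j).theta (Complex.I * ω - γ) (Complex.I * ω + γ)) ∧
      K.IsCompatible fun j => (K.block j).theta (Complex.I * ω - γ) (Complex.I * ω + γ) := by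
    intro K
    obtain ⟨h1, h2⟩ := K.isChainOperator hab hb hZ hS
    exact ⟨h2, Lure.isCompatible hγ ω K h1⟩
  obtain ⟨K⟩ := hregr.nonempty_kroneckerForm
  have hsplit := K.weaklyDSplit hdef (hK K).1 (hK K).2 hcard
  have hL := K.isSemiStableLagrangian hdef (hK K).1 (hK K).2 hcard hsplit
  obtain ⟨Z₁, Z₂, hZ₁, hZ₂⟩ := Lure.exists_reduction hssf
  refine ⟨⟨_, Z₁, Z₂, ?_, hZ₁, hZ₂⟩, Lure.isSymplectic_red hQ hY.R_isHermitian hssf,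
    ⟨K, hsplit⟩, ?_, K.dSemiUnstableSpan.comap (Lure.proj n m),
    ⟨hL.isStableLagrangian hω', ?_⟩, ?_⟩
  · rw [det_neg]
    exact (isUnit_one.neg.pow _).mul (isUnit_nonsing_inv_det_iff.mpr hssf)
  · obtain ⟨V₁, hV₁, -⟩ := Lure.exists_colSpan_eq _ hL.finrank_eq
    exact ⟨V₁, K, hsplit, hV₁.symm⟩
  · intro 𝒱' h𝒱'
    obtain ⟨W, hW, rfl⟩ := h𝒱'.exists_eq_comap hω'
    rw [K.eq_dSemiUnstableSpan hdef (hK K).1 (hK K).2 hcard hsplit hW]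
  · rintro V₁ ⟨K', hsplit', hV₁⟩
    -- the canonical subspace does not depend on the Kronecker form
    have hL' := K'.isSemiStableLagrangian hdef (hK K').1 (hK K').2 hcard hsplit'
    have hKK := K.eq_dSemiUnstableSpan hdef (hK K).1 (hK K).2 hcard hsplit hL'
    refine ⟨⟨0, ?_⟩, fun X hX => ?_⟩
    · rw [← hKK, hV₁, Lure.comap_proj_colSpan]
    · rw [hV₁, hX] at hL'
      exact Lure.isMaximalSolution hQ hstab ⟨Y, hY⟩ hω' hL'
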